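/- There is a constant $\Lambda = 0.57716\cdots$ (more precisely $0.57716\le \Lambda<0.57717$; in particular $\Lambda \ge 1/2$) and a constant $C\ge 0$ such that the following holds for every $\lambda\in[0,\Lambda]$. For $0\le\lambda<1$ let $P_\lambda(r) = 2\,\mathrm{arctanh}(\lambda\tanh(r/2))$, let $$\mathcal E(\psi_0,\psi_1)=\frac12\int_0^\infty\Big(\psi_1^2+(\partial_r\psi_0)^2+\frac{\sinh^2\psi_0}{\sinh^2 r}\Big)\sinh r\,dr ,$$ and let $\mathcal E_\lambda$ be the set of pairs $(\psi_0,\psi_1)$ on $(0,\infty)$ with $\mathcal E(\psi_0,\psi_1)<\infty$ and $\lim_{r\to\infty}\psi_0(r)=2\,\mathrm{arctanh}\,\lambda$, where $\psi_0$ is locally absolutely continuous and $\psi_1$ is measurable, with the distance given by the norm $\|(\phi_0,\phi_1)\|_{\mathcal H_0}^2=\int_0^\infty\big((\partial_r\phi_0)^2+\frac{\phi_0^2}{\sinh^2 r}+\phi_1^2\big)\sinh r\,dr$ of the difference. Let $\vec\psi=(\psi,\psi_t)\in C_t([0,\infty);\mathcal E_\lambda)$ be a finite-energy equivariant wave map $\mathbb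 R\times\mathbb H^2\to\mathbb H^2$, i.e. a weak solution of $$\psi_{tt}-\psi_{rr}-\coth r\,\psi_r+\frac{\sinh 2\psi}{2\sinh^2 r}=0 ,$$ with energy $\mathcal E=\mathcal E(\vec\psi(0))$, and put $u(t,r)=(\psi(t,r)-P_\lambda(r))/\sinh r$. Then $$\int_0^\infty\int_0^\infty |u(t,r)|^4\,\sinh^3 r\,dr\,dt\le C\,\mathcal E .$$ The constant $C$ depends neither on $\lambda\in[0,\Lambda]$ nor on $\psi$. -/

import Mathlib

open Real Set Filter Topology MeasureTheory
open scoped NNReal ENNReal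

namespace HypWaveMap

/-- The equivariant harmonic map `P_λ(r) = 2 artanh (λ tanh (r/2))` from the hyperbolic plane to
itself. -/
noncomputable def harmonicMap (lam r : ℝ) : ℝ :=
  2 * artanh (lam * tanh (r / 2))

/-- Radial functions on the hyperbolic plane minus its origin that are locally absolutely
continuous in the radial variable. Such a function is differentiable almost everywhere and is the
integral of its derivative, so below `deriv` computes its weak derivative. -/
def LocallyAC (f : ℝ → ℝ) : Prop :=
  ∀ a b : ℝ, 0 < a → a ≤ b → AbsolutelyContinuousOnInterval f a b

/-- The energy
`½ ∫₀^∞ (ψ₁² + (∂_r ψ₀)² + sinh² ψ₀ / sinh² r) sinh r dr`, with values in `[0, ∞]`. -/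
noncomputable def energy (ψ₀ ψ₁ : ℝ → ℝ) : ℝ≥0∞ :=
  ∫⁻ r in Ioi (0 : ℝ), ENNReal.ofReal
    ((1 / 2) * (ψ₁ r ^ 2 + deriv ψ₀ r ^ 2 + sinh (ψ₀ r) ^ 2 / sinh r ^ 2) * sinh r)

/-- The square of the norm of `H₀`:
`∫₀^∞ ((∂_r φ₀)² + φ₀² / sinh² r + φ₁²) sinh r dr`, with values in `[0, ∞]`. -/
noncomputable def normSqH0 (φ₀ φ₁ : ℝ → ℝ) : ℝ≥0∞ :=
  ∫⁻ r in Ioi (0 : ℝ), ENNReal.ofReal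
    ((deriv φ₀ r ^ 2 + φ₀ r ^ 2 / sinh r ^ 2 + φ₁ r ^ 2) * sinh r)

/-- The finite energy class `E_λ`: pairs `(ψ₀, ψ₁)` of finite energy with
`ψ₀(r) → 2 artanh λ` as `r → ∞`. (Finite energy forces `ψ₀(r) → 0` as `r → 0`.) -/
structure MemEnergyClass (lam : ℝ) (ψ₀ ψ₁ : ℝ → ℝ) : Prop where
  locallyAC : LocallyAC ψ₀
  aemeasurable : AEMeasurable ψ₁ (volume.restrict (Ioi 0))
  energy_lt_top : energy ψ₀ ψ₁ < ⊤
  tendsto_atTop : Tendsto ψ₀ atTop (𝓝 (2 * artanh lam))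

/-- Smooth radial test functions with compact support in `(0, ∞)`. -/
structure IsTestFunction (χ : ℝ → ℝ) : Prop where
  smooth : ContDiff ℝ (⊤ : ℕ∞) χ
  hasCompactSupport : HasCompactSupport χ
  tsupport_subset : tsupport χ ⊆ Ioi 0

/-- `(ψ, ψ') ∈ C_t([0, ∞); E_λ)` is an equivariant wave map: `ψ' = ∂_t ψ`, and
`ψ_tt - ψ_rr - coth r ψ_r + sinh (2ψ) / (2 sinh² r) = 0` holds in the weak sense. The trajectory is
continuous for the `H₀` distance on `E_λ`; the equation is tested on each time slice against
`χ(r)`, with respect to the volume `sinh r dr` of the hyperbolic plane, so that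
`-ψ_rr - coth r ψ_r = -(sinh r)⁻¹ (sinh r ψ_r)_r` becomes `∫ ψ_r χ' sinh r dr`. Test functions
supported away from `r = 0` are dense in the radial energy space, so they suffice. Smooth solutions
are solutions in this sense. -/
structure IsFiniteEnergyWaveMap (lam : ℝ) (ψ ψ' : ℝ → ℝ → ℝ) : Prop where
  mem_energyClass : ∀ t : ℝ, 0 ≤ t → MemEnergyClass lam (ψ t) (ψ' t)
  continuous : ∀ t : ℝ, 0 ≤ t →
    Tendsto (fun s => normSqH0 (fun r => ψ s r - ψ t r) (fun r => ψ' s r - ψ' t r))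
      (𝓝[Ici 0] t) (𝓝 0)
  hasDeriv_position : ∀ χ : ℝ → ℝ, IsTestFunction χ → ∀ t : ℝ, 0 ≤ t →
    HasDerivWithinAt (fun s => ∫ r in Ioi (0 : ℝ), ψ s r * χ r * sinh r)
      (∫ r in Ioi (0 : ℝ), ψ' t r * χ r * sinh r) (Ici 0) t
  hasDeriv_velocity : ∀ χ : ℝ → ℝ, IsTestFunction χ → ∀ t : ℝ, 0 ≤ t →
    HasDerivWithinAt (fun s => ∫ r in Ioi (0 : ℝ), ψ' s r * χ r * sinh r)
      (-∫ r in Ioi (0 : ℝ), (deriv (ψ t) r * deriv χ r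
          + sinh (2 * ψ t r) / (2 * sinh r ^ 2) * χ r) * sinh r) (Ici 0) t

/-- The associated function `u = (ψ - P_λ) / sinh r` on four-dimensional hyperbolic space. -/
noncomputable def fourDim (lam : ℝ) (ψ : ℝ → ℝ → ℝ) (t r : ℝ) : ℝ :=
  (ψ t r - harmonicMap lam r) / sinh r

end HypWaveMap

/-! Put φ = ψ − P with P = P_λ. Since |u|⁴ sinh³ r = φ⁴ / sinh r, the claim is a spacetime bound for
φ⁴ / sinh r, and a Morawetz multiplier supplies it. With respect to dr, φ solves φ_tt − φ_rr = N on
the half line, with coth r φ_r as part of N (`IsFiniteEnergyWaveMap.weakWave`). The functional is ∫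
((cosh r − 1) φ_t φ_r + ½ sinh r φ_t φ) dr, that is, the multiplier tanh(r/2) ∂_r + ½ for the volume
sinh r dr. Its time derivative (`morawetz_density_eq`) is a nonpositive multiple of φ_r² minus 1 /
(sinh r (cosh r + 1)) times an expression in ψ, P and cosh r. The dangerous part of that expression
comes from the variation of P with r. By `morawetz_pointwise` the expression is still at least (cosh
r + 1) φ⁴ / 420 when cosh P ≤ 2 and 3 cosh P − 2 ≤ cosh r, and `cosh_harmonicMap_le` derives both
conditions from λ² ≤ 1/3. This admits Λ = 0.57716.

The functional at one time is bounded by the energy at that time, uniformly in λ (`deviation_le`):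
Hardy's inequality `MemH.hardy` controls φ itself, and the Bogomolny argument `cosh_sub_one_le`
bounds the energy of P by that of ψ.

To let time tend to infinity the energy must not grow, and this is not part of the definition of a
weak solution: ψ_t is not an admissible test function. `twiceEnergy_le` compares ψ with its
translate by ε. The virial identity for the sum and the difference of ψ(t + ε) and ψ(t) expresses
the derivative of ∫ (ψ_t(t + ε) + ψ_t(t)) (ψ(t + ε) − ψ(t)) sinh r dr as the increment of the
Lagrangian, up to an error that is cubic in ψ(t + ε) − ψ(t). After division by ε, the limit ε → 0
gives the energy inequality, provided that the integral over time of (ψ(t + ε) − ψ(t))² / sinh r is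
O(ε); the third factor tends to 0 uniformly. Near the origin this O(ε) bound does not follow from
the energy. It comes from `local_smoothing`, a second Morawetz estimate around the map λ = 0 whose
weights are flattened at scale ε, through `exists_integral_sq_sub_le`.

The quadratic identities are justified at the regularity at hand without mollification. A localised
null derivative u_t ± u_r solves a transport equation; followed along characteristics it becomes a
norm differentiable curve in L² (`IsTransport.hasDerivWithinAt`), and pairings of two such curves of
equal speed can be differentiated. Momentum and virial identities follow by polarisation.

All identities are localised away from 0 and ∞ by cutoffs in log sinh r, whose derivatives are
O(coth r / N). Against the energy density this is an O(1 / N) error per unit time, so taking the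
time horizon equal to N leaves a bounded total error. -/

namespace HypWaveMap

/-! ### Weak derivatives of curves in a Hilbert space -/

/-- A continuous curve in a Hilbert space whose pairings with a dense set are differentiable, with
continuous derivative, is differentiable in norm. -/
theorem hasDerivWithinAt_of_weak {H : Type*} [NormedAddCommGroup H] [InnerProductSpace ℝ H]
    [CompleteSpace H] {D : Set H} (hD : Dense D) {a b : ℝ → H}
    (ha : ContinuousOn a (Ici 0)) (hb : ContinuousOn b (Ici 0))
    (hab : ∀ χ ∈ D, ∀ t : ℝ, 0 ≤ t →
      HasDerivWithinAt (fun s => inner ℝ χ (a s)) (inner ℝ χ (b t)) (Ici 0) t)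
    {t : ℝ} (ht : 0 ≤ t) : HasDerivWithinAt a (b t) (Ici 0) t := by
  -- Extending the derivative to negative times by its value at 0 makes it continuous on the line,
  -- so its primitive is differentiable everywhere.
  set b' : ℝ → H := fun s => b (max s 0) with hb'
  have hb'c : Continuous b' := by
    rw [← continuousOn_univ]
    exact hb.comp (by fun_prop) (fun s _ => mem_Ici.2 (le_max_right _ _))
  set A : ℝ → H := fun s => a 0 + ∫ τ in (0 : ℝ)..s, b' τ with hA
  have hAd : ∀ s, HasDerivAt A (b' s) s := fun s =>
    (intervalIntegral.integral_hasDerivAt_right (hb'c.intervalIntegrable _ _)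
      hb'c.aestronglyMeasurable.stronglyMeasurableAtFilter hb'c.continuousAt).const_add _
  have hb'eq : ∀ s, 0 ≤ s → b' s = b s := fun s hs => by simp [hb', max_eq_left hs]
  have key : ∀ s, 0 ≤ s → a s = A s := by
    intro s hs
    -- Tested against χ, the difference has zero right derivative and vanishes at time 0; density
    -- then removes the test vector.
    have hz : ∀ χ ∈ D, inner ℝ χ (a s - A s) = 0 := by
      intro χ hχ
      have hder : ∀ τ ∈ Ico 0 s,
          HasDerivWithinAt (fun τ => inner ℝ χ (a τ - A τ)) 0 (Ici τ) τ := by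
        intro τ hτ
        have h1 := (hab χ hχ τ hτ.1).mono (Ici_subset_Ici.2 hτ.1)
        have h2 : HasDerivWithinAt (fun τ => inner ℝ χ (A τ)) (inner ℝ χ (b τ)) (Ici τ) τ := by
          have := (hAd τ).hasDerivWithinAt (s := Ici τ)
          rw [hb'eq τ hτ.1] at this
          simpa using (hasDerivWithinAt_const τ (Ici τ) χ).inner ℝ this
        simpa [inner_sub_right] using! h1.sub h2
      have hc : ContinuousOn (fun τ => inner ℝ χ (a τ - A τ)) (Icc 0 s) := by
        have hAc : Continuous A := continuous_iff_continuousAt.2 fun s => (hAd s).continuousAt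
        exact continuousOn_const.inner ((ha.mono Icc_subset_Ici_self).sub hAc.continuousOn)
      have := constant_of_has_deriv_right_zero hc hder s ⟨hs, le_rfl⟩
      simpa [hA] using this
    have : a s - A s = 0 := hD.eq_zero_of_inner_left ℝ fun v hv => by
      rw [real_inner_comm]; exact hz _ hv
    exact sub_eq_zero.1 this
  have := (hAd t).hasDerivWithinAt (s := Ici 0)
  rw [hb'eq t ht] at this
  exact this.congr (fun s hs => key s hs) (key t ht)

/-- Product rule for the pairing of a norm differentiable curve with a weakly differentiable
one. -/
theorem hasDerivWithinAt_inner_of_weak {H : Type*} [NormedAddCommGroup H] [InnerProductSpace ℝ H]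
    {X v : ℝ → H} {X' : H} {c t : ℝ} {S : Set ℝ} (hX : HasDerivWithinAt X X' S t)
    (hv : ContinuousWithinAt v S t)
    (hw : HasDerivWithinAt (fun s => inner ℝ (X t) (v s)) c S t) :
    HasDerivWithinAt (fun s => inner ℝ (X s) (v s)) (c + inner ℝ X' (v t)) S t := by
  -- Continuity of v is enough here, because the difference quotient of X converges in norm.
  have h2 : HasDerivWithinAt (fun s => inner ℝ (X s - X t) (v s)) (inner ℝ X' (v t)) S t := by
    rw [hasDerivWithinAt_iff_tendsto_slope] at hX ⊢
    have hv' : Tendsto v (𝓝[S \ {t}] t) (𝓝 (v t)) := hv.mono sdiff_subset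
    refine (hX.inner hv').congr fun s => ?_
    simp [slope_def_module, inner_smul_left]
  refine (hw.add h2).congr_of_eventuallyEq (Eventually.of_forall fun s => ?_) ?_ <;>
    simp [inner_sub_left]

/-! ### Translations of square integrable functions -/

/-- Square integrable functions on the line. -/
abbrev L2R : Type := Lp ℝ 2 (volume : Measure ℝ)

/-- Translation of a square integrable function: `(translate c f) r = f (r + c)`. -/
noncomputable def translate (c : ℝ) : L2R →ₗᵢ[ℝ] L2R :=
  Lp.compMeasurePreservingₗᵢ ℝ (fun r => r + c) (measurePreserving_add_right volume c)

theorem translate_toLp (c : ℝ) {f : ℝ → ℝ} (hf : MemLp f 2 volume) :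
    translate c (hf.toLp f)
      = (hf.comp_measurePreserving (measurePreserving_add_right volume c)).toLp
          (fun r => f (r + c)) :=
  Lp.toLp_compMeasurePreserving hf _

theorem continuousOn_translate {c : ℝ → ℝ} {f : ℝ → L2R} {S : Set ℝ} (hc : ContinuousOn c S)
    (hf : ContinuousOn f S) : ContinuousOn (fun s => translate (c s) (f s)) S := by
  have hg : Continuous fun a : ℝ => (⟨fun r => r + a, by fun_prop⟩ : C(ℝ, ℝ)) :=
    ContinuousMap.continuous_of_continuous_uncurry _ (by simp only [Function.uncurry_def]; exact continuous_snd.add continuous_fst)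
  exact hf.compMeasurePreservingLp (hg.comp_continuousOn hc)
    (fun s => measurePreserving_add_right volume (c s)) (by simp)

theorem inner_toLp {f g : ℝ → ℝ} (hf : MemLp f 2 volume) (hg : MemLp g 2 volume) :
    inner ℝ (hf.toLp f) (hg.toLp g) = ∫ r, f r * g r := by
  rw [L2.inner_def]
  refine integral_congr_ae ?_
  filter_upwards [hf.coeFn_toLp, hg.coeFn_toLp] with r h1 h2
  simp [h1, h2, mul_comm]

/-- Only the relative shift matters, so a translation of the solution can be moved to the test
function. -/
theorem inner_translate_translate (c d : ℝ) (f g : L2R) :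
    inner ℝ (translate c f) (translate d g) = inner ℝ (translate (c - d) f) g := by
  obtain ⟨f, hf, rfl⟩ : ∃ f', ∃ hf : MemLp f' 2 volume, f = hf.toLp f' :=
    ⟨f, Lp.memLp f, (Lp.toLp_coeFn _ _).symm⟩
  obtain ⟨g, hg, rfl⟩ : ∃ f', ∃ hf : MemLp f' 2 volume, g = hf.toLp f' :=
    ⟨g, Lp.memLp g, (Lp.toLp_coeFn _ _).symm⟩
  rw [translate_toLp, translate_toLp, translate_toLp, inner_toLp, inner_toLp,
    ← integral_add_right_eq_self (fun r => f (r + (c - d)) * g r) d]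
  congr 1; ext r; ring_nf

/-- Translates of a smooth compactly supported function form a differentiable curve. -/
theorem hasDerivWithinAt_translate {χ : ℝ → ℝ} (hχ : ContDiff ℝ (⊤ : ℕ∞) χ)
    (hc : HasCompactSupport χ) (h : MemLp χ 2 volume) (h' : MemLp (deriv χ) 2 volume)
    (σ : ℝ) {t : ℝ} (ht : 0 ≤ t) :
    HasDerivWithinAt (fun s => translate (σ * s) (h.toLp χ))
      (σ • translate (σ * t) (h'.toLp (deriv χ))) (Ici 0) t := by
  have hct : ∀ f : L2R, ContinuousOn (fun s => translate (σ * s) f) (Ici 0) := fun f =>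
    continuousOn_translate (by fun_prop) continuousOn_const
  refine hasDerivWithinAt_of_weak (b := fun t => σ • translate (σ * t) (h'.toLp (deriv χ)))
    (Lp.dense_hasCompactSupport_contDiff (E := ℝ) (F := ℝ) (μ := volume)
    (p := 2) (by simp)) (hct _) ((hct _).const_smul σ) ?_ ht
  rintro f ⟨g, hfg, hg, hgs⟩ t ht
  have hgm : MemLp g 2 volume := hgs.continuous.memLp_of_hasCompactSupport hg
  have hf : f = hgm.toLp g := by
    rw [← Lp.toLp_coeFn f (Lp.memLp f)]; exact MemLp.toLp_congr _ _ hfg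
  have h1 : ∀ s, inner ℝ f (translate (σ * s) (h.toLp χ)) = ∫ r, g r * χ (r + σ * s) := by
    intro s; rw [hf, translate_toLp, inner_toLp]
  have h2 : inner ℝ f (σ • translate (σ * t) (h'.toLp (deriv χ)))
      = ∫ r, g r * (σ * deriv χ (r + σ * t)) := by
    rw [inner_smul_right, hf, translate_toLp, inner_toLp, ← integral_const_mul]
    congr 1; ext r; ring
  simp only [h1, h2]
  have hdc : Continuous (deriv χ) := hχ.continuous_deriv (by simp)
  obtain ⟨C, hC⟩ := hdc.bounded_above_of_compact_support hc.deriv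
  -- Against a smooth g the derivative falls on χ under the integral, dominated by |g| times a bound
  -- for σ χ'.
  have := hasDerivAt_integral_of_dominated_loc_of_deriv_le (μ := volume) (𝕜 := ℝ)
    (F := fun s r => g r * χ (r + σ * s)) (F' := fun s r => g r * (σ * deriv χ (r + σ * s)))
    (x₀ := t) (s := univ) (bound := fun r => |g r| * (|σ| * C)) univ_mem
    (Eventually.of_forall fun s => ?_) ?_ ?_ ?_ ?_ ?_
  · exact this.2.hasDerivWithinAt
  · exact (hgs.continuous.mul (hχ.continuous.comp (by fun_prop))).aestronglyMeasurable
  · exact (hgs.continuous.mul (hχ.continuous.comp (by fun_prop))).integrable_of_hasCompactSupport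
      (hg.mul_right)
  · exact (hgs.continuous.mul (continuous_const.mul
      (hdc.comp (by fun_prop)))).aestronglyMeasurable
  · refine Eventually.of_forall fun r s _ => ?_
    rw [norm_mul, norm_mul]
    simp only [Real.norm_eq_abs]
    have := hC (r + σ * s)
    rw [Real.norm_eq_abs] at this
    gcongr
  · exact (hgs.continuous.abs.integrable_of_hasCompactSupport (hg.norm)).mul_const _
  · refine Eventually.of_forall fun r s _ => ?_
    have h3 : HasDerivAt χ (deriv χ (r + σ * s)) (r + σ * s) :=
      (hχ.differentiable (by simp)).differentiableAt.hasDerivAt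
    have h4 : HasDerivAt (fun s => r + σ * s) σ s := by
      simpa using ((hasDerivAt_id s).const_mul σ).const_add r
    have := (h3.comp s h4).const_mul (g r)
    simpa [Function.comp_def, mul_comm] using this

/-- `v_t = σ v_r + G` in the weak sense, for curves of square integrable functions. -/
structure IsTransport (σ : ℝ) (v G : ℝ → L2R) : Prop where
  continuousOn : ContinuousOn v (Ici 0)
  continuousOn_source : ContinuousOn G (Ici 0)
  weak : ∀ χ : ℝ → ℝ, ContDiff ℝ (⊤ : ℕ∞) χ → HasCompactSupport χ → ∀ t : ℝ, 0 ≤ t →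
    HasDerivWithinAt (fun s => ∫ r, χ r * v s r)
      (-σ * (∫ r, deriv χ r * v t r) + ∫ r, χ r * G t r) (Ici 0) t

theorem inner_toLp_left {f : ℝ → ℝ} (hf : MemLp f 2 volume) (g : L2R) :
    inner ℝ (hf.toLp f) g = ∫ r, f r * g r := by
  rw [L2.inner_def]
  refine integral_congr_ae ?_
  filter_upwards [hf.coeFn_toLp] with r h1
  simp [h1, mul_comm]

/-- A solution of a transport equation, followed along the characteristics. -/
theorem IsTransport.hasDerivWithinAt {σ : ℝ} {v G : ℝ → L2R} (h : IsTransport σ v G)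
    {t : ℝ} (ht : 0 ≤ t) :
    HasDerivWithinAt (fun s => translate (-σ * s) (v s)) (translate (-σ * t) (G t)) (Ici 0) t := by
  refine hasDerivWithinAt_of_weak (b := fun t => translate (-σ * t) (G t))
    (Lp.dense_hasCompactSupport_contDiff (E := ℝ) (F := ℝ) (μ := volume)
    (p := 2) (by simp)) (continuousOn_translate (by fun_prop) h.continuousOn)
    (continuousOn_translate (by fun_prop) h.continuousOn_source) ?_ ht
  rintro f ⟨χ, hfχ, hc, hχ⟩ t ht
  have hm : MemLp χ 2 volume := hχ.continuous.memLp_of_hasCompactSupport hc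
  have hdc : Continuous (deriv χ) := hχ.continuous_deriv (by simp)
  have hm' : MemLp (deriv χ) 2 volume := hdc.memLp_of_hasCompactSupport hc.deriv
  have hf : f = hm.toLp χ := by
    rw [← Lp.toLp_coeFn f (Lp.memLp f)]; exact MemLp.toLp_congr _ _ hfχ
  -- With the translation on the test function, the claim becomes the product rule for a smoothly
  -- moving χ and a weakly differentiable curve.
  have h1 : ∀ s (g : L2R), inner ℝ f (translate (-σ * s) g)
      = inner ℝ (translate (σ * s) (hm.toLp χ)) g := by
    intro s g
    have h0 := inner_translate_translate 0 (-σ * s) (hm.toLp χ) g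
    have h00 : translate 0 (hm.toLp χ) = hm.toLp χ := by
      rw [translate_toLp]; simp
    rw [h00] at h0
    rw [hf, h0]; congr 3; ring
  simp only [h1]
  have hX := hasDerivWithinAt_translate hχ hc hm hm' σ ht
  have hw := h.weak (fun r => χ (r + σ * t)) (hχ.comp (by fun_prop))
    (hc.comp_homeomorph (Homeomorph.addRight (σ * t))) t ht
  have hd : deriv (fun r => χ (r + σ * t)) = fun r => deriv χ (r + σ * t) := by
    ext r; exact deriv_comp_add_const _ _ _
  rw [hd] at hw
  have hw' : HasDerivWithinAt (fun s => inner ℝ (translate (σ * t) (hm.toLp χ)) (v s))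
      (-σ * inner ℝ (translate (σ * t) (hm'.toLp (deriv χ))) (v t)
        + inner ℝ (translate (σ * t) (hm.toLp χ)) (G t)) (Ici 0) t := by
    simpa only [translate_toLp, inner_toLp_left] using hw
  have := hasDerivWithinAt_inner_of_weak (v := v) hX (h.continuousOn t ht) hw'
  -- The σ χ' produced by the motion of the test function cancels the −σ χ' of the weak equation.
  convert this using 1
  rw [inner_smul_left]; simp

/-- Bilinear identity for two solutions of transport equations with the same speed. -/
theorem IsTransport.hasDerivWithinAt_inner {σ : ℝ} {v₁ v₂ G₁ G₂ : ℝ → L2R}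
    (h₁ : IsTransport σ v₁ G₁) (h₂ : IsTransport σ v₂ G₂) {t : ℝ} (ht : 0 ≤ t) :
    HasDerivWithinAt (fun s => inner ℝ (v₁ s) (v₂ s))
      (inner ℝ (v₁ t) (G₂ t) + inner ℝ (G₁ t) (v₂ t)) (Ici 0) t := by
  -- Both curves are shifted by the same isometry: the pairing is unchanged and no r-derivative
  -- survives.
  have := (h₁.hasDerivWithinAt ht).inner ℝ (h₂.hasDerivWithinAt ht)
  simpa only [LinearIsometry.inner_map_map] using this

/-! ### Test functions -/

namespace IsTestFunction

variable {χ : ℝ → ℝ}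

theorem exists_Icc (h : IsTestFunction χ) :
    ∃ a b : ℝ, 0 < a ∧ a ≤ b ∧ ∀ r, r ∉ Icc a b → χ r = 0 := by
  rcases (tsupport χ).eq_empty_or_nonempty with he | hne
  · refine ⟨1, 1, one_pos, le_rfl, fun r _ => image_eq_zero_of_notMem_tsupport (by simp [he])⟩
  · have hc : IsCompact (tsupport χ) := h.hasCompactSupport
    obtain ⟨a, ha⟩ := hc.exists_isLeast hne
    obtain ⟨b, hb⟩ := hc.exists_isGreatest hne
    exact ⟨a, b, h.tsupport_subset ha.1, hb.2 ha.1, fun r hr =>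
      image_eq_zero_of_notMem_tsupport fun hr' => hr ⟨ha.2 hr', hb.2 hr'⟩⟩

theorem of_Icc {a b : ℝ} (ha : 0 < a) (hs : ContDiff ℝ (⊤ : ℕ∞) χ)
    (h : ∀ r, r ∉ Icc a b → χ r = 0) : IsTestFunction χ := by
  have hsub : tsupport χ ⊆ Icc a b :=
    closure_minimal (fun r hr => by by_contra h'; exact hr (h r h')) isClosed_Icc
  exact ⟨hs, HasCompactSupport.of_support_subset_isCompact isCompact_Icc
    (subset_closure.trans hsub), hsub.trans fun r hr => ha.trans_le hr.1⟩

theorem continuous (h : IsTestFunction χ) : Continuous χ := h.smooth.continuous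

theorem differentiable (h : IsTestFunction χ) : Differentiable ℝ χ :=
  h.smooth.differentiable (by simp)

theorem eq_zero (h : IsTestFunction χ) {r : ℝ} (hr : r ≤ 0) : χ r = 0 :=
  image_eq_zero_of_notMem_tsupport fun h' => not_lt.2 hr (h.tsupport_subset h')

/-- Weights such as 1 / sinh r are smooth on (0, ∞) only; the test function vanishes on a
neighbourhood of the remaining points. -/
theorem mul_contDiffOn (h : IsTestFunction χ) {g : ℝ → ℝ}
    (hg : ContDiffOn ℝ (⊤ : ℕ∞) g (Ioi 0)) : IsTestFunction (fun r => χ r * g r) := by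
  obtain ⟨a, b, ha, -, hab⟩ := h.exists_Icc
  refine of_Icc (a := a) (b := b) ha ?_ fun r hr => by simp [hab r hr]
  rw [contDiff_iff_contDiffAt]
  intro r
  rcases lt_or_ge 0 r with hr | hr
  · exact h.smooth.contDiffAt.mul (hg.contDiffAt (Ioi_mem_nhds hr))
  · refine (contDiffAt_const (c := (0 : ℝ))).congr_of_eventuallyEq ?_
    filter_upwards [Iio_mem_nhds (hr.trans_lt ha)] with x hx
    rw [hab x (fun hx' => not_lt.2 hx'.1 hx), zero_mul]

theorem deriv (h : IsTestFunction χ) : IsTestFunction (deriv χ) := by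
  obtain ⟨a, b, ha, -, hab⟩ := h.exists_Icc
  have h1 : ContDiff ℝ (⊤ : ℕ∞) (_root_.deriv χ) := by
    have := h.smooth
    exact (contDiff_infty_iff_deriv.1 this).2
  refine of_Icc (a := a) (b := b) ha h1 fun r hr => ?_
  have : χ =ᶠ[𝓝 r] fun _ => 0 := by
    filter_upwards [isClosed_Icc.isOpen_compl.mem_nhds hr] with x hx using hab x hx
  rw [this.deriv_eq]; simp

theorem mul (h : IsTestFunction χ) {χ' : ℝ → ℝ} (h' : IsTestFunction χ') :
    IsTestFunction (fun r => χ r * χ' r) := h.mul_contDiffOn h'.smooth.contDiffOn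

end IsTestFunction

/-! ### Locally square integrable functions that depend continuously on time -/

/-- `f ∈ C([0, ∞); L²_loc(0, ∞))`. -/
structure ContL2Loc (f : ℝ → ℝ → ℝ) : Prop where
  memLp : ∀ a b : ℝ, 0 < a → ∀ t : ℝ, 0 ≤ t → MemLp (f t) 2 (volume.restrict (Icc a b))
  tendsto : ∀ a b : ℝ, 0 < a → ∀ t : ℝ, 0 ≤ t →
    Tendsto (fun s => eLpNorm (f s - f t) 2 (volume.restrict (Icc a b))) (𝓝[Ici 0] t) (𝓝 0)

namespace ContL2Loc

variable {f g : ℝ → ℝ → ℝ}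

theorem add (hf : ContL2Loc f) (hg : ContL2Loc g) : ContL2Loc fun t r => f t r + g t r := by
  refine ⟨fun a b ha t ht => (hf.memLp a b ha t ht).add (hg.memLp a b ha t ht),
    fun a b ha t ht => ?_⟩
  have h := (hf.tendsto a b ha t ht).add (hg.tendsto a b ha t ht)
  rw [add_zero] at h
  refine tendsto_of_tendsto_of_tendsto_of_le_of_le' tendsto_const_nhds h
    (Eventually.of_forall fun s => zero_le) ?_
  filter_upwards [self_mem_nhdsWithin] with s hs
  have : (fun r => f s r + g s r) - (fun r => f t r + g t r) = (f s - f t) + (g s - g t) := by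
    ext r; simp; ring
  rw [this]
  exact eLpNorm_add_le ((hf.memLp a b ha s hs).sub (hf.memLp a b ha t ht)).1
    ((hg.memLp a b ha s hs).sub (hg.memLp a b ha t ht)).1 (by norm_num)

/-- A continuous weight is bounded on each compact interval of (0, ∞), whatever it does at the two
ends. -/
theorem mul_left (hf : ContL2Loc f) {g : ℝ → ℝ} (hg : ContinuousOn g (Ioi 0)) :
    ContL2Loc fun t r => g r * f t r := by
  have key : ∀ a b : ℝ, 0 < a → ∃ C : ℝ, ∀ k : ℝ → ℝ,
      AEStronglyMeasurable k (volume.restrict (Icc a b)) →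
      AEStronglyMeasurable (fun r => g r * k r) (volume.restrict (Icc a b)) ∧
      ∀ᵐ r ∂volume.restrict (Icc a b), ‖g r * k r‖ ≤ C * ‖k r‖ := by
    intro a b ha
    have hg' := hg.mono (fun r (hr : r ∈ Icc a b) => ha.trans_le hr.1)
    obtain ⟨C, hC⟩ := isCompact_Icc.exists_bound_of_continuousOn hg'
    refine ⟨C, fun k hk => ⟨(hg'.aestronglyMeasurable measurableSet_Icc).mul hk, ?_⟩⟩
    filter_upwards [ae_restrict_mem measurableSet_Icc] with r hr
    rw [norm_mul]
    gcongr
    exact hC r hr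
  refine ⟨fun a b ha t ht => ?_, fun a b ha t ht => ?_⟩
  · obtain ⟨C, hC⟩ := key a b ha
    obtain ⟨h1, h2⟩ := hC _ (hf.memLp a b ha t ht).1
    exact (hf.memLp a b ha t ht).of_le_mul h1 h2
  · obtain ⟨C, hC⟩ := key a b ha
    have h := ENNReal.Tendsto.const_mul (a := ENNReal.ofReal C) (hf.tendsto a b ha t ht)
      (Or.inr (by simp))
    rw [mul_zero] at h
    refine tendsto_of_tendsto_of_tendsto_of_le_of_le' tendsto_const_nhds h
      (Eventually.of_forall fun s => zero_le) ?_
    filter_upwards [self_mem_nhdsWithin] with s hs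
    have h1 := (hC _ ((hf.memLp a b ha s hs).sub (hf.memLp a b ha t ht)).1).2
    refine eLpNorm_le_mul_eLpNorm_of_ae_le_mul (h1.mono fun r hr => ?_) 2
    simpa [mul_sub] using hr

theorem const_mul (hf : ContL2Loc f) (c : ℝ) : ContL2Loc fun t r => c * f t r :=
  hf.mul_left (g := fun _ => c) continuousOn_const

theorem sub (hf : ContL2Loc f) (hg : ContL2Loc g) : ContL2Loc fun t r => f t r - g t r := by
  simpa [sub_eq_add_neg] using hf.add (hg.const_mul (-1))

theorem of_continuousOn {g : ℝ → ℝ} (hg : ContinuousOn g (Ioi 0)) : ContL2Loc fun _ => g := by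
  refine ⟨fun a b ha t ht => ?_, fun a b ha t ht => by simpa using tendsto_const_nhds⟩
  have hg' := hg.mono (fun r (hr : r ∈ Icc a b) => ha.trans_le hr.1)
  obtain ⟨C, hC⟩ := isCompact_Icc.exists_bound_of_continuousOn hg'
  exact MemLp.of_bound (hg'.aestronglyMeasurable measurableSet_Icc) C
    ((ae_restrict_mem measurableSet_Icc).mono hC)

theorem comp_add (hf : ContL2Loc f) {h : ℝ} (hh : 0 ≤ h) : ContL2Loc fun t => f (t + h) := by
  refine ⟨fun a b ha t ht => hf.memLp a b ha _ (by positivity), fun a b ha t ht =>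
    (hf.tendsto a b ha (t + h) (by positivity)).comp ?_⟩
  refine tendsto_nhdsWithin_of_tendsto_nhds_of_eventually_within _
    ((continuous_add_const h).tendsto t |>.mono_left inf_le_left) ?_
  filter_upwards [self_mem_nhdsWithin] with s hs
  exact add_nonneg hs hh

theorem memLp_mul (hf : ContL2Loc f) {w : ℝ → ℝ} (hw : IsTestFunction w) {t : ℝ} (ht : 0 ≤ t) :
    MemLp (fun r => w r * f t r) 2 volume := by
  obtain ⟨a, b, ha, -, hab⟩ := hw.exists_Icc
  have h := (hf.mul_left hw.continuous.continuousOn).memLp a b ha t ht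
  rw [← memLp_indicator_iff_restrict measurableSet_Icc] at h
  convert! h using 1
  ext r
  by_cases hr : r ∈ Icc a b <;> simp [hr, hab r]

theorem integrable_mul (hf : ContL2Loc f) {w : ℝ → ℝ} (hw : IsTestFunction w) {t : ℝ}
    (ht : 0 ≤ t) : Integrable (fun r => w r * f t r) := by
  obtain ⟨a, b, ha, -, hab⟩ := hw.exists_Icc
  have h := ((hf.mul_left hw.continuous.continuousOn).memLp a b ha t ht).integrable (by norm_num)
  have h : IntegrableOn (fun r => w r * f t r) (Icc a b) := h
  rw [← integrable_indicator_iff measurableSet_Icc] at h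
  convert! h using 1
  ext r
  by_cases hr : r ∈ Icc a b <;> simp [hr, hab r]

theorem integrable_mul_mul (hf : ContL2Loc f) (hg : ContL2Loc g) {w : ℝ → ℝ}
    (hw : IsTestFunction w) {t t' : ℝ} (ht : 0 ≤ t) (ht' : 0 ≤ t') :
    Integrable (fun r => w r * (f t r * g t' r)) := by
  obtain ⟨a, b, ha, -, hab⟩ := hw.exists_Icc
  have h := ((hf.mul_left hw.continuous.continuousOn).memLp a b ha t ht).integrable_mul
    (hg.memLp a b ha t' ht')
  have h : IntegrableOn (fun r => w r * (f t r * g t' r)) (Icc a b) := by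
    refine h.congr (Eventually.of_forall fun r => ?_)
    simp only [Pi.mul_apply]; ring
  rw [← integrable_indicator_iff measurableSet_Icc] at h
  convert! h using 1
  ext r
  by_cases hr : r ∈ Icc a b <;> simp [hr, hab r]

/-- The curve of square integrable functions `t ↦ w f(t)`. -/
noncomputable def _root_.HypWaveMap.lift (w : ℝ → ℝ) (f : ℝ → ℝ → ℝ) (t : ℝ) : L2R :=
  open Classical in
  if h : MemLp (fun r => w r * f t r) 2 volume then h.toLp else 0

theorem lift_eq (hf : ContL2Loc f) {w : ℝ → ℝ} (hw : IsTestFunction w) {t : ℝ} (ht : 0 ≤ t) :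
    lift w f t = (hf.memLp_mul hw ht).toLp := by
  simp [lift, hf.memLp_mul hw ht]

theorem coeFn_lift (hf : ContL2Loc f) {w : ℝ → ℝ} (hw : IsTestFunction w) {t : ℝ} (ht : 0 ≤ t) :
    lift w f t =ᵐ[volume] fun r => w r * f t r := by
  rw [hf.lift_eq hw ht]; exact MemLp.coeFn_toLp _

theorem inner_lift (hf : ContL2Loc f) (hg : ContL2Loc g) {w w' : ℝ → ℝ} (hw : IsTestFunction w)
    (hw' : IsTestFunction w') {t t' : ℝ} (ht : 0 ≤ t) (ht' : 0 ≤ t') :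
    inner ℝ (lift w f t) (lift w' g t') = ∫ r, (w r * w' r) * (f t r * g t' r) := by
  rw [hf.lift_eq hw ht, hg.lift_eq hw' ht', inner_toLp]
  congr 1; ext r; ring

theorem continuousOn_lift (hf : ContL2Loc f) {w : ℝ → ℝ} (hw : IsTestFunction w) :
    ContinuousOn (lift w f) (Ici 0) := by
  intro t ht
  obtain ⟨a, b, ha, -, hab⟩ := hw.exists_Icc
  rw [ContinuousWithinAt, tendsto_iff_edist_tendsto_0]
  refine ((hf.mul_left hw.continuous.continuousOn).tendsto a b ha t ht).congr' ?_
  filter_upwards [self_mem_nhdsWithin] with s hs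
  rw [hf.lift_eq hw hs, hf.lift_eq hw ht, Lp.edist_toLp_toLp,
    ← eLpNorm_indicator_eq_eLpNorm_restrict measurableSet_Icc]
  congr 1
  ext r
  by_cases hr : r ∈ Icc a b <;> simp [hr, hab r]

/-- Localised products depend continuously on time. -/
theorem continuousOn_integral (hf : ContL2Loc f) (hg : ContL2Loc g) {w : ℝ → ℝ}
    (hw : IsTestFunction w) {χ : ℝ → ℝ} (hχ : IsTestFunction χ) (h1 : ∀ r, w r ≠ 0 → χ r = 1) :
    ContinuousOn (fun t => ∫ r, w r * (f t r * g t r)) (Ici 0) := by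
  refine ((hf.continuousOn_lift hw).inner (𝕜 := ℝ) (hg.continuousOn_lift hχ)).congr fun t ht => ?_
  dsimp only
  rw [hf.inner_lift hg hw hχ ht ht]
  congr 1; ext r
  by_cases hr : w r = 0
  · simp [hr]
  · simp [h1 r hr]

end ContL2Loc

/-! ### Weak solutions of one dimensional wave equations with a source -/

/-- `u ∈ C(H¹_loc) ∩ C¹(L²_loc)` on `(0, ∞)` is a weak solution of `u_tt - u_rr = N`; here
`u' = u_t` and `ux = u_r`. -/
structure WeakWave (u u' ux N : ℝ → ℝ → ℝ) : Prop where
  cont_u : ContL2Loc u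
  cont_u' : ContL2Loc u'
  cont_ux : ContL2Loc ux
  cont_N : ContL2Loc N
  grad : ∀ χ : ℝ → ℝ, IsTestFunction χ → ∀ t : ℝ, 0 ≤ t →
    ∫ r, χ r * ux t r = -∫ r, deriv χ r * u t r
  position : ∀ χ : ℝ → ℝ, IsTestFunction χ → ∀ t : ℝ, 0 ≤ t →
    HasDerivWithinAt (fun s => ∫ r, χ r * u s r) (∫ r, χ r * u' t r) (Ici 0) t
  velocity : ∀ χ : ℝ → ℝ, IsTestFunction χ → ∀ t : ℝ, 0 ≤ t →
    HasDerivWithinAt (fun s => ∫ r, χ r * u' s r)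
      (-(∫ r, deriv χ r * ux t r) + ∫ r, χ r * N t r) (Ici 0) t

/-- Supplies a second cutoff for bilinear pairings: a lift by χ paired with a lift by w carries the
single weight w, and the terms with the derivative of χ vanish. -/
theorem IsTestFunction.exists_eq_one {w : ℝ → ℝ} (hw : IsTestFunction w) :
    ∃ χ : ℝ → ℝ, IsTestFunction χ ∧ (∀ r, w r ≠ 0 → χ r = 1) ∧
      (∀ r, _root_.deriv w r ≠ 0 → χ r = 1) ∧ (∀ r, w r ≠ 0 → _root_.deriv χ r = 0) := by
  obtain ⟨a, b, ha, -, hab⟩ := hw.exists_Icc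
  have hsub : tsupport w ⊆ Icc a b :=
    closure_minimal (fun r hr => by by_contra h'; exact hr (hab r h')) isClosed_Icc
  -- The first factor rises from 0 to 1 on [a/2, a], the second falls from 1 to 0 on [b, b + 1].
  have h1 : ∀ r ∈ Icc a b,
      smoothTransition (2 / a * r - 1) * smoothTransition (b + 1 - r) = 1 := by
    intro r hr
    rw [smoothTransition.one_of_one_le, smoothTransition.one_of_one_le, one_mul]
    · linarith [hr.2]
    · have : 2 / a * a ≤ 2 / a * r := by gcongr; exact hr.1
      have h2 : 2 / a * a = 2 := by field_simp
      linarith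
  refine ⟨fun r => smoothTransition (2 / a * r - 1) * smoothTransition (b + 1 - r),
    .of_Icc (a := a / 2) (b := b + 1) (by positivity) ?_ ?_,
    fun r hr => h1 r (hsub (subset_closure hr)),
    fun r hr => h1 r (hsub (support_deriv_subset hr)), fun r hr => ?_⟩
  · exact (smoothTransition.contDiff.comp (by fun_prop)).mul
      (smoothTransition.contDiff.comp (by fun_prop))
  · intro r hr
    rw [mem_Icc, not_and_or, not_le, not_le] at hr
    rcases hr with hr | hr
    · rw [smoothTransition.zero_of_nonpos, zero_mul]
      have : 2 / a * r ≤ 2 / a * (a / 2) := by gcongr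
      have h2 : 2 / a * (a / 2) = 1 := by field_simp
      linarith
    · rw [mul_comm, smoothTransition.zero_of_nonpos (by linarith), zero_mul]
  · have : (fun r => smoothTransition (2 / a * r - 1) * smoothTransition (b + 1 - r))
        =ᶠ[𝓝 r] fun _ => 1 := by
      filter_upwards [hw.continuous.continuousAt.eventually_ne hr] with x hx
      exact h1 x (hsub (subset_closure hx))
    rw [this.deriv_eq]; simp

theorem ContL2Loc.integral_lift {f : ℝ → ℝ → ℝ} (hf : ContL2Loc f) {w : ℝ → ℝ}
    (hw : IsTestFunction w) (χ : ℝ → ℝ) {t : ℝ} (ht : 0 ≤ t) :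
    ∫ r, χ r * lift w f t r = ∫ r, (w r * χ r) * f t r := by
  refine integral_congr_ae ?_
  filter_upwards [hf.coeFn_lift hw ht] with r hr
  rw [hr]; ring

theorem IsTestFunction.deriv_mul {w χ : ℝ → ℝ} (hw : IsTestFunction w)
    (hχ : ContDiff ℝ (⊤ : ℕ∞) χ) (r : ℝ) :
    _root_.deriv (fun r => w r * χ r) r = _root_.deriv w r * χ r + w r * _root_.deriv χ r :=
  deriv_fun_mul hw.differentiable.differentiableAt (hχ.differentiable (by simp)).differentiableAt

theorem integral_add_mul {f g k : ℝ → ℝ} {c d : ℝ}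
    (h : ∀ r, k r = c * f r + d * g r) (hf : Integrable f) (hg : Integrable g) :
    ∫ r, k r = c * (∫ r, f r) + d * ∫ r, g r := by
  rw [← integral_const_mul, ← integral_const_mul, ← integral_add (hf.const_mul c) (hg.const_mul d)]
  exact integral_congr_ae (Eventually.of_forall h)

namespace WeakWave

variable {u u' ux N : ℝ → ℝ → ℝ}

theorem comp_add (h : WeakWave u u' ux N) {c : ℝ} (hc : 0 ≤ c) :
    WeakWave (fun t => u (t + c)) (fun t => u' (t + c)) (fun t => ux (t + c))
      (fun t => N (t + c)) := by
  have key : ∀ (F : ℝ → ℝ) (F' t : ℝ), 0 ≤ t → HasDerivWithinAt F F' (Ici 0) (t + c) →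
      HasDerivWithinAt (fun s => F (s + c)) F' (Ici 0) t := by
    intro F F' t ht hF
    have h2 : HasDerivWithinAt (fun s => s + c) 1 (Ici 0) t :=
      ((hasDerivAt_id t).add_const c).hasDerivWithinAt
    simpa [Function.comp_def] using
      HasDerivWithinAt.comp t hF h2 (fun s hs => mem_Ici.2 (add_nonneg hs hc))
  exact ⟨h.cont_u.comp_add hc, h.cont_u'.comp_add hc, h.cont_ux.comp_add hc, h.cont_N.comp_add hc,
    fun χ hχ t ht => h.grad χ hχ _ (by positivity),
    fun χ hχ t ht => key (fun s => ∫ r, χ r * u s r) _ t ht (h.position χ hχ (t + c) (by positivity)),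
    fun χ hχ t ht => key (fun s => ∫ r, χ r * u' s r) _ t ht (h.velocity χ hχ (t + c) (by positivity))⟩

/-- The null derivatives of a weak solution are transported. -/
theorem isTransport_null (h : WeakWave u u' ux N) {w : ℝ → ℝ} (hw : IsTestFunction w) {σ : ℝ}
    (hσ : σ ^ 2 = 1) :
    IsTransport σ (lift w fun t r => u' t r + σ * ux t r)
      (fun t => lift w N t - lift (deriv w) (fun t r => σ * u' t r + ux t r) t) := by
  have c1 := h.cont_u'.add (h.cont_ux.const_mul σ)
  have c2 := (h.cont_u'.const_mul σ).add h.cont_ux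
  refine ⟨c1.continuousOn_lift hw, (h.cont_N.continuousOn_lift hw).sub
    (c2.continuousOn_lift hw.deriv), fun χ hχ hc t ht => ?_⟩
  have hwχ : IsTestFunction fun r => w r * χ r := hw.mul_contDiffOn hχ.contDiffOn
  have hw'χ : IsTestFunction fun r => deriv w r * χ r := hw.deriv.mul_contDiffOn hχ.contDiffOn
  have hχ' : ContDiff ℝ (⊤ : ℕ∞) (deriv χ) := (contDiff_infty_iff_deriv.1 hχ).2
  have hwχ' : IsTestFunction fun r => w r * deriv χ r := hw.mul_contDiffOn hχ'.contDiffOn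
  -- The part σ u_r has no time derivative of its own: its r-derivative is put on the test function,
  -- and `position` differentiates what is left.
  have hd := (h.velocity _ hwχ t ht).add
    ((h.position _ hwχ.deriv t ht).const_mul (-σ))
  have hG : ∫ r, χ r * (lift w N t - lift (deriv w) (fun t r => σ * u' t r + ux t r) t : L2R) r
      = (∫ r, (w r * χ r) * N t r) - ∫ r, (deriv w r * χ r) * (σ * u' t r + ux t r) := by
    rw [← integral_sub (h.cont_N.integrable_mul hwχ ht) (c2.integrable_mul hw'χ ht)]
    refine integral_congr_ae ?_
    filter_upwards [Lp.coeFn_sub (lift w N t) (lift (deriv w) (fun t r => σ * u' t r + ux t r) t),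
      h.cont_N.coeFn_lift hw ht, c2.coeFn_lift hw.deriv ht] with r h1 h2 h3
    rw [h1, Pi.sub_apply, h2, h3]; ring
  have hL : ∀ s, 0 ≤ s → ∫ r, χ r * lift w (fun t r => u' t r + σ * ux t r) s r
      = (∫ r, (w r * χ r) * u' s r) + -σ * ∫ r, deriv (fun r => w r * χ r) r * u s r := by
    intro s hs
    rw [c1.integral_lift hw χ hs, integral_add_mul (c := 1) (d := σ)
      (f := fun r => (w r * χ r) * u' s r) (g := fun r => (w r * χ r) * ux s r) (fun r => by ring)
      (h.cont_u'.integrable_mul hwχ hs) (h.cont_ux.integrable_mul hwχ hs), h.grad _ hwχ s hs]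
    simp only [one_mul, mul_neg, neg_mul]
  refine (hd.congr (fun s hs => ?_) ?_).congr_deriv ?_
  · exact hL s hs
  · exact hL t ht
  · rw [hG, c1.integral_lift hw _ ht]
    have e1 : ∫ r, deriv (fun r => w r * χ r) r * ux t r
        = 1 * (∫ r, (deriv w r * χ r) * ux t r) + 1 * ∫ r, (w r * deriv χ r) * ux t r :=
      integral_add_mul (fun r => by rw [hw.deriv_mul hχ]; ring)
        (h.cont_ux.integrable_mul hw'χ ht) (h.cont_ux.integrable_mul hwχ' ht)
    have e2 : ∫ r, deriv (fun r => w r * χ r) r * u' t r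
        = 1 * (∫ r, (deriv w r * χ r) * u' t r) + 1 * ∫ r, (w r * deriv χ r) * u' t r :=
      integral_add_mul (fun r => by rw [hw.deriv_mul hχ]; ring)
        (h.cont_u'.integrable_mul hw'χ ht) (h.cont_u'.integrable_mul hwχ' ht)
    have e3 : ∫ r, (deriv w r * χ r) * (σ * u' t r + ux t r)
        = σ * (∫ r, (deriv w r * χ r) * u' t r) + 1 * ∫ r, (deriv w r * χ r) * ux t r :=
      integral_add_mul (fun r => by ring)
        (h.cont_u'.integrable_mul hw'χ ht) (h.cont_ux.integrable_mul hw'χ ht)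
    have e4 : ∫ r, (w r * deriv χ r) * (u' t r + σ * ux t r)
        = 1 * (∫ r, (w r * deriv χ r) * u' t r) + σ * ∫ r, (w r * deriv χ r) * ux t r :=
      integral_add_mul (fun r => by ring)
        (h.cont_u'.integrable_mul hwχ' ht) (h.cont_ux.integrable_mul hwχ' ht)
    rw [e1, e2, e3, e4]
    linear_combination (∫ r, (w r * deriv χ r) * ux t r) * hσ

/-- A weak solution is itself transported, with its null derivative as a source. -/
theorem isTransport_self (h : WeakWave u u' ux N) {w : ℝ → ℝ} (hw : IsTestFunction w) (σ : ℝ) :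
    IsTransport σ (lift w u)
      (fun t => lift w (fun t r => u' t r - σ * ux t r) t - lift (deriv w) (fun t r => σ * u t r) t) := by
  have c1 := h.cont_u'.sub (h.cont_ux.const_mul σ)
  have c2 := h.cont_u.const_mul σ
  refine ⟨h.cont_u.continuousOn_lift hw, (c1.continuousOn_lift hw).sub
    (c2.continuousOn_lift hw.deriv), fun χ hχ hc t ht => ?_⟩
  have hwχ : IsTestFunction fun r => w r * χ r := hw.mul_contDiffOn hχ.contDiffOn
  have hw'χ : IsTestFunction fun r => deriv w r * χ r := hw.deriv.mul_contDiffOn hχ.contDiffOn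
  have hχ' : ContDiff ℝ (⊤ : ℕ∞) (deriv χ) := (contDiff_infty_iff_deriv.1 hχ).2
  have hwχ' : IsTestFunction fun r => w r * deriv χ r := hw.mul_contDiffOn hχ'.contDiffOn
  have hG : ∫ r, χ r * (lift w (fun t r => u' t r - σ * ux t r) t
        - lift (deriv w) (fun t r => σ * u t r) t : L2R) r
      = (∫ r, (w r * χ r) * (u' t r - σ * ux t r)) - ∫ r, (deriv w r * χ r) * (σ * u t r) := by
    rw [← integral_sub (c1.integrable_mul hwχ ht) (c2.integrable_mul hw'χ ht)]
    refine integral_congr_ae ?_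
    filter_upwards [Lp.coeFn_sub (lift w (fun t r => u' t r - σ * ux t r) t)
      (lift (deriv w) (fun t r => σ * u t r) t),
      c1.coeFn_lift hw ht, c2.coeFn_lift hw.deriv ht] with r h1 h2 h3
    rw [h1, Pi.sub_apply, h2, h3]; ring
  refine ((h.position _ hwχ t ht).congr (fun s hs => ?_) ?_).congr_deriv ?_
  · exact h.cont_u.integral_lift hw χ hs
  · exact h.cont_u.integral_lift hw χ ht
  · rw [hG, h.cont_u.integral_lift hw _ ht]
    have e1 : ∫ r, deriv (fun r => w r * χ r) r * u t r
        = 1 * (∫ r, (deriv w r * χ r) * u t r) + 1 * ∫ r, (w r * deriv χ r) * u t r :=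
      integral_add_mul (fun r => by rw [hw.deriv_mul hχ]; ring)
        (h.cont_u.integrable_mul hw'χ ht) (h.cont_u.integrable_mul hwχ' ht)
    have e2 : ∫ r, (w r * χ r) * (u' t r - σ * ux t r)
        = 1 * (∫ r, (w r * χ r) * u' t r) + (-σ) * ∫ r, (w r * χ r) * ux t r :=
      integral_add_mul (fun r => by ring)
        (h.cont_u'.integrable_mul hwχ ht) (h.cont_ux.integrable_mul hwχ ht)
    rw [h.grad _ hwχ t ht, e1] at e2
    rw [e2]
    have e3 : ∫ r, (deriv w r * χ r) * (σ * u t r) = σ * ∫ r, (deriv w r * χ r) * u t r := by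
      rw [← integral_const_mul]; congr 1; ext r; ring
    rw [e3]; ring

end WeakWave

namespace WeakWave

variable {u u' ux N u₂ u₂' ux₂ N₂ : ℝ → ℝ → ℝ}

/-- The identity for the localised square of a null derivative. -/
theorem hasDerivWithinAt_null (h : WeakWave u u' ux N) {w : ℝ → ℝ} (hw : IsTestFunction w) {σ : ℝ}
    (hσ : σ ^ 2 = 1) {t : ℝ} (ht : 0 ≤ t) :
    HasDerivWithinAt
      (fun s => ∫ r, w r * ((u' s r + σ * ux s r) * (u' s r + σ * ux s r)))
      (∫ r, (2 * (w r * ((u' t r + σ * ux t r) * N t r))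
        - deriv w r * ((u' t r + σ * ux t r) * (σ * u' t r + ux t r)))) (Ici 0) t := by
  obtain ⟨ζ, hζ, h1, h2, h3⟩ := hw.exists_eq_one
  have c1 := h.cont_u'.add (h.cont_ux.const_mul σ)
  have c2 := (h.cont_u'.const_mul σ).add h.cont_ux
  -- Lifting one factor by ζ and the other by w, with ζ = 1 where w ≠ 0, produces the weight w and
  -- not w².
  have hd := (h.isTransport_null hζ hσ).hasDerivWithinAt_inner (h.isTransport_null hw hσ) ht
  have e1 : ∀ r, ζ r * w r = w r := fun r => by
    by_cases hr : w r = 0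
    · simp [hr]
    · simp [h1 r hr]
  have e2 : ∀ r, ζ r * deriv w r = deriv w r := fun r => by
    by_cases hr : deriv w r = 0
    · simp [hr]
    · simp [h2 r hr]
  have e3 : ∀ r, deriv ζ r * w r = 0 := fun r => by
    by_cases hr : w r = 0
    · simp [hr]
    · simp [h3 r hr]
  refine (hd.congr (fun s hs => ?_) ?_).congr_deriv ?_
  · rw [c1.inner_lift c1 hζ hw hs hs]; simp only [e1]
  · rw [c1.inner_lift c1 hζ hw ht ht]; simp only [e1]
  · rw [inner_sub_right, inner_sub_left, c1.inner_lift h.cont_N hζ hw ht ht,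
      c1.inner_lift c2 hζ hw.deriv ht ht, h.cont_N.inner_lift c1 hζ hw ht ht,
      c2.inner_lift c1 hζ.deriv hw ht ht]
    simp only [e1, e2, e3, zero_mul, integral_zero, sub_zero]
    have e := integral_add_mul (c := 2) (d := -1)
      (k := fun r => 2 * (w r * ((u' t r + σ * ux t r) * N t r))
        - deriv w r * ((u' t r + σ * ux t r) * (σ * u' t r + ux t r))) (fun r => by ring)
      (c1.integrable_mul_mul h.cont_N hw ht ht) (c1.integrable_mul_mul c2 hw.deriv ht ht)
    have : ∫ r, w r * (N t r * (u' t r + σ * ux t r))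
        = ∫ r, w r * ((u' t r + σ * ux t r) * N t r) := by
      congr 1; ext r; ring
    rw [this, e]; ring

theorem integrable_momentum (h : WeakWave u u' ux N) {w : ℝ → ℝ} (hw : IsTestFunction w)
    {t : ℝ} (ht : 0 ≤ t) :
    Integrable fun r => w r * (ux t r * N t r)
      - 1 / 2 * deriv w r * (u' t r ^ 2 + ux t r ^ 2) := by
  have i1 := h.cont_ux.integrable_mul_mul h.cont_N hw ht ht
  have i2 := h.cont_u'.integrable_mul_mul h.cont_u' hw.deriv ht ht
  have i3 := h.cont_ux.integrable_mul_mul h.cont_ux hw.deriv ht ht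
  refine (i1.sub ((i2.add i3).const_mul (1 / 2))).congr (Eventually.of_forall fun r => ?_)
  simp only [Pi.sub_apply, Pi.add_apply]; ring

/-- The localised momentum identity. -/
theorem hasDerivWithinAt_momentum (h : WeakWave u u' ux N) {w : ℝ → ℝ} (hw : IsTestFunction w)
    {t : ℝ} (ht : 0 ≤ t) :
    HasDerivWithinAt (fun s => ∫ r, w r * (u' s r * ux s r))
      (∫ r, (w r * (ux t r * N t r) - 1 / 2 * deriv w r * (u' t r ^ 2 + ux t r ^ 2)))
      (Ici 0) t := by
  have d1 := h.hasDerivWithinAt_null hw (σ := 1) (by norm_num) ht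
  have d2 := h.hasDerivWithinAt_null hw (σ := -1) (by norm_num) ht
  have c : ∀ σ : ℝ, ContL2Loc fun t r => u' t r + σ * ux t r := fun σ =>
    h.cont_u'.add (h.cont_ux.const_mul σ)
  have c2 : ∀ σ : ℝ, ContL2Loc fun t r => σ * u' t r + ux t r := fun σ =>
    (h.cont_u'.const_mul σ).add h.cont_ux
  have i2 : ∀ σ : ℝ, Integrable fun r => 2 * (w r * ((u' t r + σ * ux t r) * N t r))
        - deriv w r * ((u' t r + σ * ux t r) * (σ * u' t r + ux t r)) := fun σ =>
    (((c σ).integrable_mul_mul h.cont_N hw ht ht).const_mul 2).sub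
      ((c σ).integrable_mul_mul (c2 σ) hw.deriv ht ht)
  -- Polarisation: u_t u_r = ((u_t + u_r)² − (u_t − u_r)²) / 4.
  have key : ∀ s, 0 ≤ s → ∫ r, w r * (u' s r * ux s r)
      = 1 / 4 * (∫ r, w r * ((u' s r + 1 * ux s r) * (u' s r + 1 * ux s r)))
        + -(1 / 4) * ∫ r, w r * ((u' s r + -1 * ux s r) * (u' s r + -1 * ux s r)) := fun s hs =>
    integral_add_mul (fun r => by ring) ((c 1).integrable_mul_mul (c 1) hw hs hs)
      ((c (-1)).integrable_mul_mul (c (-1)) hw hs hs)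
  refine (((d1.const_mul (1 / 4)).add (d2.const_mul (-(1 / 4)))).congr (fun s hs => ?_)
    ?_).congr_deriv ?_
  · exact key s hs
  · exact key t ht
  · exact (integral_add_mul (fun r => by ring) (i2 1) (i2 (-1))).symm

theorem integrable_virial (h : WeakWave u u' ux N) (h₂ : WeakWave u₂ u₂' ux₂ N₂) {w : ℝ → ℝ}
    (hw : IsTestFunction w) {t : ℝ} (ht : 0 ≤ t) :
    Integrable fun r => w r * (u' t r * u₂' t r - ux t r * ux₂ t r + N t r * u₂ t r)
      - deriv w r * (ux t r * u₂ t r) := by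
  have i1 := h.cont_u'.integrable_mul_mul h₂.cont_u' hw ht ht
  have i2 := h.cont_ux.integrable_mul_mul h₂.cont_ux hw ht ht
  have i3 := h.cont_N.integrable_mul_mul h₂.cont_u hw ht ht
  have i4 := h.cont_ux.integrable_mul_mul h₂.cont_u hw.deriv ht ht
  refine (((i1.sub i2).add i3).sub i4).congr (Eventually.of_forall fun r => ?_)
  simp only [Pi.sub_apply, Pi.add_apply]; ring

/-- The localised virial identity for a pair of solutions. -/
theorem hasDerivWithinAt_virial (h : WeakWave u u' ux N) (h₂ : WeakWave u₂ u₂' ux₂ N₂)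
    {w : ℝ → ℝ} (hw : IsTestFunction w) {t : ℝ} (ht : 0 ≤ t) :
    HasDerivWithinAt (fun s => ∫ r, w r * (u' s r * u₂ s r))
      (∫ r, (w r * (u' t r * u₂' t r - ux t r * ux₂ t r + N t r * u₂ t r)
        - deriv w r * (ux t r * u₂ t r))) (Ici 0) t := by
  obtain ⟨ζ, hζ, h1, h2, h3⟩ := hw.exists_eq_one
  have e1 : ∀ r, ζ r * w r = w r := fun r => by
    by_cases hr : w r = 0
    · simp [hr]
    · simp [h1 r hr]
  have e2 : ∀ r, ζ r * deriv w r = deriv w r := fun r => by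
    by_cases hr : deriv w r = 0
    · simp [hr]
    · simp [h2 r hr]
  have e3 : ∀ r, deriv ζ r * w r = 0 := fun r => by
    by_cases hr : w r = 0
    · simp [hr]
    · simp [h3 r hr]
  have c1 : ∀ σ : ℝ, ContL2Loc fun t r => u' t r + σ * ux t r := fun σ =>
    h.cont_u'.add (h.cont_ux.const_mul σ)
  have c2 : ∀ σ : ℝ, ContL2Loc fun t r => σ * u' t r + ux t r := fun σ =>
    (h.cont_u'.const_mul σ).add h.cont_ux
  have c3 : ∀ σ : ℝ, ContL2Loc fun t r => u₂' t r - σ * ux₂ t r := fun σ =>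
    h₂.cont_u'.sub (h₂.cont_ux.const_mul σ)
  have c4 : ∀ σ : ℝ, ContL2Loc fun t r => σ * u₂ t r := fun σ => h₂.cont_u.const_mul σ
  set I : ℝ → ℝ → ℝ := fun σ r => w r * ((u' t r + σ * ux t r) * (u₂' t r - σ * ux₂ t r))
    - deriv w r * ((u' t r + σ * ux t r) * (σ * u₂ t r)) + w r * (N t r * u₂ t r) with hI
  have hIi : ∀ σ, Integrable (I σ) := fun σ =>
    (((c1 σ).integrable_mul_mul (c3 σ) hw ht ht).sub
      ((c1 σ).integrable_mul_mul (c4 σ) hw.deriv ht ht)).add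
      (h.cont_N.integrable_mul_mul h₂.cont_u hw ht ht)
  -- The pairing needs equal speeds. The undifferentiated u₂ is transported at either speed, with
  -- the opposite null derivative as source, and the mean over σ = ±1 leaves u_t u₂.
  have hd : ∀ σ : ℝ, σ ^ 2 = 1 → HasDerivWithinAt
      (fun s => ∫ r, w r * ((u' s r + σ * ux s r) * u₂ s r)) (∫ r, I σ r) (Ici 0) t := by
    intro σ hσ
    have hd := (h.isTransport_null hζ hσ).hasDerivWithinAt_inner (h₂.isTransport_self hw σ) ht
    refine (hd.congr (fun s hs => ?_) ?_).congr_deriv ?_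
    · rw [(c1 σ).inner_lift h₂.cont_u hζ hw hs hs]; simp only [e1]
    · rw [(c1 σ).inner_lift h₂.cont_u hζ hw ht ht]; simp only [e1]
    · rw [inner_sub_right, inner_sub_left, (c1 σ).inner_lift (c3 σ) hζ hw ht ht,
        (c1 σ).inner_lift (c4 σ) hζ hw.deriv ht ht, h.cont_N.inner_lift h₂.cont_u hζ hw ht ht,
        (c2 σ).inner_lift h₂.cont_u hζ.deriv hw ht ht]
      simp only [e1, e2, e3, zero_mul, integral_zero, sub_zero]
      rw [hI, integral_add, integral_sub]
      · exact (c1 σ).integrable_mul_mul (c3 σ) hw ht ht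
      · exact (c1 σ).integrable_mul_mul (c4 σ) hw.deriv ht ht
      · exact ((c1 σ).integrable_mul_mul (c3 σ) hw ht ht).sub
          ((c1 σ).integrable_mul_mul (c4 σ) hw.deriv ht ht)
      · exact h.cont_N.integrable_mul_mul h₂.cont_u hw ht ht
  have key : ∀ s, 0 ≤ s → ∫ r, w r * (u' s r * u₂ s r)
      = 1 / 2 * (∫ r, w r * ((u' s r + 1 * ux s r) * u₂ s r))
        + 1 / 2 * ∫ r, w r * ((u' s r + -1 * ux s r) * u₂ s r) := fun s hs =>
    integral_add_mul (fun r => by ring) ((c1 1).integrable_mul_mul h₂.cont_u hw hs hs)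
      ((c1 (-1)).integrable_mul_mul h₂.cont_u hw hs hs)
  refine ((((hd 1 (by norm_num)).const_mul (1 / 2)).add
    ((hd (-1) (by norm_num)).const_mul (1 / 2))).congr (fun s hs => ?_) ?_).congr_deriv ?_
  · exact key s hs
  · exact key t ht
  · exact (integral_add_mul (fun r => by simp only [hI]; ring) (hIi 1) (hIi (-1))).symm

/-- The localised solution is differentiable in time as a curve of square integrable functions. -/
theorem hasDerivWithinAt_lift (h : WeakWave u u' ux N) {w : ℝ → ℝ} (hw : IsTestFunction w)
    {t : ℝ} (ht : 0 ≤ t) : HasDerivWithinAt (lift w u) (lift w u' t) (Ici 0) t := by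
  refine hasDerivWithinAt_of_weak (b := lift w u')
    (Lp.dense_hasCompactSupport_contDiff (E := ℝ) (F := ℝ) (μ := volume)
    (p := 2) (by simp)) (h.cont_u.continuousOn_lift hw) (h.cont_u'.continuousOn_lift hw) ?_ ht
  rintro f ⟨χ, hfχ, hc, hχ⟩ t ht
  have hm : MemLp χ 2 volume := hχ.continuous.memLp_of_hasCompactSupport hc
  have hf : f = hm.toLp χ := by
    rw [← Lp.toLp_coeFn f (Lp.memLp f)]; exact MemLp.toLp_congr _ _ hfχ
  have hwχ : IsTestFunction fun r => w r * χ r := hw.mul_contDiffOn hχ.contDiffOn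
  refine ((h.position _ hwχ t ht).congr (fun s hs => ?_) ?_).congr_deriv ?_
  · rw [hf, inner_toLp_left]; exact h.cont_u.integral_lift hw χ hs
  · rw [hf, inner_toLp_left]; exact h.cont_u.integral_lift hw χ ht
  · rw [hf, inner_toLp_left]; exact (h.cont_u'.integral_lift hw χ ht).symm

end WeakWave

/-! ### The pointwise inequality behind the Morawetz estimate -/

theorem sinh_le_mul_cosh {y : ℝ} (hy : 0 ≤ y) : sinh y ≤ y * cosh y := by
  have hd : ∀ x : ℝ, HasDerivAt (fun x => x * cosh x - sinh x) (x * sinh x) x := fun x => by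
    refine (((hasDerivAt_id x).mul (hasDerivAt_cosh x)).sub (hasDerivAt_sinh x)).congr_deriv ?_
    simp
  have hm : MonotoneOn (fun x => x * cosh x - sinh x) (Ici 0) := by
    refine monotoneOn_of_deriv_nonneg (convex_Ici 0)
      (fun x _ => (hd x).continuousAt.continuousWithinAt)
      (fun x _ => (hd x).differentiableAt.differentiableWithinAt) fun x hx => ?_
    rw [(hd x).deriv]
    rw [interior_Ici] at hx
    exact mul_nonneg (le_of_lt hx) (sinh_nonneg_iff.2 (le_of_lt hx))
  have := hm self_mem_Ici (mem_Ici.2 hy) hy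
  simp at this
  linarith

/-- In half angles this is 4 sinh² y ≤ 4 y sinh y cosh y. -/
theorem two_mul_cosh_sub_one_le {θ : ℝ} (hθ : 0 ≤ θ) : 2 * (cosh θ - 1) ≤ θ * sinh θ := by
  obtain ⟨y, rfl⟩ : ∃ y, θ = 2 * y := ⟨θ / 2, by ring⟩
  have hy : 0 ≤ y := by linarith
  have h1 := sinh_le_mul_cosh hy
  have h2 : 0 ≤ sinh y := sinh_nonneg_iff.2 hy
  rw [cosh_two_mul, sinh_two_mul, cosh_sq]
  nlinarith [mul_le_mul_of_nonneg_left h1 h2]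

/-- In half angles this is sinh y cosh y ≤ y cosh² y. -/
theorem two_mul_sinh_sub_le {θ : ℝ} (hθ : 0 ≤ θ) : 2 * (sinh θ - θ) ≤ θ * (cosh θ - 1) := by
  obtain ⟨y, rfl⟩ : ∃ y, θ = 2 * y := ⟨θ / 2, by ring⟩
  have hy : 0 ≤ y := by linarith
  have h1 := sinh_le_mul_cosh hy
  have h2 : 0 < cosh y := cosh_pos y
  have h3 := cosh_sq y
  rw [cosh_two_mul, sinh_two_mul]
  nlinarith [mul_le_mul_of_nonneg_left h1 h2.le]

theorem half_cubic_le_exp {θ : ℝ} (hθ : 0 ≤ θ) : 1 + θ + θ ^ 2 / 2 + θ ^ 3 / 6 ≤ exp θ := by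
  have := Real.sum_le_exp_of_nonneg hθ 4
  simp [Finset.sum_range_succ, Nat.factorial] at this
  linarith

theorem pow_four_le_mul_sinh {θ : ℝ} (hθ : 0 ≤ θ) : θ ^ 4 / 12 ≤ θ * sinh θ := by
  have h1 := half_cubic_le_exp hθ
  have h2 : exp (-θ) ≤ 1 := exp_le_one_iff.2 (by linarith)
  have h3 : θ ^ 3 / 12 ≤ sinh θ := by
    rw [sinh_eq]
    nlinarith [sq_nonneg θ]
  calc θ ^ 4 / 12 = θ * (θ ^ 3 / 12) := by ring
    _ ≤ _ := by gcongr

/-- The cubic term of exp gives θ³ / 12; from 2 on, the terms of lower order compensate the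
subtracted 1. -/
theorem pow_four_le_mul_cosh {θ : ℝ} (hθ : 2 ≤ θ) : θ ^ 4 / 12 ≤ θ * (cosh θ - 1) := by
  have h1 := half_cubic_le_exp (by linarith : 0 ≤ θ)
  have h2 : 0 ≤ exp (-θ) := (exp_pos _).le
  have h3 : θ ^ 3 / 12 ≤ cosh θ - 1 := by
    rw [cosh_eq]
    nlinarith [sq_nonneg θ]
  have h4 : 0 ≤ θ := by linarith
  calc θ ^ 4 / 12 = θ * (θ ^ 3 / 12) := by ring
    _ ≤ _ := by gcongr

/-- The polynomial inequality that limits the admissible endpoints in the Morawetz estimate. -/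
theorem morawetz_coefficient {S C : ℝ} (hSC : C ^ 2 = S ^ 2 + 1) (hC : 1 ≤ C)
    (hC2 : C ≤ 2) :
    2 * S * (2 * C ^ 2 - 1)
      ≤ 4 / 5 * (1 / 2 * (3 * C - 1) * (2 * C ^ 2 - 1) + 3 * (C - 1) * (2 * S * C)) := by
  -- The tangent of S² at S = 3/4, with S² = C² − 1; it eliminates S.
  have h1 : S ≤ (C ^ 2 - 7 / 16) / (3 / 2) := by nlinarith [sq_nonneg (S - 3 / 4)]
  -- Up to the factor 2/5, collecting the terms with S leaves S (−2 C² + 12 C − 5) ≤ (3 C − 1)(2 C²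
  -- − 1).
  have h2 : 0 ≤ -2 * C ^ 2 + 12 * C - 5 := by nlinarith
  have h3 : (C ^ 2 - 7 / 16) / (3 / 2) * (-2 * C ^ 2 + 12 * C - 5)
      ≤ (3 * C - 1) * (2 * C ^ 2 - 1) := by
    obtain ⟨d, rfl⟩ : ∃ d, C = 1 + d := ⟨C - 1, by ring⟩
    have hd : 0 ≤ d := by linarith
    have : 0 ≤ 1 / 8 + 4 / 3 * d + 11 / 4 * d ^ 2 + 10 / 3 * d ^ 3 + 4 / 3 * d ^ 4 := by positivity
    linear_combination this
  nlinarith [mul_le_mul_of_nonneg_right h1 h2]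

/-- In the application S = sinh P, C = cosh P, c = cosh r and θ = 2 (ψ − P). For θ ≥ 0 all
hyperbolic terms of the gain have one sign; the last line, due to the variation of P, costs at most
4/5 of the gain, and the remaining fifth controls θ⁴. -/
theorem morawetz_pos_case {S C c θ : ℝ} (hS : 0 ≤ S) (hSC : C ^ 2 = S ^ 2 + 1) (hC : 1 ≤ C)
    (hc : 3 * C - 2 ≤ c) (hθ : 0 ≤ θ) :
    (c + 1) * θ ^ 4 / 1680 ≤
      (c - 1) * ((2 * C ^ 2 - 1) * (cosh θ - 1) + 2 * S * C * (sinh θ - θ))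
      + 1 / 2 * (c + 1) * ((2 * C ^ 2 - 1) * (θ * sinh θ) + 2 * S * C * (θ * (cosh θ - 1)))
      - 2 * S * (2 * S * C * (cosh θ - 1) + (2 * C ^ 2 - 1) * (sinh θ - θ)) := by
  have hA : 0 ≤ cosh θ - 1 := by linarith [one_le_cosh θ]
  have hB : 0 ≤ sinh θ - θ := by linarith [self_le_sinh_iff.2 hθ]
  have hW := two_mul_cosh_sub_one_le hθ
  have hV := two_mul_sinh_sub_le hθ
  have h4 := pow_four_le_mul_sinh hθ
  set A := cosh θ - 1
  set B := sinh θ - θ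
  set W := θ * sinh θ
  set V := θ * A
  have hC2' : 1 ≤ 2 * C ^ 2 - 1 := by nlinarith
  have hSC0 : 0 ≤ 2 * S * C := by positivity
  have hX : 0 ≤ (2 * C ^ 2 - 1) * A + 2 * S * C * B := by positivity
  have hY : (2 * C ^ 2 - 1) * (2 * A) + 2 * S * C * (2 * B) ≤ (2 * C ^ 2 - 1) * W + 2 * S * C * V := by
    gcongr
  have hY' : θ ^ 4 / 12 ≤ (2 * C ^ 2 - 1) * W + 2 * S * C * V := by
    have e1 : 0 ≤ V := by linarith
    have e2 : 0 ≤ W := by linarith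
    have e3 := mul_le_mul_of_nonneg_right hC2' e2
    have e4 := mul_nonneg hSC0 e1
    linarith
  set X := (2 * C ^ 2 - 1) * A + 2 * S * C * B
  set Y := (2 * C ^ 2 - 1) * W + 2 * S * C * V
  -- The comparison value is a lower bound of the gain: as 2 X ≤ Y, (3 C − 3) X + ½ (3 C − 1) Y ≥ 2
  -- (3 C − 2) X.
  have hZ : 2 * S * (2 * S * C * A + (2 * C ^ 2 - 1) * B) ≤ 4 / 5 * (2 * (3 * C - 2) * X) := by
    have e1 : 0 ≤ A * (4 / 5 * 2 * (3 * C - 2) * (2 * C ^ 2 - 1) - 4 * S ^ 2 * C) := by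
      refine mul_nonneg hA ?_
      have : S ^ 2 = C ^ 2 - 1 := by linarith
      rw [this]
      nlinarith [mul_nonneg (sub_nonneg.2 hC) (sub_nonneg.2 hC), pow_nonneg (sub_nonneg.2 hC) 3]
    have e2 : 0 ≤ 2 * S * B * (4 / 5 * 2 * (3 * C - 2) * C - (2 * C ^ 2 - 1)) := by
      refine mul_nonneg (by positivity) ?_
      nlinarith
    simp only [X]
    linear_combination e1 + e2
  have h5 : 2 * (3 * C - 2) * X ≤ (c - 1) * X + 1 / 2 * (c + 1) * Y := by
    have e1 : (3 * C - 3) * X ≤ (c - 1) * X := mul_le_mul_of_nonneg_right (by linarith) hX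
    have e2 : 1 / 2 * (3 * C - 1) * (2 * X) ≤ 1 / 2 * (c + 1) * Y := by
      have : 2 * X ≤ Y := by simp only [X]; linarith
      have : 0 ≤ Y := by linarith
      have h0 : 0 ≤ 1 / 2 * (3 * C - 1) := by linarith
      have h1 : 1 / 2 * (3 * C - 1) ≤ 1 / 2 * (c + 1) := by linarith
      calc _ ≤ 1 / 2 * (3 * C - 1) * Y := by gcongr
        _ ≤ _ := by gcongr
    linarith
  have h6 : 1 / 2 * (c + 1) * (θ ^ 4 / 12) ≤ 1 / 2 * (c + 1) * Y := by
    have : 0 ≤ c + 1 := by linarith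
    gcongr
  have h7 : 0 ≤ (c - 1) * X := mul_nonneg (by linarith) hX
  have h8 : 0 ≤ (c + 1) * θ ^ 4 := mul_nonneg (by linarith) (by positivity)
  linarith

/-- For ψ < P the sinh 2P terms change sign. Writing sinh σ = (cosh σ − 1) + e with e = 1 − exp(−σ)
attaches the exponentially growing part to D = cosh 2P − sinh 2P > 0, and the rest involves only σ −
e, which `morawetz_coefficient` can absorb. -/
theorem morawetz_neg_case {S C c σ : ℝ} (hS : 0 ≤ S) (hSC : C ^ 2 = S ^ 2 + 1) (hC : 1 ≤ C)
    (hC2 : C ≤ 2) (hc : 3 * C - 2 ≤ c) (hσ : 0 ≤ σ) :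
    (c + 1) * σ ^ 4 / 1680 ≤
      (c - 1) * ((2 * C ^ 2 - 1) * (cosh σ - 1) - 2 * S * C * (sinh σ - σ))
      + 1 / 2 * (c + 1) * ((2 * C ^ 2 - 1) * (σ * sinh σ) - 2 * S * C * (σ * (cosh σ - 1)))
      - 2 * S * (2 * S * C * (cosh σ - 1) - (2 * C ^ 2 - 1) * (sinh σ - σ)) := by
  obtain ⟨e, he⟩ : ∃ e, e = 1 - exp (-σ) := ⟨_, rfl⟩
  have hA : 0 ≤ cosh σ - 1 := by linarith [one_le_cosh σ]
  have hsinh : sinh σ = cosh σ - 1 + e := by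
    have := cosh_sub_sinh σ
    rw [he]; linarith
  have he1 : e ≤ σ := by linarith [add_one_le_exp (-σ)]
  -- Equivalent to (1 + σ) exp(−σ) ≤ 1.
  have he2 : σ - e ≤ σ * e := by
    have h1 := add_one_le_exp σ
    have h2 : exp σ * exp (-σ) = 1 := by rw [← exp_add]; simp
    have h3 : (σ + 1) * exp (-σ) ≤ exp σ * exp (-σ) := by gcongr
    rw [he]; nlinarith
  have he0 : 0 ≤ e := by
    have : exp (-σ) ≤ 1 := exp_le_one_iff.2 (by linarith)
    linarith
  have h4 : 2 ≤ σ → σ ^ 4 / 12 ≤ σ * (cosh σ - 1) := pow_four_le_mul_cosh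
  rw [hsinh]
  set A := cosh σ - 1
  -- The product with the conjugate (C + S)² is 1, and C ≤ 2 gives (C + S)² ≤ (2 + √3)² < 14.
  have hDpos : 1 / 14 ≤ 2 * C ^ 2 - 1 - 2 * S * C := by
    have h1 : (2 * C ^ 2 - 1 - 2 * S * C) * (2 * C ^ 2 - 1 + 2 * S * C) = 1 := by
      have : S ^ 2 = C ^ 2 - 1 := by linarith
      ring_nf; rw [this]; ring
    have h2 : 2 * C ^ 2 - 1 + 2 * S * C ≤ 14 := by nlinarith
    have h3 : 0 < 2 * C ^ 2 - 1 + 2 * S * C := by nlinarith [mul_nonneg hS (by linarith : 0 ≤ C)]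
    by_contra hcon
    push Not at hcon
    have := mul_lt_mul_of_pos_right hcon h3
    linarith
  have hco := morawetz_coefficient hSC hC hC2
  have hC2' : 1 ≤ 2 * C ^ 2 - 1 := by nlinarith
  have hSC0 : 0 ≤ 2 * S * C := by positivity
  obtain ⟨D, hD⟩ : ∃ D, D = 2 * C ^ 2 - 1 - 2 * S * C := ⟨_, rfl⟩
  obtain ⟨K, hK⟩ : ∃ K, K = 2 * C ^ 2 - 1 := ⟨_, rfl⟩
  obtain ⟨T, hT⟩ : ∃ T, T = 2 * S * C := ⟨_, rfl⟩
  rw [← hK, ← hT] at hco hD hDpos ⊢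
  rw [← hK] at hC2'
  rw [← hT] at hSC0
  rw [← hD] at hDpos
  have hK0 : 0 ≤ K := by linarith
  have hσe : 0 ≤ σ - e := by linarith
  have hDT : K = D + T := by rw [hD]; ring
  -- For σ ≤ 2 the term K σ e suffices; beyond 2 the cosh term does, with constant 14 · 12 = 168.
  have hY : σ ^ 4 / 168 ≤ D * (σ * A) + K * (σ * e) := by
    rcases le_total σ 2 with h2 | h2
    · have e1 : 0 ≤ D * (σ * A) := mul_nonneg (by linarith) (by positivity)
      have e2 : σ * e ≤ K * (σ * e) := le_mul_of_one_le_left (by positivity) hC2'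
      have e3 : σ ≤ 3 * e := by
        have := mul_le_mul_of_nonneg_right h2 he0
        linarith
      have e4 : σ * σ ≤ 3 * (σ * e) := by
        have := mul_le_mul_of_nonneg_left e3 hσ
        linarith
      have e5 : σ ^ 4 ≤ 4 * (σ * σ) := by
        have : σ * σ ≤ 2 * 2 := by gcongr
        calc σ ^ 4 = (σ * σ) * (σ * σ) := by ring
          _ ≤ 2 * 2 * (σ * σ) := by gcongr
          _ = _ := by ring
      linarith
    · have e1 : 1 / 14 * (σ ^ 4 / 12) ≤ D * (σ * A) := by
        have := h4 h2
        have : 1 / 14 ≤ D := by linarith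
        gcongr
      have e2 : 0 ≤ K * (σ * e) := by positivity
      linarith
  have hX : 0 ≤ D * A + T * (σ - e) := by
    have : 0 ≤ σ - e := by linarith
    have : 0 ≤ D := by linarith
    positivity
  obtain ⟨X, hXd⟩ : ∃ X, X = D * A + T * (σ - e) := ⟨_, rfl⟩
  obtain ⟨Y, hYd⟩ : ∃ Y, Y = D * (σ * A) + K * (σ * e) := ⟨_, rfl⟩
  rw [← hYd] at hY
  rw [← hXd] at hX
  -- The loss is at most 2 S K (σ − e). It is paid through X ≥ T (σ − e) and, by σ − e ≤ σ e,
  -- through Y ≥ K (σ − e), with the coefficients of `hco`.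
  have hZ : 2 * S * (K * (σ - e) - D * A) ≤ 4 / 5 * ((c - 1) * X + 1 / 2 * (c + 1) * Y) := by
    have hY0 : 0 ≤ Y := le_trans (by positivity) hY
    have e1 : 3 * (C - 1) * X ≤ (c - 1) * X := mul_le_mul_of_nonneg_right (by linarith) hX
    have e2 : 1 / 2 * (3 * C - 1) * Y ≤ 1 / 2 * (c + 1) * Y :=
      mul_le_mul_of_nonneg_right (by linarith) hY0
    have e3 : 3 * (C - 1) * (T * (σ - e)) ≤ 3 * (C - 1) * X := by
      have : 0 ≤ 3 * (C - 1) := by linarith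
      have : 0 ≤ D * A := mul_nonneg (by linarith) hA
      gcongr
      linarith
    have e4 : 1 / 2 * (3 * C - 1) * (K * (σ - e)) ≤ 1 / 2 * (3 * C - 1) * Y := by
      have : 0 ≤ 1 / 2 * (3 * C - 1) := by linarith
      have h1 : 0 ≤ D * (σ * A) := mul_nonneg (by linarith) (by positivity)
      have h2 : K * (σ - e) ≤ K * (σ * e) := by gcongr
      gcongr
      linarith
    have e5 : 2 * S * K * (σ - e)
        ≤ 4 / 5 * (1 / 2 * (3 * C - 1) * K + 3 * (C - 1) * T) * (σ - e) :=
      mul_le_mul_of_nonneg_right hco hσe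
    have e6 : 0 ≤ 2 * S * (D * A) := mul_nonneg (by positivity) (mul_nonneg (by linarith) hA)
    linarith
  have h6 : 1 / 2 * (c + 1) * (σ ^ 4 / 168) ≤ 1 / 2 * (c + 1) * Y := by
    have : 0 ≤ c + 1 := by linarith
    gcongr
  have h7 : 0 ≤ (c - 1) * X := mul_nonneg (by linarith) hX
  have e7 : (c - 1) * (K * A - T * (A + e - σ)) + 1 / 2 * (c + 1) * (K * (σ * (A + e)) - T * (σ * A))
      - 2 * S * (T * A - K * (A + e - σ))
      = (c - 1) * X + 1 / 2 * (c + 1) * Y - 2 * S * (K * (σ - e) - D * A) := by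
    rw [hXd, hYd, hDT]; ring
  rw [e7]
  linarith

/-- The potential of the equation for a perturbation `ψ - a` of the harmonic map. -/
noncomputable def potential (a p : ℝ) : ℝ :=
  1 / 2 * (sinh p ^ 2 - sinh a ^ 2 - (p - a) * sinh (2 * a))

/-- Coercivity of the quantity in the Morawetz identity. -/
theorem morawetz_pointwise {a p c : ℝ} (ha : 0 ≤ a) (hC2 : cosh a ≤ 2)
    (hc : 3 * cosh a - 2 ≤ c) :
    (c + 1) * (p - a) ^ 4 / 420 ≤ potential a p * (c - 1)
      + 1 / 2 * (c + 1) * ((p - a) * (1 / 2 * (sinh (2 * p) - sinh (2 * a))))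
      - sinh a * (1 / 2 * (sinh (2 * p) - sinh (2 * a) - 2 * (p - a) * cosh (2 * a))) := by
  obtain ⟨φ, rfl⟩ : ∃ φ, p = a + φ := ⟨p - a, by ring⟩
  have hS : 0 ≤ sinh a := sinh_nonneg_iff.2 ha
  have hSC := cosh_sq a
  have hC := one_le_cosh a
  have e1 : sinh (2 * (a + φ)) = sinh (2 * a) * cosh (2 * φ) + cosh (2 * a) * sinh (2 * φ) := by
    rw [← sinh_add]; ring_nf
  have e2 : sinh (a + φ) ^ 2 = (cosh (2 * a) * cosh (2 * φ) + sinh (2 * a) * sinh (2 * φ) - 1) / 2 := by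
    rw [← cosh_add, ← mul_add, cosh_two_mul, cosh_sq]; ring
  have e3 : sinh a ^ 2 = (cosh (2 * a) - 1) / 2 := by rw [cosh_two_mul, cosh_sq]; ring
  have e4 : cosh (2 * a) = 2 * cosh a ^ 2 - 1 := by rw [cosh_two_mul, hSC]; ring
  have e5 : sinh (2 * a) = 2 * sinh a * cosh a := sinh_two_mul a
  rw [potential, e1, e2, e3, e4, e5]
  -- Both cases are stated for the doubled deviation, whence 16 / (4 · 1680) = 1 / 420.
  rcases le_total 0 φ with h | h
  · have := morawetz_pos_case hS hSC hC hc (θ := 2 * φ) (by linarith)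
    linear_combination 1 / 4 * this
  · have := morawetz_neg_case hS hSC hC hC2 hc (σ := -(2 * φ)) (by linarith)
    rw [sinh_neg, cosh_neg] at this
    linear_combination 1 / 4 * this

/-! ### The harmonic maps -/

theorem hasDerivAt_tanh_half (r : ℝ) :
    HasDerivAt (fun r => tanh (r / 2)) ((1 - tanh (r / 2) ^ 2) / 2) r := by
  have h1 : HasDerivAt (fun r : ℝ => r / 2) (1 / 2) r := (hasDerivAt_id r).div_const 2
  have h2 : cosh (r / 2) ≠ 0 := (cosh_pos _).ne'
  have e : (fun r => tanh (r / 2)) = fun r => sinh (r / 2) / cosh (r / 2) := by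
    ext r; exact tanh_eq_sinh_div_cosh _
  rw [e, tanh_eq_sinh_div_cosh]
  refine ((h1.sinh).div (h1.cosh) h2).congr_deriv ?_
  field_simp

theorem cosh_eq_tanh_half (r : ℝ) : cosh r * (1 - tanh (r / 2) ^ 2) = 1 + tanh (r / 2) ^ 2 := by
  have h2 : cosh (r / 2) ≠ 0 := (cosh_pos _).ne'
  have h3 := cosh_sq (r / 2)
  have h4 : cosh r = cosh (r / 2) ^ 2 + sinh (r / 2) ^ 2 := by rw [← cosh_two_mul]; ring_nf
  rw [tanh_eq_sinh_div_cosh, h4]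
  field_simp
  have : sinh (r / 2) ^ 2 = cosh (r / 2) ^ 2 - 1 := by linarith
  rw [this]; ring

theorem sinh_eq_tanh_half (r : ℝ) : sinh r * (1 - tanh (r / 2) ^ 2) = 2 * tanh (r / 2) := by
  have h2 : cosh (r / 2) ≠ 0 := (cosh_pos _).ne'
  have h3 := cosh_sq (r / 2)
  have h4 : sinh r = 2 * sinh (r / 2) * cosh (r / 2) := by rw [← sinh_two_mul]; ring_nf
  rw [tanh_eq_sinh_div_cosh, h4]
  field_simp
  have : sinh (r / 2) ^ 2 = cosh (r / 2) ^ 2 - 1 := by linarith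
  rw [this]; ring

section

variable {lam : ℝ}

theorem abs_mul_tanh_lt (h0 : 0 ≤ lam) (h1 : lam < 1) (y : ℝ) : lam * tanh y ∈ Ioo (-1) 1 := by
  have a := neg_one_lt_tanh y
  have b := tanh_lt_one y
  constructor <;> nlinarith

theorem harmonicMap_eq (h0 : 0 ≤ lam) (h1 : lam < 1) (r : ℝ) :
    harmonicMap lam r = log (1 + lam * tanh (r / 2)) - log (1 - lam * tanh (r / 2)) := by
  obtain ⟨a, b⟩ := abs_mul_tanh_lt h0 h1 (r / 2)
  rw [harmonicMap, artanh_eq_half_log ⟨a.le, b.le⟩, log_div (by linarith) (by linarith)]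
  ring

theorem exp_harmonicMap (h0 : 0 ≤ lam) (h1 : lam < 1) (r : ℝ) :
    exp (harmonicMap lam r) = (1 + lam * tanh (r / 2)) / (1 - lam * tanh (r / 2)) := by
  obtain ⟨a, b⟩ := abs_mul_tanh_lt h0 h1 (r / 2)
  rw [harmonicMap_eq h0 h1, exp_sub, exp_log (by linarith), exp_log (by linarith)]

theorem sinh_harmonicMap (h0 : 0 ≤ lam) (h1 : lam < 1) (r : ℝ) :
    sinh (harmonicMap lam r)
      = 2 * (lam * tanh (r / 2)) / (1 - (lam * tanh (r / 2)) ^ 2) := by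
  obtain ⟨a, b⟩ := abs_mul_tanh_lt h0 h1 (r / 2)
  have h2 : 1 + lam * tanh (r / 2) ≠ 0 := by linarith
  have h3 : 1 - lam * tanh (r / 2) ≠ 0 := by linarith
  have h4 : 1 - (lam * tanh (r / 2)) ^ 2 ≠ 0 := by nlinarith
  rw [sinh_eq, exp_neg, exp_harmonicMap h0 h1]
  generalize lam * tanh (r / 2) = y at *
  field_simp
  ring

theorem cosh_harmonicMap (h0 : 0 ≤ lam) (h1 : lam < 1) (r : ℝ) :
    cosh (harmonicMap lam r)
      = (1 + (lam * tanh (r / 2)) ^ 2) / (1 - (lam * tanh (r / 2)) ^ 2) := by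
  obtain ⟨a, b⟩ := abs_mul_tanh_lt h0 h1 (r / 2)
  have h2 : 1 + lam * tanh (r / 2) ≠ 0 := by linarith
  have h3 : 1 - lam * tanh (r / 2) ≠ 0 := by linarith
  have h4 : 1 - (lam * tanh (r / 2)) ^ 2 ≠ 0 := by nlinarith
  rw [cosh_eq, exp_neg, exp_harmonicMap h0 h1]
  generalize lam * tanh (r / 2) = y at *
  field_simp
  ring

/-- The first order equation of the harmonic map. -/
theorem hasDerivAt_harmonicMap (h0 : 0 ≤ lam) (h1 : lam < 1) {r : ℝ} (hr : 0 < r) :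
    HasDerivAt (harmonicMap lam) (sinh (harmonicMap lam r) / sinh r) r := by
  obtain ⟨a, b⟩ := abs_mul_tanh_lt h0 h1 (r / 2)
  have h2 : 1 + lam * tanh (r / 2) ≠ 0 := by linarith
  have h3 : 1 - lam * tanh (r / 2) ≠ 0 := by linarith
  have hd := (hasDerivAt_tanh_half r).const_mul lam
  have e : harmonicMap lam = fun r => log (1 + lam * tanh (r / 2)) - log (1 - lam * tanh (r / 2)) := by
    ext r; exact harmonicMap_eq h0 h1 r
  have hd2 := ((hd.const_add 1).log h2).sub ((hd.const_sub 1).log h3)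
  rw [e]
  refine hd2.congr_deriv ?_
  rw [← e]
  have hs : sinh r ≠ 0 := (sinh_pos_iff.2 hr).ne'
  have h4 : 1 - (lam * tanh (r / 2)) ^ 2 ≠ 0 := by nlinarith
  have h5 := sinh_eq_tanh_half r
  rw [sinh_harmonicMap h0 h1]
  generalize tanh (r / 2) = x at *
  have h6 : 1 - (lam * x) ^ 2 = (1 + lam * x) * (1 - lam * x) := by ring
  rw [h6] at *
  field_simp
  linear_combination 2 * lam * h5

theorem harmonicMap_nonneg (h0 : 0 ≤ lam) {r : ℝ} (hr : 0 ≤ r) : 0 ≤ harmonicMap lam r := by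
  have : 0 ≤ tanh (r / 2) := by
    rw [tanh_eq_sinh_div_cosh]
    exact div_nonneg (sinh_nonneg_iff.2 (by linarith)) (cosh_pos _).le
  exact mul_nonneg (by norm_num) (artanh_nonneg (mul_nonneg h0 this))

theorem tendsto_harmonicMap (h0 : 0 ≤ lam) (h1 : lam < 1) :
    Tendsto (harmonicMap lam) atTop (𝓝 (2 * artanh lam)) := by
  have ht : Tendsto (fun r : ℝ => tanh (r / 2)) atTop (𝓝 1) := by
    have e : ∀ r : ℝ, tanh (r / 2) = 1 - 2 / (exp r + 1) := by
      intro r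
      have h2 : exp r = exp (r / 2) * exp (r / 2) := by rw [← exp_add]; ring_nf
      have h3 := exp_pos (r / 2)
      rw [tanh_eq_sinh_div_cosh, sinh_eq, cosh_eq, exp_neg, h2]
      field_simp
      ring
    simp only [e]
    have : Tendsto (fun r : ℝ => 2 / (exp r + 1)) atTop (𝓝 0) :=
      (tendsto_exp_atTop.atTop_add tendsto_const_nhds).const_div_atTop 2
    simpa using this.const_sub 1
  have h2 : Tendsto (fun r => log (1 + lam * tanh (r / 2)) - log (1 - lam * tanh (r / 2))) atTop
      (𝓝 (log (1 + lam * 1) - log (1 - lam * 1))) :=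
    (((ht.const_mul lam).const_add 1).log (by linarith)).sub
      (((ht.const_mul lam).const_sub 1).log (by linarith))
  have h3 : 2 * artanh lam = log (1 + lam * 1) - log (1 - lam * 1) := by
    rw [artanh_eq_half_log ⟨by linarith, h1.le⟩, log_div (by linarith) (by linarith)]; ring_nf
  rw [h3]
  exact h2.congr fun r => (harmonicMap_eq h0 h1 r).symm

theorem harmonicMap_zero_left (r : ℝ) : harmonicMap 0 r = 0 := by simp [harmonicMap]

/-- The bounds on the range of the harmonic map that make the Morawetz estimate coercive. -/
theorem cosh_harmonicMap_le (h0 : 0 ≤ lam) (h1 : lam ^ 2 ≤ 1 / 3) (r : ℝ) :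
    cosh (harmonicMap lam r) ≤ 2 ∧ 3 * cosh (harmonicMap lam r) - 2 ≤ cosh r := by
  have h1' : lam < 1 := by nlinarith
  have a := neg_one_lt_tanh (r / 2)
  have b := tanh_lt_one (r / 2)
  have hc := cosh_eq_tanh_half r
  rw [cosh_harmonicMap h0 h1']
  generalize tanh (r / 2) = x at *
  have hx : x ^ 2 < 1 := by nlinarith
  have hx0 : 0 ≤ x ^ 2 := sq_nonneg x
  have e : (lam * x) ^ 2 = lam ^ 2 * x ^ 2 := by ring
  rw [e]
  have hy : lam ^ 2 * x ^ 2 ≤ x ^ 2 / 3 := by nlinarith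
  generalize lam ^ 2 * x ^ 2 = y at *
  have hy1 : 0 < 1 - y := by linarith
  -- cosh P increases with λ², so λ² = 1/3 is the worst case; its limit as x → 1 is 2.
  have hd : (1 + y) / (1 - y) ≤ (1 + x ^ 2 / 3) / (1 - x ^ 2 / 3) := by
    rw [div_le_div_iff₀ hy1 (by linarith)]; nlinarith
  have hc' : cosh r = (1 + x ^ 2) / (1 - x ^ 2) := by
    rw [eq_div_iff (by linarith)]; exact hc
  constructor
  · refine hd.trans ?_
    rw [div_le_iff₀ (by linarith)]; linarith
  · have h5 : 3 * ((1 + x ^ 2 / 3) / (1 - x ^ 2 / 3)) - 2 ≤ cosh r := by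
      rw [hc', ← sub_nonneg]
      -- Near the origin cosh r is about 1 + 2 x² and 3 cosh P − 2 about 1 + 6 λ² x², so 1/3 is the
      -- threshold and the difference starts at order x⁴.
      have h6 : (1 + x ^ 2) / (1 - x ^ 2) - (3 * ((1 + x ^ 2 / 3) / (1 - x ^ 2 / 3)) - 2)
          = (4 / 3 * (x ^ 2) ^ 2) / ((1 - x ^ 2) * (1 - x ^ 2 / 3)) := by
        have : 1 - x ^ 2 ≠ 0 := by linarith
        have : 1 - x ^ 2 / 3 ≠ 0 := by linarith
        have : 3 - x ^ 2 ≠ 0 := by linarith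
        field_simp
        ring
      rw [h6]
      exact div_nonneg (by positivity) (mul_nonneg (by linarith) (by linarith))
    linarith

end

/-! ### Logarithmic cutoffs -/

theorem exists_deriv_smoothTransition_bound :
    ∃ K : ℝ, 0 ≤ K ∧ ∀ x, |deriv smoothTransition x| ≤ K := by
  have hc : Continuous (deriv smoothTransition) :=
    (smoothTransition.contDiff (n := 1)).continuous_deriv le_rfl
  have hs : HasCompactSupport (deriv smoothTransition) := by
    refine HasCompactSupport.of_support_subset_isCompact (isCompact_Icc (a := (0 : ℝ)) (b := 1)) ?_
    intro x hx
    by_contra h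
    rw [mem_Icc, not_and_or, not_le, not_le] at h
    apply hx
    rcases h with h | h
    · have : smoothTransition =ᶠ[𝓝 x] fun _ => 0 := by
        filter_upwards [Iio_mem_nhds h] with y hy using smoothTransition.zero_of_nonpos (le_of_lt hy)
      rw [this.deriv_eq]; simp
    · have : smoothTransition =ᶠ[𝓝 x] fun _ => 1 := by
        filter_upwards [Ioi_mem_nhds h] with y hy using smoothTransition.one_of_one_le (le_of_lt hy)
      rw [this.deriv_eq]; simp
  obtain ⟨C, hC⟩ := hc.bounded_above_of_compact_support hs
  exact ⟨C, (norm_nonneg _).trans (hC 0), hC⟩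

/-- A cutoff that equals `1` where `|log (sinh r)| ≤ N` and vanishes where
`|log (sinh r)| ≥ 2 N`. -/
noncomputable def cutoff (N : ℝ) : ℝ → ℝ :=
  (Ioi (0 : ℝ)).indicator fun r =>
    smoothTransition (2 + log (sinh r) / N) * smoothTransition (2 - log (sinh r) / N)

theorem cutoff_of_pos (N : ℝ) {r : ℝ} (hr : 0 < r) : cutoff N r =
    smoothTransition (2 + log (sinh r) / N) * smoothTransition (2 - log (sinh r) / N) :=
  indicator_of_mem (mem_Ioi.2 hr) _

theorem cutoff_nonneg (N r : ℝ) : 0 ≤ cutoff N r :=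
  indicator_nonneg (fun _ _ => mul_nonneg (smoothTransition.nonneg _) (smoothTransition.nonneg _)) r

theorem cutoff_le_one (N r : ℝ) : cutoff N r ≤ 1 :=
  indicator_apply_le' (fun _ => mul_le_one₀ (smoothTransition.le_one _)
    (smoothTransition.nonneg _) (smoothTransition.le_one _)) (fun _ => zero_le_one)

theorem contDiffOn_log_sinh : ContDiffOn ℝ (⊤ : ℕ∞) (fun r => log (sinh r)) (Ioi 0) :=
  contDiff_sinh.contDiffOn.log fun _ hr => (sinh_pos_iff.2 hr).ne'

theorem isTestFunction_cutoff {N : ℝ} (hN : 0 < N) : IsTestFunction (cutoff N) := by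
  obtain ⟨a, ha⟩ := sinh_surjective (exp (-(2 * N)))
  obtain ⟨b, hb⟩ := sinh_surjective (exp (2 * N))
  have ha0 : 0 < a := by rw [← sinh_pos_iff, ha]; exact exp_pos _
  have hz : ∀ r, r ∉ Icc a b → cutoff N r = 0 := by
    intro r hr
    rcases le_or_gt r 0 with h0 | h0
    · exact indicator_of_notMem (by simpa using h0) _
    rw [cutoff_of_pos N h0]
    have hs := sinh_pos_iff.2 h0
    rw [mem_Icc, not_and_or, not_le, not_le] at hr
    rcases hr with hr | hr
    · rw [smoothTransition.zero_of_nonpos, zero_mul]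
      have : log (sinh r) ≤ -(2 * N) := by
        rw [log_le_iff_le_exp hs, ← ha]; exact sinh_le_sinh.2 hr.le
      have : log (sinh r) / N ≤ -2 := by rw [div_le_iff₀ hN]; linarith
      linarith
    · rw [mul_comm, smoothTransition.zero_of_nonpos, zero_mul]
      have : 2 * N ≤ log (sinh r) := by
        rw [le_log_iff_exp_le hs, ← hb]; exact sinh_le_sinh.2 hr.le
      have : 2 ≤ log (sinh r) / N := by rw [le_div_iff₀ hN]; linarith
      linarith
  refine .of_Icc (a := a) (b := b) ha0 ?_ hz
  rw [contDiff_iff_contDiffAt]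
  intro r
  rcases lt_or_ge 0 r with hr | hr
  · have h1 : ContDiffAt ℝ (⊤ : ℕ∞) (fun r => log (sinh r) / N) r :=
      (contDiffOn_log_sinh.contDiffAt (Ioi_mem_nhds hr)).div_const N
    have h2 : ContDiffAt ℝ (⊤ : ℕ∞) (fun r =>
        smoothTransition (2 + log (sinh r) / N) * smoothTransition (2 - log (sinh r) / N)) r :=
      (smoothTransition.contDiffAt.comp r (contDiffAt_const.add h1)).mul
        (smoothTransition.contDiffAt.comp r (contDiffAt_const.sub h1))
    refine h2.congr_of_eventuallyEq ?_
    filter_upwards [Ioi_mem_nhds hr] with x hx using cutoff_of_pos N hx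
  · refine (contDiffAt_const (c := (0 : ℝ))).congr_of_eventuallyEq ?_
    filter_upwards [Iio_mem_nhds (hr.trans_lt ha0)] with x hx
    exact hz x (fun hx' => not_lt.2 hx'.1 hx)

/-- The derivative of the cutoff decays like `1 / N`. -/
theorem exists_deriv_cutoff_bound : ∃ K : ℝ, 0 ≤ K ∧ ∀ N : ℝ, 0 < N → ∀ r : ℝ, 0 < r →
    |deriv (cutoff N) r| ≤ K / N * (cosh r / sinh r) := by
  obtain ⟨K, hK0, hK⟩ := exists_deriv_smoothTransition_bound
  refine ⟨2 * K, by positivity, fun N hN r hr => ?_⟩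
  have hs : 0 < sinh r := sinh_pos_iff.2 hr
  have h1 : HasDerivAt (fun r => log (sinh r) / N) (cosh r / sinh r / N) r :=
    ((hasDerivAt_sinh r).log hs.ne').div_const N
  have hST : ∀ x, HasDerivAt smoothTransition (deriv smoothTransition x) x := fun x =>
    ((smoothTransition.contDiff (n := 1)).differentiable (by simp)).differentiableAt.hasDerivAt
  have h2 := ((hST (2 + log (sinh r) / N)).comp r (h1.const_add 2)).mul
    ((hST (2 - log (sinh r) / N)).comp r (h1.const_sub 2))
  have he : cutoff N =ᶠ[𝓝 r] (smoothTransition ∘ fun r => 2 + log (sinh r) / N) *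
      (smoothTransition ∘ fun r => 2 - log (sinh r) / N) := by
    filter_upwards [Ioi_mem_nhds hr] with x hx using cutoff_of_pos N hx
  rw [he.deriv_eq, h2.deriv]
  have hc : 0 ≤ cosh r / sinh r / N := by have := cosh_pos r; positivity
  have b1 := hK (2 + log (sinh r) / N)
  have b2 := hK (2 - log (sinh r) / N)
  have c1 : |smoothTransition (2 + log (sinh r) / N)| ≤ 1 := by
    rw [abs_of_nonneg (smoothTransition.nonneg _)]; exact smoothTransition.le_one _
  have c2 : |smoothTransition (2 - log (sinh r) / N)| ≤ 1 := by
    rw [abs_of_nonneg (smoothTransition.nonneg _)]; exact smoothTransition.le_one _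
  refine (abs_add_le _ _).trans ?_
  simp only [abs_mul, abs_neg, abs_of_nonneg hc, Function.comp_apply]
  calc _ ≤ K * (cosh r / sinh r / N) * 1 + 1 * (K * (cosh r / sinh r / N)) := by gcongr
    _ = _ := by field_simp; ring

theorem tendsto_cutoff {r : ℝ} (hr : 0 < r) :
    Tendsto (fun n : ℕ => cutoff (n + 1) r) atTop (𝓝 1) := by
  refine tendsto_const_nhds.congr' ?_
  filter_upwards [eventually_ge_atTop ⌈|log (sinh r)|⌉₊] with n hn
  have h1 : |log (sinh r)| ≤ n := (Nat.le_ceil _).trans (by exact_mod_cast hn)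
  have h2 := abs_le.1 h1
  have hN : (0 : ℝ) < n + 1 := by positivity
  rw [cutoff_of_pos _ hr, smoothTransition.one_of_one_le, smoothTransition.one_of_one_le, mul_one]
  · have : log (sinh r) / (n + 1) ≤ 1 := by rw [div_le_one hN]; linarith
    linarith
  · have : -1 ≤ log (sinh r) / (n + 1) := by rw [le_div_iff₀ hN]; linarith
    linarith

/-! ### Locally absolutely continuous functions on the half line -/

namespace LocallyAC

variable {f g : ℝ → ℝ}

theorem of_contDiffOn (hf : ContDiffOn ℝ 1 f (Ioi 0)) : LocallyAC f := fun a b ha hab =>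
  (hf.mono fun r hr => by
    rw [uIcc_of_le hab] at hr; exact ha.trans_le hr.1).absolutelyContinuousOnInterval

theorem add (hf : LocallyAC f) (hg : LocallyAC g) : LocallyAC fun r => f r + g r :=
  fun a b ha hab => (hf a b ha hab).add (hg a b ha hab)

theorem sub (hf : LocallyAC f) (hg : LocallyAC g) : LocallyAC fun r => f r - g r :=
  fun a b ha hab => (hf a b ha hab).sub (hg a b ha hab)

theorem mul (hf : LocallyAC f) (hg : LocallyAC g) : LocallyAC fun r => f r * g r :=
  fun a b ha hab => (hf a b ha hab).mul (hg a b ha hab)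

theorem const_mul (hf : LocallyAC f) (c : ℝ) : LocallyAC fun r => c * f r :=
  fun a b ha hab => (hf a b ha hab).const_mul c

theorem continuousOn (hf : LocallyAC f) : ContinuousOn f (Ioi 0) := by
  intro r hr
  have hr : 0 < r := hr
  have h := (hf (r / 2) (r + 1) (by positivity) (by linarith)).continuousOn
  rw [uIcc_of_le (by linarith)] at h
  exact (h.continuousAt (Icc_mem_nhds (by linarith) (by linarith))).continuousWithinAt

theorem comp (hf : LocallyAC f) {F : ℝ → ℝ} (hF : ContDiff ℝ 1 F) : LocallyAC fun r => F (f r) := by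
  intro a b ha hab
  have hf' := hf a b ha hab
  obtain ⟨M, hM⟩ := hf'.exists_bound
  obtain ⟨K, hK⟩ := (hF.contDiffOn (s := Icc (-M) M)).exists_lipschitzOnWith (by simp)
    (convex_Icc _ _) isCompact_Icc
  have hmem : ∀ x ∈ uIcc a b, f x ∈ Icc (-M) M := fun x hx => abs_le.1 (hM x hx)
  rw [absolutelyContinuousOnInterval_iff] at hf' ⊢
  intro ε hε
  -- K + 1 allows for a vanishing Lipschitz constant.
  obtain ⟨δ, hδ, h⟩ := hf' (ε / (K + 1)) (by positivity)
  refine ⟨δ, hδ, fun E hE hE' => ?_⟩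
  calc _ ≤ ∑ i ∈ Finset.range E.1, K * dist (f (E.2 i).1) (f (E.2 i).2) := by
        refine Finset.sum_le_sum fun i hi => ?_
        exact hK.dist_le_mul _ (hmem _ (hE.1 i hi).1) _ (hmem _ (hE.1 i hi).2)
    _ = K * ∑ i ∈ Finset.range E.1, dist (f (E.2 i).1) (f (E.2 i).2) := (Finset.mul_sum _ _ _).symm
    _ ≤ K * (ε / (K + 1)) := by gcongr; exact (h E hE hE').le
    _ < (K + 1) * (ε / (K + 1)) := by gcongr; linarith
    _ = ε := by field

theorem ae_hasDerivAt (hf : LocallyAC f) :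
    ∀ᵐ r ∂volume.restrict (Ioi 0), HasDerivAt f (deriv f r) r := by
  rw [ae_restrict_iff' measurableSet_Ioi]
  have h : ∀ n : ℕ, ∀ᵐ r, r ∈ uIcc (1 / ((n : ℝ) + 1)) (n + 1) → DifferentiableAt ℝ f r :=
    fun n => (hf _ _ (by positivity) (by
      rw [div_le_iff₀ (by positivity)]; nlinarith [(Nat.cast_nonneg n : (0 : ℝ) ≤ n)]))
        |>.ae_differentiableAt
  filter_upwards [ae_all_iff.2 h] with r hr hr0
  have hr0 : 0 < r := hr0
  obtain ⟨n, hn⟩ := exists_nat_gt (max r (1 / r))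
  have h1 : r < n := (le_max_left _ _).trans_lt hn
  have h2 : 1 / r < n := (le_max_right _ _).trans_lt hn
  refine (hr n (mem_uIcc.2 (Or.inl ⟨?_, by linarith⟩))).hasDerivAt
  rw [div_le_iff₀ (by positivity)]
  rw [div_lt_iff₀ hr0] at h2
  nlinarith

/-- Absolute continuity recovers f b − f a from the almost everywhere derivative. The nonnegative
slack k is integrated over the whole half line, so the bound does not depend on the interval. -/
theorem integral_le_sub_add (hf : LocallyAC f) {f' k : ℝ → ℝ} (hk : IntegrableOn k (Ioi 0))
    (hk0 : ∀ r, 0 < r → 0 ≤ k r) (hg : ContinuousOn g (Ioi 0))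
    (hf' : ∀ᵐ r ∂volume.restrict (Ioi 0), HasDerivAt f (f' r) r)
    (h : ∀ r, 0 < r → g r ≤ f' r + k r) {a b : ℝ} (ha : 0 < a) (hab : a ≤ b) :
    ∫ r in a..b, g r ≤ f b - f a + ∫ r in Ioi 0, k r := by
  have hsub : Ioc a b ⊆ Ioi 0 := fun r hr => ha.trans hr.1
  have hki : IntervalIntegrable k volume a b :=
    (intervalIntegrable_iff_integrableOn_Ioc_of_le hab).2 (hk.mono_set hsub)
  have hgi : IntervalIntegrable g volume a b :=
    (hg.mono fun r hr => by
      rw [uIcc_of_le hab] at hr; exact ha.trans_le hr.1).intervalIntegrable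
  have hd := (hf a b ha hab).intervalIntegrable_deriv
  calc ∫ r in a..b, g r ≤ ∫ r in a..b, (deriv f r + k r) := by
        refine intervalIntegral.integral_mono_ae_restrict hab hgi (hd.add hki) ?_
        have h1 := ae_restrict_of_ae_restrict_of_subset
          (show Ioo a b ⊆ Ioi 0 from fun r hr => ha.trans hr.1) hf'
        rw [restrict_Ioo_eq_restrict_Icc] at h1
        filter_upwards [h1, ae_restrict_mem measurableSet_Icc] with r hr hr'
        rw [hr.deriv]
        exact h r (ha.trans_le hr'.1)
    _ = f b - f a + ∫ r in a..b, k r := by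
        rw [intervalIntegral.integral_add hd hki, (hf a b ha hab).integral_deriv_eq_sub]
    _ ≤ _ := by
        rw [intervalIntegral.integral_of_le hab]
        gcongr
        · filter_upwards [ae_restrict_mem measurableSet_Ioi] with r hr using hk0 r hr

theorem sub_le_integral (hf : LocallyAC f) {f' k : ℝ → ℝ} (hk : IntegrableOn k (Ioi 0))
    (hk0 : ∀ r, 0 < r → 0 ≤ k r)
    (hf' : ∀ᵐ r ∂volume.restrict (Ioi 0), HasDerivAt f (f' r) r)
    (h : ∀ r, 0 < r → f' r ≤ k r) {a b : ℝ} (ha : 0 < a) (hab : a ≤ b) :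
    f b - f a ≤ ∫ r in Ioi 0, k r := by
  have h1 := (hf.const_mul (-1)).integral_le_sub_add (g := fun _ => 0) (f' := fun r => -1 * f' r)
    hk hk0 continuousOn_const
    (hf'.mono fun r hr => hr.const_mul (-1)) (fun r hr => by linarith [h r hr]) ha hab
  simp only [intervalIntegral.integral_zero] at h1
  linarith

theorem integrable_mul_deriv (hf : LocallyAC f) {χ : ℝ → ℝ} (hχ : IsTestFunction χ) :
    Integrable fun r => χ r * deriv f r := by
  obtain ⟨a, b, ha, hab, h0⟩ := hχ.exists_Icc
  have h1 := (hf a b ha hab).intervalIntegrable_deriv.continuousOn_mul hχ.continuous.continuousOn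
  rw [intervalIntegrable_iff_integrableOn_Icc_of_le hab, ← integrable_indicator_iff measurableSet_Icc]
    at h1
  refine h1.congr (Eventually.of_forall fun r => ?_)
  by_cases hr : r ∈ Icc a b <;> simp [hr, h0 r]

/-- Integration by parts against test functions. -/
theorem integral_mul_deriv (hf : LocallyAC f) {χ : ℝ → ℝ} (hχ : IsTestFunction χ) :
    ∫ r, χ r * deriv f r = -∫ r, deriv χ r * f r := by
  obtain ⟨a, b, ha, hab, h0⟩ := hχ.exists_Icc
  -- The endpoints of the larger interval lie outside the support, so the boundary terms vanish.
  have ha2 : 0 < a / 2 := by positivity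
  have hab2 : a / 2 ≤ b + 1 := by linarith
  have hsupp : ∀ k : ℝ → ℝ, (∀ r, r ∉ Icc a b → k r = 0) →
      ∫ r, k r = ∫ r in (a / 2)..(b + 1), k r := by
    intro k hk
    rw [intervalIntegral.integral_of_le hab2, setIntegral_eq_integral_of_forall_compl_eq_zero]
    intro r hr
    exact hk r fun hr' => hr ⟨by linarith [hr'.1], by linarith [hr'.2]⟩
  have hd0 : ∀ r, r ∉ Icc a b → deriv χ r = 0 := by
    intro r hr
    have hsub : tsupport χ ⊆ Icc a b :=
      closure_minimal (fun r hr => by by_contra h'; exact hr (h0 r h')) isClosed_Icc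
    by_contra h'
    exact hr (hsub (support_deriv_subset h'))
  rw [hsupp _ fun r hr => by rw [h0 r hr, zero_mul],
    hsupp _ fun r hr => by rw [hd0 r hr, zero_mul],
    AbsolutelyContinuousOnInterval.integral_mul_deriv_eq_deriv_mul _ (hf _ _ ha2 hab2),
    h0 (a / 2) (fun h => by linarith [h.1]), h0 (b + 1) (fun h => by linarith [h.2])]
  · ring
  · exact ((hχ.smooth.of_le (by exact_mod_cast le_top)).contDiffOn).absolutelyContinuousOnInterval

end LocallyAC

/-- Exhaustion by the intervals (1 / (n + 1), n + 1]; integrability is a conclusion, since the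
integral of a nonintegrable function would be 0 by convention. -/
theorem integrableOn_of_intervalIntegral_le {g : ℝ → ℝ} (hg : ContinuousOn g (Ioi 0))
    (hg0 : ∀ r, 0 < r → 0 ≤ g r) {I : ℝ}
    (h : ∀ a b, 0 < a → a ≤ b → ∫ r in a..b, g r ≤ I) :
    IntegrableOn g (Ioi 0) ∧ ∫ r in Ioi 0, g r ≤ I := by
  have hab : ∀ n : ℕ, 1 / ((n : ℝ) + 1) ≤ n + 1 := fun n => by
    rw [div_le_iff₀ (by positivity)]; nlinarith [(Nat.cast_nonneg n : (0 : ℝ) ≤ n)]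
  have hc : AECover (volume.restrict (Ioi 0)) atTop
      fun n : ℕ => Ioc (1 / ((n : ℝ) + 1)) (n + 1) := by
    refine ⟨?_, fun n => measurableSet_Ioc⟩
    filter_upwards [ae_restrict_mem measurableSet_Ioi] with r hr
    have e1 : ∀ᶠ n : ℕ in atTop, 1 / ((n : ℝ) + 1) < r :=
      tendsto_one_div_add_atTop_nhds_zero_nat.eventually_lt_const hr
    have e2 : ∀ᶠ n : ℕ in atTop, r < n := tendsto_natCast_atTop_atTop.eventually_gt_atTop r
    filter_upwards [e1, e2] with n h1 h2 using ⟨h1, by linarith⟩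
  have hr : ∀ n : ℕ, (volume.restrict (Ioi (0 : ℝ))).restrict (Ioc (1 / ((n : ℝ) + 1)) (n + 1))
      = volume.restrict (Ioc (1 / ((n : ℝ) + 1)) (n + 1)) := fun n =>
    Measure.restrict_restrict_of_subset fun x hx =>
      lt_trans (by positivity : (0 : ℝ) < 1 / ((n : ℝ) + 1)) hx.1
  have hle : ∀ n : ℕ, ∫ r in Ioc (1 / ((n : ℝ) + 1)) (n + 1), g r ∂volume.restrict (Ioi 0) ≤ I := by
    intro n
    rw [hr, ← intervalIntegral.integral_of_le (hab n)]
    exact h _ _ (by positivity) (hab n)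
  have hint : IntegrableOn g (Ioi 0) := by
    refine hc.integrable_of_integral_bounded_of_nonneg_ae I (fun n => ?_) ?_
      (Eventually.of_forall hle)
    · rw [IntegrableOn, hr]
      refine ((hg.mono fun x hx => ?_).integrableOn_Icc).mono_set Ioc_subset_Icc_self
      exact lt_of_lt_of_le (by positivity : (0 : ℝ) < 1 / ((n : ℝ) + 1)) hx.1
    · filter_upwards [ae_restrict_mem measurableSet_Ioi] with r hr using hg0 r hr
  exact ⟨hint, le_of_tendsto (hc.integral_tendsto_of_countably_generated hint)
    (Eventually.of_forall hle)⟩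

/-- 1 / sinh r is not integrable at 0, so v cannot stay above ε there. This takes the place of a
boundary condition at the origin. -/
theorem exists_lt_of_integrableOn_div_sinh {v : ℝ → ℝ}
    (hv : IntegrableOn (fun r => v r / sinh r) (Ioi 0)) {ε b : ℝ} (hε : 0 < ε) (hb : 0 < b) :
    ∃ a, 0 < a ∧ a < b ∧ v a < ε := by
  by_contra! hcon
  have h1 : IntervalIntegrable (fun x : ℝ => x⁻¹) volume 0 b := by
    rw [intervalIntegrable_iff_integrableOn_Ioo_of_le hb.le]
    refine Integrable.mono' ((hv.mono_set (show Ioo 0 b ⊆ Ioi 0 from fun x hx => hx.1)).const_mul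
      (cosh b / ε)) (by measurability) ?_
    filter_upwards [ae_restrict_mem measurableSet_Ioo] with x hx
    have hs : 0 < sinh x := sinh_pos_iff.2 hx.1
    have h2 : ε ≤ v x := hcon x hx.1 hx.2
    have h3 : sinh x ≤ x * cosh b := (sinh_le_mul_cosh hx.1.le).trans
      (mul_le_mul_of_nonneg_left (cosh_le_cosh.2
        (by rw [abs_of_pos hx.1, abs_of_pos hb]; exact hx.2.le)) hx.1.le)
    rw [norm_of_nonneg (inv_nonneg.2 hx.1.le), inv_eq_one_div, div_mul_div_comm,
      div_le_div_iff₀ hx.1 (by positivity)]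
    have := cosh_pos b
    calc 1 * (ε * sinh x) ≤ ε * (x * cosh b) := by rw [one_mul]; gcongr
      _ ≤ v x * (x * cosh b) := by gcongr; have := hx.1; positivity
      _ = cosh b * v x * x := by ring
  rw [intervalIntegrable_inv_iff] at h1
  rcases h1 with h1 | h1
  · exact hb.ne h1
  · exact h1 left_mem_uIcc

/-! ### The radial energy space -/

/-- The radial energy space. -/
structure MemH (u : ℝ → ℝ) : Prop where
  ac : LocallyAC u
  grad : IntegrableOn (fun r => deriv u r ^ 2 * sinh r) (Ioi 0)
  pot : IntegrableOn (fun r => u r ^ 2 / sinh r) (Ioi 0)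

namespace MemH

variable {u : ℝ → ℝ}

theorem sub {v : ℝ → ℝ} (hu : MemH u) (hv : MemH v) : MemH fun r => u r - v r := by
  refine ⟨hu.ac.sub hv.ac, ?_, ?_⟩
  · refine Integrable.mono' ((hu.grad.add hv.grad).const_mul 2)
      (((measurable_deriv _).pow_const 2).mul continuous_sinh.measurable).aestronglyMeasurable ?_
    filter_upwards [ae_restrict_mem measurableSet_Ioi, hu.ac.ae_hasDerivAt, hv.ac.ae_hasDerivAt]
      with r hr h1 h2
    have hs : 0 < sinh r := sinh_pos_iff.2 hr
    rw [norm_of_nonneg (by positivity), (h1.fun_sub h2).deriv]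
    simp only [Pi.add_apply]
    nlinarith [mul_nonneg (sq_nonneg (deriv u r + deriv v r)) hs.le]
  · refine Integrable.mono' ((hu.pot.add hv.pot).const_mul 2) ?_ ?_
    · refine ContinuousOn.aestronglyMeasurable ?_ measurableSet_Ioi
      exact ((hu.ac.continuousOn.sub hv.ac.continuousOn).pow 2).div
        continuous_sinh.continuousOn fun r hr => (sinh_pos_iff.2 hr).ne'
    filter_upwards [ae_restrict_mem measurableSet_Ioi] with r hr
    have hs : 0 < sinh r := sinh_pos_iff.2 hr
    rw [norm_of_nonneg (by positivity)]
    simp only [Pi.add_apply]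
    rw [← add_div, ← mul_div_assoc]
    gcongr
    nlinarith [sq_nonneg (u r + v r)]

/-- The value of a primitive is controlled by the energy density. -/
theorem comp_le (hu : MemH u) {F F' : ℝ → ℝ} (hF : ContDiff ℝ 1 F) (hF' : ∀ x, HasDerivAt F (F' x) x)
    {v : ℝ → ℝ} (hv : IntegrableOn (fun r => v r ^ 2 / sinh r) (Ioi 0))
    (huv : ∀ r, 0 < r → F' (u r) = v r) (hF0 : F 0 = 0) {b : ℝ} (hb : 0 < b) :
    F (u b) ≤ 1 / 2 * ((∫ r in Ioi 0, deriv u r ^ 2 * sinh r) + ∫ r in Ioi 0, v r ^ 2 / sinh r) := by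
  have h1 : ∀ a, 0 < a → a < b → F (u b) - F (u a) ≤
      1 / 2 * ((∫ r in Ioi 0, deriv u r ^ 2 * sinh r) + ∫ r in Ioi 0, v r ^ 2 / sinh r) := by
    intro a ha hab
    rw [← integral_add hu.grad hv, ← integral_const_mul]
    refine (hu.ac.comp hF).sub_le_integral (f' := fun r => F' (u r) * deriv u r)
      ((hu.grad.add hv).const_mul (1 / 2)) (fun r hr => ?_) ?_ (fun r hr => ?_) ha hab.le
    · have hs : 0 < sinh r := sinh_pos_iff.2 hr
      simp only [Pi.add_apply]
      positivity
    · filter_upwards [hu.ac.ae_hasDerivAt] with r hr using (hF' (u r)).comp r hr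
    · have hs : 0 < sinh r := sinh_pos_iff.2 hr
      simp only [Pi.add_apply]
      rw [huv r hr, ← sub_nonneg]
      -- Bogomolny's square: the derivative of F(u) is bounded by the energy density.
      have : 1 / 2 * (deriv u r ^ 2 * sinh r + v r ^ 2 / sinh r) - v r * deriv u r
          = 1 / 2 * ((deriv u r * sinh r - v r) ^ 2 / sinh r) := by field_simp; ring
      rw [this]; positivity
  refine le_of_forall_pos_le_add fun ε hε => ?_
  have hc : ∀ᶠ x in 𝓝 0, F x < ε := by
    have := hF.continuous.continuousAt (x := 0)
    rw [ContinuousAt, hF0] at this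
    exact this.eventually_lt_const hε
  obtain ⟨δ, hδ, hδ'⟩ := Metric.eventually_nhds_iff.1 hc
  -- Arbitrarily near the origin there are points where u is small; starting from one of them costs
  -- at most ε.
  obtain ⟨a, ha, hab, hu'⟩ := exists_lt_of_integrableOn_div_sinh hu.pot (pow_pos hδ 2) hb
  have h3 : F (u a) < ε := hδ' (by
    rw [dist_zero_right, Real.norm_eq_abs]; exact abs_lt_of_sq_lt_sq hu' hδ.le)
  linarith [h1 a ha hab]

theorem sq_le (hu : MemH u) {b : ℝ} (hb : 0 < b) :
    u b ^ 2 ≤ (∫ r in Ioi 0, deriv u r ^ 2 * sinh r) + ∫ r in Ioi 0, u r ^ 2 / sinh r := by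
  have := hu.comp_le (F := fun x => x ^ 2 / 2) (F' := fun x => x) (by fun_prop)
    (fun x => by simpa using (hasDerivAt_pow 2 x).div_const 2) hu.pot (fun r _ => rfl) (by simp) hb
  linarith

/-- Cauchy–Schwarz for u(R) = −∫ u_r over [R, ∞), since 1 / sinh r ≤ cosh r / sinh² r integrates to
1 / sinh R. It is carried out as Young's inequality with parameter c, optimised at the end. -/
theorem sq_le_div_sinh (hu : MemH u) (h0 : Tendsto u atTop (𝓝 0)) {R : ℝ} (hR : 0 < R) :
    u R ^ 2 ≤ (∫ r in Ioi 0, deriv u r ^ 2 * sinh r) / sinh R := by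
  set D := ∫ r in Ioi 0, deriv u r ^ 2 * sinh r with hD
  have hS : 0 < sinh R := sinh_pos_iff.2 hR
  have hD0 : 0 ≤ D := setIntegral_nonneg measurableSet_Ioi fun r hr =>
    mul_nonneg (sq_nonneg _) (sinh_pos_iff.2 hr).le
  have key : ∀ ε c : ℝ, ε ^ 2 = 1 → 0 < c → -(ε * u R) ≤ c * D + 1 / (4 * c) / sinh R := by
    intro ε c hε hc
    have hl : LocallyAC fun r => ε * u r + 1 / (4 * c) * (sinh r)⁻¹ := by
      refine (hu.ac.const_mul ε).add ((LocallyAC.of_contDiffOn ?_).const_mul _)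
      exact contDiff_sinh.contDiffOn.inv fun r hr => (sinh_pos_iff.2 hr).ne'
    have h1 : ∀ b, R ≤ b → (ε * u b + 1 / (4 * c) * (sinh b)⁻¹)
        - (ε * u R + 1 / (4 * c) * (sinh R)⁻¹) ≤ c * D := by
      intro b hb
      rw [hD, ← integral_const_mul]
      refine hl.sub_le_integral
        (f' := fun r => ε * deriv u r + 1 / (4 * c) * (-cosh r / sinh r ^ 2))
        (hu.grad.const_mul c) (fun r hr => ?_) ?_ (fun r hr => ?_) hR hb
      · have hs : 0 < sinh r := sinh_pos_iff.2 hr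
        positivity
      · filter_upwards [hu.ac.ae_hasDerivAt, ae_restrict_mem measurableSet_Ioi] with r hr hr0
        exact (hr.const_mul ε).add
          (((hasDerivAt_sinh r).inv (sinh_pos_iff.2 hr0).ne').const_mul _)
      · have hs : 0 < sinh r := sinh_pos_iff.2 hr
        have hcs : sinh r ≤ cosh r := (sinh_lt_cosh r).le
        have e1 : 1 / sinh r ≤ cosh r / sinh r ^ 2 := by
          rw [div_le_div_iff₀ hs (by positivity)]; nlinarith
        have e2 : 0 ≤ c * (deriv u r ^ 2 * sinh r) - ε * deriv u r + 1 / (4 * c) * (1 / sinh r) := by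
          have : c * (deriv u r ^ 2 * sinh r) - ε * deriv u r + 1 / (4 * c) * (1 / sinh r)
              = (2 * c * deriv u r * sinh r - ε) ^ 2 / (4 * c * sinh r) + (1 - ε ^ 2) /
                (4 * c * sinh r) := by
            field_simp; ring
          rw [this, hε]; simp only [sub_self, zero_div, add_zero]; positivity
        have e3 : 1 / (4 * c) * (1 / sinh r) ≤ 1 / (4 * c) * (cosh r / sinh r ^ 2) := by gcongr
        have e4 : 1 / (4 * c) * (-cosh r / sinh r ^ 2) = -(1 / (4 * c) * (cosh r / sinh r ^ 2)) := by
          ring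
        linarith
    have hs : Tendsto (fun b => (sinh b)⁻¹) atTop (𝓝 0) :=
      tendsto_inv_atTop_zero.comp (tendsto_atTop_mono' _
        ((eventually_ge_atTop 0).mono fun r hr => self_le_sinh_iff.2 hr) tendsto_id)
    have h2 : Tendsto (fun b => (ε * u b + 1 / (4 * c) * (sinh b)⁻¹)
        - (ε * u R + 1 / (4 * c) * (sinh R)⁻¹)) atTop
        (𝓝 ((ε * 0 + 1 / (4 * c) * 0) - (ε * u R + 1 / (4 * c) * (sinh R)⁻¹))) :=
      ((h0.const_mul ε).add (hs.const_mul _)).sub_const _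
    have h3 := le_of_tendsto h2 ((eventually_ge_atTop R).mono h1)
    rw [div_eq_mul_inv _ (sinh R)]
    linarith
  rcases eq_or_ne (u R) 0 with h | h
  · rw [h, zero_pow two_ne_zero]; positivity
  · have hy : 0 < |u R| := abs_pos.2 h
    -- This parameter gives y ≤ D / (2 sinh R y) + y / 2 with y = |u R|, which is the claim after
    -- absorbing y / 2.
    have hk : |u R| ≤ 1 / (2 * sinh R * |u R|) * D + 1 / (4 * (1 / (2 * sinh R * |u R|))) / sinh R := by
      rcases abs_cases (u R) with ⟨h1, -⟩ | ⟨h1, -⟩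
      · have := key (-1) (1 / (2 * sinh R * |u R|)) (by norm_num) (by positivity)
        rw [show -(-1 * u R) = |u R| by rw [h1]; ring] at this
        exact this
      · have := key 1 (1 / (2 * sinh R * |u R|)) (by norm_num) (by positivity)
        rw [show -(1 * u R) = |u R| by rw [h1]; ring] at this
        exact this
    rw [← sq_abs, le_div_iff₀ hS]
    generalize |u R| = y at *
    have e : 1 / (2 * sinh R * y) * D + 1 / (4 * (1 / (2 * sinh R * y))) / sinh R
        = D / (2 * sinh R * y) + y / 2 := by field_simp; ring
    rw [e] at hk
    have : y / 2 ≤ D / (2 * sinh R * y) := by linarith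
    rw [le_div_iff₀ (by positivity)] at this
    nlinarith

/-- Hardy's inequality on the hyperbolic plane. -/
theorem hardy (hu : MemH u) (h0 : Tendsto u atTop (𝓝 0)) :
    IntegrableOn (fun r => u r ^ 2 * sinh r) (Ioi 0) ∧
      ∫ r in Ioi 0, u r ^ 2 * sinh r ≤ 6 * ∫ r in Ioi 0, deriv u r ^ 2 * sinh r := by
  set D := ∫ r in Ioi 0, deriv u r ^ 2 * sinh r with hD
  have hD0 : 0 ≤ D := setIntegral_nonneg measurableSet_Ioi fun r hr =>
    mul_nonneg (sq_nonneg _) (sinh_pos_iff.2 hr).le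
  have hcont : ContinuousOn (fun r => u r ^ 2 * sinh r) (Ioi 0) :=
    (hu.ac.continuousOn.pow 2).mul continuous_sinh.continuousOn
  refine integrableOn_of_intervalIntegral_le hcont
    (fun r hr => mul_nonneg (sq_nonneg _) (sinh_pos_iff.2 hr).le) fun a b ha hab => ?_
  have hb := ha.trans_le hab
  -- cosh r − 1 is a primitive of sinh r that is at most sinh r, and the inner boundary term has a
  -- good sign. The outer one contributes 2 D by `sq_le_div_sinh` and the square 4 D, whence 6.
  have hl : LocallyAC fun r => (cosh r - 1) * u r ^ 2 :=
    (LocallyAC.of_contDiffOn (contDiff_cosh.sub contDiff_const).contDiffOn).mul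
      (hu.ac.comp (F := fun x => x ^ 2) (by fun_prop))
  have h1 := (hl.const_mul 2).integral_le_sub_add (g := fun r => u r ^ 2 * sinh r)
    (f' := fun r => 2 * (sinh r * u r ^ 2 + (cosh r - 1) * (2 * u r * deriv u r)))
    (k := fun r => 4 * (deriv u r ^ 2 * sinh r))
    (hu.grad.const_mul 4) (fun r hr => ?_) hcont ?_ (fun r hr => ?_) ha hab
  · rw [integral_const_mul, ← hD] at h1
    have h2 := hu.sq_le_div_sinh h0 hb
    rw [← hD] at h2
    have hs : 0 < sinh b := sinh_pos_iff.2 hb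
    rw [le_div_iff₀ hs] at h2
    have h3 : cosh b - 1 ≤ sinh b := by
      have := cosh_sub_sinh b
      have : exp (-b) ≤ 1 := exp_le_one_iff.2 (by linarith)
      linarith
    have h4 : (cosh b - 1) * u b ^ 2 ≤ D := by nlinarith [sq_nonneg (u b)]
    have h5 : 0 ≤ (cosh a - 1) * u a ^ 2 :=
      mul_nonneg (by linarith [one_le_cosh a]) (sq_nonneg _)
    linarith
  · have hs : 0 < sinh r := sinh_pos_iff.2 hr
    positivity
  · filter_upwards [hu.ac.ae_hasDerivAt] with r hr
    have := (((hasDerivAt_cosh r).sub_const 1).mul (hr.pow 2)).const_mul 2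
    refine this.congr_deriv ?_
    simp
  · have hs : 0 < sinh r := sinh_pos_iff.2 hr
    have h3 : cosh r - 1 ≤ sinh r := by
      have := cosh_sub_sinh r
      have : exp (-r) ≤ 1 := exp_le_one_iff.2 (by linarith)
      linarith
    have h4 : 0 ≤ cosh r - 1 := by linarith [one_le_cosh r]
    have h5 : (cosh r - 1) ^ 2 ≤ sinh r ^ 2 := by gcongr
    have : 0 ≤ sinh r * (u r ^ 2 * sinh r + 4 * (cosh r - 1) * (u r * deriv u r)
        + 4 * deriv u r ^ 2 * sinh r) := by
      nlinarith [sq_nonneg (u r * sinh r + 2 * (cosh r - 1) * deriv u r), sq_nonneg (deriv u r)]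
    nlinarith [nonneg_of_mul_nonneg_right this hs]

end MemH

/-! ### Finite energy data -/

namespace MemEnergyClass

variable {lam : ℝ} {ψ₀ ψ₁ : ℝ → ℝ}

theorem integrableOn_density (h : MemEnergyClass lam ψ₀ ψ₁) :
    IntegrableOn (fun r => 1 / 2 * (ψ₁ r ^ 2 + deriv ψ₀ r ^ 2 + sinh (ψ₀ r) ^ 2 / sinh r ^ 2)
      * sinh r) (Ioi 0) := by
  have h0 : 0 ≤ᵐ[volume.restrict (Ioi 0)] fun r => 1 / 2 * (ψ₁ r ^ 2 + deriv ψ₀ r ^ 2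
      + sinh (ψ₀ r) ^ 2 / sinh r ^ 2) * sinh r := by
    filter_upwards [ae_restrict_mem measurableSet_Ioi] with r hr
    have hs : 0 < sinh r := sinh_pos_iff.2 hr
    have : 0 ≤ 1 / 2 * (ψ₁ r ^ 2 + deriv ψ₀ r ^ 2 + sinh (ψ₀ r) ^ 2 / sinh r ^ 2) * sinh r := by
      positivity
    exact this
  have hm : AEMeasurable (fun r => 1 / 2 * (ψ₁ r ^ 2 + deriv ψ₀ r ^ 2
      + sinh (ψ₀ r) ^ 2 / sinh r ^ 2) * sinh r) (volume.restrict (Ioi 0)) := by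
    have h1 : AEMeasurable ψ₀ (volume.restrict (Ioi 0)) :=
      h.locallyAC.continuousOn.aemeasurable measurableSet_Ioi
    have h2 : AEMeasurable (fun r => sinh (ψ₀ r)) (volume.restrict (Ioi 0)) :=
      continuous_sinh.measurable.comp_aemeasurable h1
    have h3 : Measurable sinh := continuous_sinh.measurable
    exact ((((h.aemeasurable.pow_const 2).add ((measurable_deriv ψ₀).pow_const 2).aemeasurable).add
      ((h2.pow_const 2).div (h3.pow_const 2).aemeasurable)).const_mul _).mul h3.aemeasurable
  refine ⟨hm.aestronglyMeasurable, ?_⟩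
  rw [hasFiniteIntegral_iff_ofReal h0]
  exact h.energy_lt_top

theorem integrableOn_velocity (h : MemEnergyClass lam ψ₀ ψ₁) :
    IntegrableOn (fun r => ψ₁ r ^ 2 * sinh r) (Ioi 0) := by
  refine Integrable.mono' (h.integrableOn_density.const_mul 2)
    ((h.aemeasurable.pow_const 2).mul continuous_sinh.measurable.aemeasurable).aestronglyMeasurable
    ?_
  filter_upwards [ae_restrict_mem measurableSet_Ioi] with r hr
  have hs : 0 < sinh r := sinh_pos_iff.2 hr
  rw [norm_of_nonneg (by positivity), ← mul_assoc, ← mul_assoc]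
  gcongr
  have : 0 ≤ sinh (ψ₀ r) ^ 2 / sinh r ^ 2 := by positivity
  nlinarith [sq_nonneg (deriv ψ₀ r)]

theorem integrableOn_grad (h : MemEnergyClass lam ψ₀ ψ₁) :
    IntegrableOn (fun r => deriv ψ₀ r ^ 2 * sinh r) (Ioi 0) := by
  refine Integrable.mono' (h.integrableOn_density.const_mul 2)
    (((measurable_deriv ψ₀).pow_const 2).mul continuous_sinh.measurable).aestronglyMeasurable ?_
  filter_upwards [ae_restrict_mem measurableSet_Ioi] with r hr
  have hs : 0 < sinh r := sinh_pos_iff.2 hr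
  rw [norm_of_nonneg (by positivity), ← mul_assoc, ← mul_assoc]
  gcongr
  have : 0 ≤ sinh (ψ₀ r) ^ 2 / sinh r ^ 2 := by positivity
  nlinarith [sq_nonneg (ψ₁ r)]

theorem integrableOn_sinh (h : MemEnergyClass lam ψ₀ ψ₁) :
    IntegrableOn (fun r => sinh (ψ₀ r) ^ 2 / sinh r) (Ioi 0) := by
  refine ((h.integrableOn_density.const_mul 2).sub
    (h.integrableOn_velocity.add h.integrableOn_grad)).congr ?_
  filter_upwards [ae_restrict_mem measurableSet_Ioi] with r hr
  have hs : 0 < sinh r := sinh_pos_iff.2 hr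
  simp only [Pi.sub_apply, Pi.add_apply]
  field_simp; ring

theorem energy_eq (h : MemEnergyClass lam ψ₀ ψ₁) : energy ψ₀ ψ₁ = ENNReal.ofReal (1 / 2 *
    ((∫ r in Ioi 0, ψ₁ r ^ 2 * sinh r) + (∫ r in Ioi 0, deriv ψ₀ r ^ 2 * sinh r)
      + ∫ r in Ioi 0, sinh (ψ₀ r) ^ 2 / sinh r)) := by
  have i1 := h.integrableOn_velocity.add h.integrableOn_grad
  rw [energy, ← integral_add h.integrableOn_velocity h.integrableOn_grad,
    ← integral_add (by exact i1) h.integrableOn_sinh, ← integral_const_mul,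
    ← ofReal_integral_eq_lintegral_ofReal h.integrableOn_density]
  · congr 1
    refine setIntegral_congr_fun measurableSet_Ioi fun r hr => ?_
    have hs : 0 < sinh r := sinh_pos_iff.2 hr
    field_simp
  · filter_upwards [ae_restrict_mem measurableSet_Ioi] with r hr
    have hs : 0 < sinh r := sinh_pos_iff.2 hr
    have : 0 ≤ 1 / 2 * (ψ₁ r ^ 2 + deriv ψ₀ r ^ 2 + sinh (ψ₀ r) ^ 2 / sinh r ^ 2) * sinh r := by
      positivity
    exact this

theorem _root_.HypWaveMap.sq_le_sinh_sq (x : ℝ) : x ^ 2 ≤ sinh x ^ 2 := by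
  rw [← sq_abs x, ← sq_abs (sinh x), abs_sinh]
  have := self_le_sinh_iff.2 (abs_nonneg x)
  gcongr

theorem memH (h : MemEnergyClass lam ψ₀ ψ₁) : MemH ψ₀ := by
  refine ⟨h.locallyAC, h.integrableOn_grad, Integrable.mono' h.integrableOn_sinh ?_ ?_⟩
  · refine ContinuousOn.aestronglyMeasurable ?_ measurableSet_Ioi
    exact (h.locallyAC.continuousOn.pow 2).div
      continuous_sinh.continuousOn fun r hr => (sinh_pos_iff.2 hr).ne'
  · filter_upwards [ae_restrict_mem measurableSet_Ioi] with r hr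
    have hs : 0 < sinh r := sinh_pos_iff.2 hr
    rw [norm_of_nonneg (by positivity)]
    gcongr ?_ / _
    exact sq_le_sinh_sq _

end MemEnergyClass

/-! ### Continuous curves of square integrable functions on the half line -/

/-- `f ∈ C([0, ∞); L²(0, ∞))`. -/
structure ContL2 (f : ℝ → ℝ → ℝ) : Prop where
  memLp : ∀ t : ℝ, 0 ≤ t → MemLp (f t) 2 (volume.restrict (Ioi 0))
  tendsto : ∀ t : ℝ, 0 ≤ t →
    Tendsto (fun s => eLpNorm (f s - f t) 2 (volume.restrict (Ioi 0))) (𝓝[Ici 0] t) (𝓝 0)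

/-- Square integrable functions on the half line. -/
noncomputable abbrev L2H := Lp ℝ 2 (volume.restrict (Ioi (0 : ℝ)))

/-- The curve in `L²(0, ∞)` given by a function of time and radius. -/
noncomputable def curve (f : ℝ → ℝ → ℝ) (t : ℝ) : L2H :=
  open Classical in
  if h : MemLp (f t) 2 (volume.restrict (Ioi 0)) then h.toLp else 0

namespace ContL2

variable {f g : ℝ → ℝ → ℝ}

theorem contL2Loc (hf : ContL2 f) : ContL2Loc f := by
  have hle : ∀ a b : ℝ, 0 < a → volume.restrict (Icc a b) ≤ volume.restrict (Ioi 0) :=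
    fun a b ha => Measure.restrict_mono (fun x hx => ha.trans_le hx.1) le_rfl
  exact ⟨fun a b ha t ht => (hf.memLp t ht).mono_measure (hle a b ha), fun a b ha t ht =>
    tendsto_of_tendsto_of_tendsto_of_le_of_le tendsto_const_nhds (hf.tendsto t ht)
      (fun _ => zero_le) fun s => eLpNorm_mono_measure _ (hle a b ha)⟩

theorem curve_eq (hf : ContL2 f) {t : ℝ} (ht : 0 ≤ t) : curve f t = (hf.memLp t ht).toLp := by
  simp [curve, hf.memLp t ht]

theorem continuousOn_curve (hf : ContL2 f) : ContinuousOn (curve f) (Ici 0) := by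
  intro t ht
  rw [ContinuousWithinAt, tendsto_iff_edist_tendsto_0]
  refine (hf.tendsto t ht).congr' ?_
  filter_upwards [self_mem_nhdsWithin] with s hs
  rw [hf.curve_eq hs, hf.curve_eq ht, Lp.edist_toLp_toLp]

theorem inner_curve (hf : ContL2 f) (hg : ContL2 g) {t t' : ℝ} (ht : 0 ≤ t) (ht' : 0 ≤ t') :
    inner ℝ (curve f t) (curve g t') = ∫ r in Ioi 0, f t r * g t' r := by
  rw [L2.inner_def]
  refine integral_congr_ae ?_
  rw [hf.curve_eq ht, hg.curve_eq ht']
  filter_upwards [(hf.memLp t ht).coeFn_toLp, (hg.memLp t' ht').coeFn_toLp] with r h1 h2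
  rw [h1, h2]; simp [mul_comm]

theorem norm_sub_sq (hf : ContL2 f) {t t' : ℝ} (ht : 0 ≤ t) (ht' : 0 ≤ t') :
    ‖curve f t - curve f t'‖ ^ 2 = ∫ r in Ioi 0, (f t r - f t' r) ^ 2 := by
  rw [← real_inner_self_eq_norm_sq, L2.inner_def]
  refine integral_congr_ae ?_
  rw [hf.curve_eq ht, hf.curve_eq ht', ← MemLp.toLp_sub]
  filter_upwards [((hf.memLp t ht).sub (hf.memLp t' ht')).coeFn_toLp] with r h1
  rw [h1]; simp [sq]

theorem integrableOn_mul (hf : ContL2 f) (hg : ContL2 g) {t t' : ℝ} (ht : 0 ≤ t) (ht' : 0 ≤ t') :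
    IntegrableOn (fun r => f t r * g t' r) (Ioi 0) :=
  (hf.memLp t ht).integrable_mul (hg.memLp t' ht')

theorem continuousOn_integral (hf : ContL2 f) (hg : ContL2 g) :
    ContinuousOn (fun t => ∫ r in Ioi 0, f t r * g t r) (Ici 0) :=
  (hf.continuousOn_curve.inner (𝕜 := ℝ) hg.continuousOn_curve).congr fun _ ht =>
    (hf.inner_curve hg ht ht).symm

end ContL2

theorem eLpNorm_two_le {μ : Measure ℝ} {f g : ℝ → ℝ} (h : ∀ᵐ r ∂μ, f r ^ 2 ≤ g r) :
    eLpNorm f 2 μ ≤ (∫⁻ r, ENNReal.ofReal (g r) ∂μ) ^ (1 / 2 : ℝ) := by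
  rw [eLpNorm_eq_lintegral_rpow_enorm_toReal (by norm_num) (by norm_num)]
  simp only [ENNReal.toReal_ofNat]
  gcongr ?_ ^ _
  refine lintegral_mono_ae ?_
  filter_upwards [h] with r hr
  rw [enorm_eq_ofReal_abs, ENNReal.ofReal_rpow_of_nonneg (abs_nonneg _) (by norm_num)]
  refine ENNReal.ofReal_le_ofReal ?_
  simpa using hr

theorem ContL2.of_sq_le {f : ℝ → ℝ → ℝ} {d : ℝ → ℝ → ℝ → ℝ}
    (hf : ∀ t, 0 ≤ t → MemLp (f t) 2 (volume.restrict (Ioi 0)))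
    (hd : ∀ t, 0 ≤ t → Tendsto (fun s => ∫⁻ r in Ioi 0, ENNReal.ofReal (d s t r)) (𝓝[Ici 0] t) (𝓝 0))
    (h : ∀ s t, 0 ≤ s → 0 ≤ t → ∀ᵐ r ∂volume.restrict (Ioi 0), (f s r - f t r) ^ 2 ≤ d s t r) :
    ContL2 f := by
  refine ⟨hf, fun t ht => ?_⟩
  have h1 := (hd t ht).ennrpow_const (1 / 2)
  rw [ENNReal.zero_rpow_of_pos (by norm_num)] at h1
  refine tendsto_of_tendsto_of_tendsto_of_le_of_le' tendsto_const_nhds h1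
    (Eventually.of_forall fun s => zero_le) ?_
  filter_upwards [self_mem_nhdsWithin] with s hs
  exact eLpNorm_two_le (h s t hs ht)

namespace IsFiniteEnergyWaveMap

variable {lam : ℝ} {ψ ψ' : ℝ → ℝ → ℝ}

theorem memH (h : IsFiniteEnergyWaveMap lam ψ ψ') {t : ℝ} (ht : 0 ≤ t) : MemH (ψ t) :=
  (h.mem_energyClass t ht).memH

/-- The factor √(sinh r) turns one term of the H₀ norm into an unweighted L² norm; gradient and
potential terms are treated alike below. -/
theorem contL2_velocity (h : IsFiniteEnergyWaveMap lam ψ ψ') :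
    ContL2 fun t r => √(sinh r) * ψ' t r := by
  refine .of_sq_le (fun t ht => ?_) h.continuous fun s t hs ht => ?_
  · have hm := (h.mem_energyClass t ht).aemeasurable
    refine (memLp_two_iff_integrable_sq
      ((continuous_sinh.sqrt.measurable.aemeasurable.mul hm).aestronglyMeasurable)).2 ?_
    refine (h.mem_energyClass t ht).integrableOn_velocity.congr ?_
    filter_upwards [ae_restrict_mem measurableSet_Ioi] with r hr
    rw [Pi.mul_apply, mul_pow, sq_sqrt (sinh_pos_iff.2 hr).le, mul_comm]
  · filter_upwards [ae_restrict_mem measurableSet_Ioi] with r hr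
    have hs : 0 < sinh r := sinh_pos_iff.2 hr
    rw [← mul_sub, mul_pow, sq_sqrt hs.le, mul_comm]
    gcongr
    have : 0 ≤ (ψ s r - ψ t r) ^ 2 / sinh r ^ 2 := by positivity
    nlinarith [sq_nonneg (deriv (fun r => ψ s r - ψ t r) r)]

theorem contL2_grad (h : IsFiniteEnergyWaveMap lam ψ ψ') :
    ContL2 fun t r => √(sinh r) * deriv (ψ t) r := by
  refine .of_sq_le (fun t ht => ?_) h.continuous fun s t hs ht => ?_
  · refine (memLp_two_iff_integrable_sq
      ((continuous_sinh.sqrt.measurable.mul (measurable_deriv _)).aestronglyMeasurable)).2 ?_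
    refine (h.mem_energyClass t ht).integrableOn_grad.congr ?_
    filter_upwards [ae_restrict_mem measurableSet_Ioi] with r hr
    rw [Pi.mul_apply, mul_pow, sq_sqrt (sinh_pos_iff.2 hr).le, mul_comm]
  · filter_upwards [ae_restrict_mem measurableSet_Ioi, (h.memH hs).ac.ae_hasDerivAt,
      (h.memH ht).ac.ae_hasDerivAt] with r hr h1 h2
    have hs : 0 < sinh r := sinh_pos_iff.2 hr
    rw [← mul_sub, mul_pow, sq_sqrt hs.le, mul_comm, (h1.fun_sub h2).deriv]
    gcongr
    have : 0 ≤ (ψ s r - ψ t r) ^ 2 / sinh r ^ 2 := by positivity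
    nlinarith [sq_nonneg (ψ' s r - ψ' t r)]

theorem contL2_pot (h : IsFiniteEnergyWaveMap lam ψ ψ') :
    ContL2 fun t r => ψ t r / √(sinh r) := by
  refine .of_sq_le (fun t ht => ?_) h.continuous fun s t hs ht => ?_
  · rw [memLp_two_iff_integrable_sq]
    · refine (h.memH ht).pot.congr ?_
      filter_upwards [ae_restrict_mem measurableSet_Ioi] with r hr
      rw [div_pow, sq_sqrt (sinh_pos_iff.2 hr).le]
    · refine ContinuousOn.aestronglyMeasurable ?_ measurableSet_Ioi
      exact (h.memH ht).ac.continuousOn.div continuous_sinh.sqrt.continuousOn fun r hr =>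
        (sqrt_pos.2 (sinh_pos_iff.2 hr)).ne'
  · filter_upwards [ae_restrict_mem measurableSet_Ioi] with r hr
    have hs : 0 < sinh r := sinh_pos_iff.2 hr
    rw [← sub_div, div_pow, sq_sqrt hs.le]
    have e : (ψ s r - ψ t r) ^ 2 / sinh r = (ψ s r - ψ t r) ^ 2 / sinh r ^ 2 * sinh r := by
      field_simp
    rw [e]
    gcongr
    nlinarith [sq_nonneg (ψ' s r - ψ' t r), sq_nonneg (deriv (fun r => ψ s r - ψ t r) r)]

/-- The distance of two states in the radial energy space. -/
noncomputable def _root_.HypWaveMap.gap (ψ : ℝ → ℝ → ℝ) (s t : ℝ) : ℝ :=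
  ‖curve (fun t r => √(sinh r) * deriv (ψ t) r) s - curve (fun t r => √(sinh r) * deriv (ψ t) r) t‖ ^ 2
    + ‖curve (fun t r => ψ t r / √(sinh r)) s - curve (fun t r => ψ t r / √(sinh r)) t‖ ^ 2

theorem integral_grad_sub (h : IsFiniteEnergyWaveMap lam ψ ψ') {s t : ℝ} (hs : 0 ≤ s) (ht : 0 ≤ t) :
    ∫ r in Ioi 0, deriv (fun r => ψ s r - ψ t r) r ^ 2 * sinh r
      = ‖curve (fun t r => √(sinh r) * deriv (ψ t) r) s
        - curve (fun t r => √(sinh r) * deriv (ψ t) r) t‖ ^ 2 := by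
  rw [h.contL2_grad.norm_sub_sq hs ht]
  refine integral_congr_ae ?_
  filter_upwards [ae_restrict_mem measurableSet_Ioi, (h.memH hs).ac.ae_hasDerivAt,
    (h.memH ht).ac.ae_hasDerivAt] with r hr h1 h2
  rw [← mul_sub, mul_pow, sq_sqrt (sinh_pos_iff.2 hr).le, (h1.fun_sub h2).deriv, mul_comm]

/-- Point values are controlled by the energy norm. -/
theorem sq_sub_le_gap (h : IsFiniteEnergyWaveMap lam ψ ψ') {s t r : ℝ} (hs : 0 ≤ s) (ht : 0 ≤ t)
    (hr : 0 < r) : (ψ s r - ψ t r) ^ 2 ≤ gap ψ s t := by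
  refine (((h.memH hs).sub (h.memH ht)).sq_le hr).trans_eq ?_
  rw [gap, ← h.integral_grad_sub hs ht, h.contL2_pot.norm_sub_sq hs ht]
  congr 1
  refine setIntegral_congr_fun measurableSet_Ioi fun r hr => ?_
  rw [← sub_div, div_pow, sq_sqrt (sinh_pos_iff.2 hr).le]

theorem tendsto_gap (h : IsFiniteEnergyWaveMap lam ψ ψ') {t : ℝ} (ht : 0 ≤ t) :
    Tendsto (fun s => gap ψ s t) (𝓝[Ici 0] t) (𝓝 0) := by
  have h1 := ((h.contL2_grad.continuousOn_curve t ht).sub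
    (tendsto_const_nhds (x := curve (fun t r => √(sinh r) * deriv (ψ t) r) t))).norm.pow 2
  have h2 := ((h.contL2_pot.continuousOn_curve t ht).sub
    (tendsto_const_nhds (x := curve (fun t r => ψ t r / √(sinh r)) t))).norm.pow 2
  have h3 := Tendsto.add h1 h2
  simpa [gap] using h3

/-- The solution is uniformly continuous in time on bounded time intervals. -/
theorem exists_forall_gap_lt (h : IsFiniteEnergyWaveMap lam ψ ψ') (T : ℝ) {ε : ℝ} (hε : 0 < ε) :
    ∃ δ > 0, ∀ s ∈ Icc 0 T, ∀ t ∈ Icc 0 T, dist s t < δ → gap ψ s t < ε := by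
  have key : ∀ f : ℝ → ℝ → ℝ, ContL2 f →
      ∃ δ > 0, ∀ s ∈ Icc 0 T, ∀ t ∈ Icc 0 T, dist s t < δ →
        ‖curve f s - curve f t‖ ^ 2 < ε / 2 := by
    intro f hf
    have hu := isCompact_Icc.uniformContinuousOn_of_continuous
      (hf.continuousOn_curve.mono (fun x (hx : x ∈ Icc 0 T) => hx.1))
    obtain ⟨δ, hδ, hδ'⟩ := Metric.uniformContinuousOn_iff.1 hu (√(ε / 2)) (by positivity)
    refine ⟨δ, hδ, fun s hs t ht hst => ?_⟩
    have := hδ' s hs t ht hst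
    rw [dist_eq_norm] at this
    calc _ < √(ε / 2) ^ 2 := by gcongr
      _ = ε / 2 := sq_sqrt (by positivity)
  obtain ⟨δ₁, h1, h1'⟩ := key _ h.contL2_grad
  obtain ⟨δ₂, h2, h2'⟩ := key _ h.contL2_pot
  refine ⟨min δ₁ δ₂, lt_min h1 h2, fun s hs t ht hst => ?_⟩
  have a1 := h1' s hs t ht (hst.trans_le (min_le_left _ _))
  have a2 := h2' s hs t ht (hst.trans_le (min_le_right _ _))
  rw [gap]
  linarith

/-- The distance to the initial state is continuous in time, hence bounded on [0, T], and it
controls point values. -/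
theorem exists_abs_le (h : IsFiniteEnergyWaveMap lam ψ ψ') (T : ℝ) :
    ∃ M, 0 ≤ M ∧ ∀ t ∈ Icc 0 T, ∀ r, 0 < r → |ψ t r| ≤ M := by
  have hc : ContinuousOn (fun t => gap ψ t 0) (Icc 0 T) := by
    have hsub : Icc 0 T ⊆ Ici 0 := fun x hx => hx.1
    exact ((((h.contL2_grad.continuousOn_curve.mono hsub).sub continuousOn_const).norm).pow 2).add
      ((((h.contL2_pot.continuousOn_curve.mono hsub).sub continuousOn_const).norm).pow 2)
  obtain ⟨A, hA⟩ := isCompact_Icc.exists_bound_of_continuousOn hc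
  set B := (∫ r in Ioi 0, deriv (ψ 0) r ^ 2 * sinh r) + ∫ r in Ioi 0, ψ 0 r ^ 2 / sinh r
  refine ⟨√(2 * A + 2 * B), by positivity, fun t ht r hr => ?_⟩
  refine abs_le_sqrt ?_
  have h1 := h.sq_sub_le_gap ht.1 le_rfl hr
  have h2 := (h.memH le_rfl).sq_le hr
  have h3 := (le_abs_self _).trans (hA t ht)
  nlinarith [sq_nonneg (ψ t r - 2 * ψ 0 r)]

/-- On a bounded time interval ψ stays in a fixed compact set, where F is Lipschitz; F 0 = 0 gives
square integrability. -/
theorem contL2_comp (h : IsFiniteEnergyWaveMap lam ψ ψ') {F : ℝ → ℝ} (hF : ContDiff ℝ 1 F)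
    (hF0 : F 0 = 0) : ContL2 fun t r => F (ψ t r) / √(sinh r) := by
  have key : ∀ T, ∃ K : ℝ≥0, ∀ s ∈ Icc 0 T, ∀ t ∈ Icc 0 T, ∀ r, 0 < r →
      |F (ψ s r) - F (ψ t r)| ≤ K * |ψ s r - ψ t r| ∧ |F (ψ t r)| ≤ K * |ψ t r| := by
    intro T
    obtain ⟨M, hM0, hM⟩ := h.exists_abs_le T
    obtain ⟨K, hK⟩ := (hF.contDiffOn (s := Icc (-M) M)).exists_lipschitzOnWith (by simp)
      (convex_Icc _ _) isCompact_Icc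
    refine ⟨K, fun s hs t ht r hr => ⟨?_, ?_⟩⟩
    · exact hK.dist_le_mul _ (abs_le.1 (hM s hs r hr)) _ (abs_le.1 (hM t ht r hr))
    · have := hK.dist_le_mul _ (abs_le.1 (hM t ht r hr)) 0 ⟨by linarith, hM0⟩
      simpa [hF0, Real.dist_eq] using this
  refine ⟨fun t ht => ?_, fun t ht => ?_⟩
  · obtain ⟨K, hK⟩ := key t
    refine (h.contL2_pot.memLp t ht).of_le_mul (c := K) ?_ ?_
    · refine ContinuousOn.aestronglyMeasurable ?_ measurableSet_Ioi
      exact (hF.continuous.comp_continuousOn (h.memH ht).ac.continuousOn).div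
        continuous_sinh.sqrt.continuousOn fun r hr => (sqrt_pos.2 (sinh_pos_iff.2 hr)).ne'
    · filter_upwards [ae_restrict_mem measurableSet_Ioi] with r hr
      have := (hK t ⟨ht, le_rfl⟩ t ⟨ht, le_rfl⟩ r hr).2
      rw [norm_div, norm_div, ← mul_div_assoc]
      gcongr
      exact this
  -- The extra unit of time provides a neighbourhood of t with a common Lipschitz constant.
  · obtain ⟨K, hK⟩ := key (t + 1)
    have h1 := ENNReal.Tendsto.const_mul (a := ENNReal.ofReal K) (h.contL2_pot.tendsto t ht)
      (Or.inr (by simp))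
    rw [mul_zero] at h1
    refine tendsto_of_tendsto_of_tendsto_of_le_of_le' tendsto_const_nhds h1
      (Eventually.of_forall fun s => zero_le) ?_
    filter_upwards [self_mem_nhdsWithin, mem_nhdsWithin_of_mem_nhds (Iio_mem_nhds (lt_add_one t))]
      with s hs hs'
    refine eLpNorm_le_mul_eLpNorm_of_ae_le_mul ?_ 2
    filter_upwards [ae_restrict_mem measurableSet_Ioi] with r hr
    have := (hK s ⟨hs, le_of_lt hs'⟩ t ⟨ht, by linarith⟩ r hr).1
    simp only [Pi.sub_apply, ← sub_div]
    rw [norm_div, norm_div, ← mul_div_assoc]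
    gcongr
    exact this

end IsFiniteEnergyWaveMap

/-! ### The equation for the deviation from a harmonic map -/

theorem ContL2Loc.congr {f g : ℝ → ℝ → ℝ} (hf : ContL2Loc f)
    (h : ∀ t r, 0 ≤ t → 0 < r → f t r = g t r) : ContL2Loc g := by
  have hae : ∀ a b : ℝ, 0 < a → ∀ t, 0 ≤ t → f t =ᵐ[volume.restrict (Icc a b)] g t := by
    intro a b ha t ht
    filter_upwards [ae_restrict_mem measurableSet_Icc] with r hr using h t r ht (ha.trans_le hr.1)
  refine ⟨fun a b ha t ht => (hf.memLp a b ha t ht).ae_eq (hae a b ha t ht), fun a b ha t ht => ?_⟩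
  refine (hf.tendsto a b ha t ht).congr' ?_
  filter_upwards [self_mem_nhdsWithin] with s hs
  exact eLpNorm_congr_ae ((hae a b ha s hs).sub (hae a b ha t ht))

theorem contDiffOn_inv_sinh : ContDiffOn ℝ (⊤ : ℕ∞) (fun r => (sinh r)⁻¹) (Ioi 0) :=
  contDiff_sinh.contDiffOn.inv fun _ hr => (sinh_pos_iff.2 hr).ne'

theorem contDiff_harmonicMap {lam : ℝ} (h0 : 0 ≤ lam) (h1 : lam < 1) :
    ContDiff ℝ (⊤ : ℕ∞) (harmonicMap lam) := by
  have e : harmonicMap lam = fun r => log (1 + lam * tanh (r / 2)) - log (1 - lam * tanh (r / 2)) := by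
    ext r; exact harmonicMap_eq h0 h1 r
  have ht : ContDiff ℝ (⊤ : ℕ∞) fun r => tanh (r / 2) := by
    simp only [tanh_eq_sinh_div_cosh]
    exact (contDiff_sinh.comp (contDiff_id.div_const 2)).div
      (contDiff_cosh.comp (contDiff_id.div_const 2)) fun r => (cosh_pos _).ne'
  rw [e]
  refine ((contDiff_const.add (contDiff_const.mul ht)).log fun r => ?_).sub
    ((contDiff_const.sub (contDiff_const.mul ht)).log fun r => ?_)
  · linarith [(abs_mul_tanh_lt h0 h1 (r / 2)).1]
  · linarith [(abs_mul_tanh_lt h0 h1 (r / 2)).2]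

theorem contDiffOn_deriv_harmonicMap {lam : ℝ} (h0 : 0 ≤ lam) (h1 : lam < 1) :
    ContDiffOn ℝ (⊤ : ℕ∞) (fun r => sinh (harmonicMap lam r) / sinh r) (Ioi 0) :=
  (contDiff_sinh.comp (contDiff_harmonicMap h0 h1)).contDiffOn.div contDiff_sinh.contDiffOn
    fun _ hr => (sinh_pos_iff.2 hr).ne'

theorem hasDerivAt_deriv_harmonicMap {lam : ℝ} (h0 : 0 ≤ lam) (h1 : lam < 1) {r : ℝ} (hr : 0 < r) :
    HasDerivAt (fun r => sinh (harmonicMap lam r) / sinh r)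
      (cosh (harmonicMap lam r) * sinh (harmonicMap lam r) / sinh r ^ 2
        - sinh (harmonicMap lam r) / sinh r * (cosh r / sinh r)) r := by
  have hs : 0 < sinh r := sinh_pos_iff.2 hr
  refine (((hasDerivAt_harmonicMap h0 h1 hr).sinh).div (hasDerivAt_sinh r) hs.ne').congr_deriv ?_
  field_simp

theorem integral_Ioi_eq {k l : ℝ → ℝ} (h : ∀ r, 0 < r → k r = l r) (h0 : ∀ r, r ≤ 0 → l r = 0) :
    ∫ r in Ioi 0, k r = ∫ r, l r := by
  rw [setIntegral_congr_fun measurableSet_Ioi fun r hr => h r hr,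
    setIntegral_eq_integral_of_forall_compl_eq_zero]
  exact fun r hr => h0 r (not_lt.1 hr)

theorem IsTestFunction.mul_inv_sinh {χ : ℝ → ℝ} (hχ : IsTestFunction χ) :
    IsTestFunction fun r => χ r * (sinh r)⁻¹ := hχ.mul_contDiffOn contDiffOn_inv_sinh

theorem IsTestFunction.deriv_mul_inv_sinh {χ : ℝ → ℝ} (hχ : IsTestFunction χ) {r : ℝ} (hr : 0 < r) :
    _root_.deriv (fun r => χ r * (sinh r)⁻¹) r * sinh r
      = _root_.deriv χ r - χ r * (cosh r / sinh r) := by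
  have hs : 0 < sinh r := sinh_pos_iff.2 hr
  rw [(hχ.differentiable.differentiableAt.hasDerivAt.fun_mul
    ((hasDerivAt_sinh r).fun_inv hs.ne')).deriv]
  field_simp
  ring

/-- The source in the equation for `ψ - P`, written in the coordinates `(t, r)`. -/
noncomputable def source (lam : ℝ) (ψ : ℝ → ℝ → ℝ) (t r : ℝ) : ℝ :=
  (deriv (ψ t) r - sinh (harmonicMap lam r) / sinh r) * (cosh r / sinh r)
    - 1 / 2 * (sinh (2 * ψ t r) - sinh (2 * harmonicMap lam r)) / sinh r ^ 2

namespace IsFiniteEnergyWaveMap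

variable {lam : ℝ} {ψ ψ' : ℝ → ℝ → ℝ}

theorem contL2Loc_of_div {f : ℝ → ℝ → ℝ} (hf : ContL2 fun t r => f t r / √(sinh r)) :
    ContL2Loc f :=
  (hf.contL2Loc.mul_left (g := fun r => √(sinh r)) continuous_sinh.sqrt.continuousOn).congr
    fun _ _ _ hr => mul_div_cancel₀ _ (sqrt_pos.2 (sinh_pos_iff.2 hr)).ne'

theorem contL2Loc_of_mul {f : ℝ → ℝ → ℝ} (hf : ContL2 fun t r => √(sinh r) * f t r) :
    ContL2Loc f :=
  (hf.contL2Loc.mul_left (g := fun r => (√(sinh r))⁻¹) (continuous_sinh.sqrt.continuousOn.inv₀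
    fun _ hr => (sqrt_pos.2 (sinh_pos_iff.2 hr)).ne')).congr
    fun _ _ _ hr => inv_mul_cancel_left₀ (sqrt_pos.2 (sinh_pos_iff.2 hr)).ne' _

theorem contL2Loc_self (h : IsFiniteEnergyWaveMap lam ψ ψ') : ContL2Loc ψ :=
  contL2Loc_of_div h.contL2_pot

theorem contL2Loc_velocity (h : IsFiniteEnergyWaveMap lam ψ ψ') : ContL2Loc ψ' :=
  contL2Loc_of_mul h.contL2_velocity

theorem contL2Loc_deriv (h : IsFiniteEnergyWaveMap lam ψ ψ') : ContL2Loc fun t => deriv (ψ t) :=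
  contL2Loc_of_mul h.contL2_grad

theorem contL2Loc_comp (h : IsFiniteEnergyWaveMap lam ψ ψ') {F : ℝ → ℝ} (hF : ContDiff ℝ 1 F)
    (hF0 : F 0 = 0) : ContL2Loc fun t r => F (ψ t r) :=
  contL2Loc_of_div (h.contL2_comp hF hF0)

/-- The deviation of a wave map from a harmonic map solves a wave equation on the half line. -/
theorem weakWave (h : IsFiniteEnergyWaveMap lam ψ ψ') {lam' : ℝ} (h0 : 0 ≤ lam') (h1 : lam' < 1) :
    WeakWave (fun t r => ψ t r - harmonicMap lam' r) ψ'
      (fun t r => deriv (ψ t) r - sinh (harmonicMap lam' r) / sinh r) (source lam' ψ) := by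
  have hP := contDiff_harmonicMap h0 h1
  have hPc : ContL2Loc fun _ r => harmonicMap lam' r := .of_continuousOn hP.continuous.continuousOn
  have hP'c : ContL2Loc fun _ r => sinh (harmonicMap lam' r) / sinh r :=
    .of_continuousOn (contDiffOn_deriv_harmonicMap h0 h1).continuousOn
  have hP2c : ContL2Loc fun _ r => sinh (2 * harmonicMap lam' r) :=
    .of_continuousOn (contDiff_sinh.comp (contDiff_const.mul hP)).continuous.continuousOn
  have hcoth : ContinuousOn (fun r => cosh r / sinh r) (Ioi 0) :=
    continuous_cosh.continuousOn.div continuous_sinh.continuousOn fun r hr => (sinh_pos_iff.2 hr).ne'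
  have hw : ContinuousOn (fun r => 1 / 2 / sinh r ^ 2) (Ioi 0) :=
    continuousOn_const.div (continuous_sinh.pow 2).continuousOn
      fun r hr => (pow_pos (sinh_pos_iff.2 hr) 2).ne'
  have hs2 : ContL2Loc fun t r => sinh (2 * ψ t r) :=
    h.contL2Loc_comp (F := fun x => sinh (2 * x)) (contDiff_sinh.comp (contDiff_const.mul contDiff_id))
      (by simp)
  have hux := h.contL2Loc_deriv.sub hP'c
  have hN : ContL2Loc (source lam' ψ) :=
    ((hux.mul_left hcoth).sub ((hs2.sub hP2c).mul_left hw)).congr fun t r _ _ => by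
      rw [source]; ring
  have hψP : ContL2Loc fun t r => ψ t r - harmonicMap lam' r := h.contL2Loc_self.sub hPc
  refine ⟨hψP, h.contL2Loc_velocity, hux, hN, fun χ hχ t ht => ?_, fun χ hχ t ht => ?_,
    fun χ hχ t ht => ?_⟩
  · have hl : LocallyAC fun r => ψ t r - harmonicMap lam' r :=
      (h.memH ht).ac.sub (.of_contDiffOn (hP.of_le (by exact_mod_cast le_top)).contDiffOn)
    rw [← hl.integral_mul_deriv hχ]
    have := (ae_restrict_iff' measurableSet_Ioi).1 (h.memH ht).ac.ae_hasDerivAt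
    refine integral_congr_ae ?_
    filter_upwards [this] with r hr
    rcases le_or_gt r 0 with h2 | h2
    · simp [hχ.eq_zero h2]
    · rw [((hr h2).fun_sub (hasDerivAt_harmonicMap h0 h1 h2)).deriv]
  -- Testing with χ / sinh r passes from the volume sinh r dr to dr.
  · have e : ∀ (f : ℝ → ℝ), ∫ r in Ioi 0, f r * (χ r * (sinh r)⁻¹) * sinh r = ∫ r, χ r * f r :=
      fun f => integral_Ioi_eq (fun r hr => by
        have := (sinh_pos_iff.2 hr).ne'; field_simp) fun r hr => by rw [hχ.eq_zero hr, zero_mul]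
    have hd := h.hasDeriv_position _ hχ.mul_inv_sinh t ht
    simp only [e] at hd
    refine (hd.sub_const (∫ r, χ r * harmonicMap lam' r)).congr (fun s hs => ?_) ?_
    · rw [← integral_sub (h.contL2Loc_self.integrable_mul hχ hs) (hPc.integrable_mul hχ le_rfl)]
      simp only [mul_sub]
    · rw [← integral_sub (h.contL2Loc_self.integrable_mul hχ ht) (hPc.integrable_mul hχ le_rfl)]
      simp only [mul_sub]
  · have e : ∀ (f : ℝ → ℝ), ∫ r in Ioi 0, f r * (χ r * (sinh r)⁻¹) * sinh r = ∫ r, χ r * f r :=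
      fun f => integral_Ioi_eq (fun r hr => by
        have := (sinh_pos_iff.2 hr).ne'; field_simp) fun r hr => by rw [hχ.eq_zero hr, zero_mul]
    have hd := h.hasDeriv_velocity _ hχ.mul_inv_sinh t ht
    simp only [e] at hd
    refine hd.congr_deriv ?_
    -- (χ / sinh r)' sinh r = χ' − χ coth r; the second term becomes the coth r ψ_r in the source.
    have e2 : ∫ r in Ioi 0, (deriv (ψ t) r * deriv (fun r => χ r * (sinh r)⁻¹) r
        + sinh (2 * ψ t r) / (2 * sinh r ^ 2) * (χ r * (sinh r)⁻¹)) * sinh r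
        = ∫ r, (deriv χ r * deriv (ψ t) r - χ r * (cosh r / sinh r * deriv (ψ t) r
          - 1 / 2 / sinh r ^ 2 * sinh (2 * ψ t r))) := by
      refine integral_Ioi_eq (fun r hr => ?_) fun r hr => ?_
      · have hs : 0 < sinh r := sinh_pos_iff.2 hr
        have := hχ.deriv_mul_inv_sinh hr
        calc _ = deriv (ψ t) r * (deriv (fun r => χ r * (sinh r)⁻¹) r * sinh r)
              + sinh (2 * ψ t r) / (2 * sinh r ^ 2) * χ r := by field_simp
          _ = _ := by rw [this]; field_simp; ring
      · rw [hχ.eq_zero hr, hχ.deriv.eq_zero hr]; ring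
    have hPl : LocallyAC fun r => sinh (harmonicMap lam' r) / sinh r :=
      .of_contDiffOn ((contDiffOn_deriv_harmonicMap h0 h1).of_le (by exact_mod_cast le_top))
    -- The second order equation of P in weak form, obtained by differentiating P' = sinh P / sinh
    -- r.
    have e3 : ∫ r, χ r * (1 / 2 / sinh r ^ 2 * sinh (2 * harmonicMap lam' r)
        - cosh r / sinh r * (sinh (harmonicMap lam' r) / sinh r))
        = -∫ r, deriv χ r * (sinh (harmonicMap lam' r) / sinh r) := by
      rw [← hPl.integral_mul_deriv hχ]
      congr 1; ext r
      rcases le_or_gt r 0 with h2 | h2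
      · simp [hχ.eq_zero h2]
      · rw [(hasDerivAt_deriv_harmonicMap h0 h1 h2).deriv, sinh_two_mul]
        have hs : 0 < sinh r := sinh_pos_iff.2 h2
        field_simp
    have hNψ := (h.contL2Loc_deriv.mul_left hcoth).sub (hs2.mul_left hw)
    have hNP := (hP2c.mul_left hw).sub (hP'c.mul_left hcoth)
    have e4 : ∫ r, deriv χ r * (deriv (ψ t) r - sinh (harmonicMap lam' r) / sinh r)
        = (∫ r, deriv χ r * deriv (ψ t) r)
          - ∫ r, deriv χ r * (sinh (harmonicMap lam' r) / sinh r) := by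
      rw [← integral_sub (h.contL2Loc_deriv.integrable_mul hχ.deriv ht)
        (hP'c.integrable_mul hχ.deriv le_rfl)]
      simp only [mul_sub]
    have e5 : ∫ r, χ r * source lam' ψ t r
        = (∫ r, χ r * (cosh r / sinh r * deriv (ψ t) r - 1 / 2 / sinh r ^ 2 * sinh (2 * ψ t r)))
          + ∫ r, χ r * (1 / 2 / sinh r ^ 2 * sinh (2 * harmonicMap lam' r)
        - cosh r / sinh r * (sinh (harmonicMap lam' r) / sinh r)) := by
      rw [← integral_add (hNψ.integrable_mul hχ ht) (hNP.integrable_mul hχ le_rfl)]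
      congr 1; ext r; rw [source]; ring
    rw [e2, integral_sub (h.contL2Loc_deriv.integrable_mul hχ.deriv ht) (hNψ.integrable_mul hχ ht),
      e4, e5, e3]
    ring

end IsFiniteEnergyWaveMap

/-! ### The Morawetz identity -/

/-- The derivative in `r` of `potential (P r) p` with `p` frozen. -/
noncomputable def potentialDrift (lam p r : ℝ) : ℝ :=
  sinh (harmonicMap lam r) / sinh r
    * (1 / 2 * (sinh (2 * p) - sinh (2 * harmonicMap lam r)
      - 2 * (p - harmonicMap lam r) * cosh (2 * harmonicMap lam r)))

/-- The time derivative of the Morawetz functional with weights `w` and `v`. -/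
noncomputable def morawetzDensity (lam : ℝ) (w v : ℝ → ℝ) (ψ ψ' : ℝ → ℝ → ℝ) (t r : ℝ) : ℝ :=
  ψ' t r ^ 2 * (v r - 1 / 2 * deriv w r)
    + (deriv (ψ t) r - sinh (harmonicMap lam r) / sinh r) ^ 2
      * (w r * (cosh r / sinh r) - 1 / 2 * deriv w r - v r)
    + (v r * (cosh r / sinh r) - deriv v r)
      * ((deriv (ψ t) r - sinh (harmonicMap lam r) / sinh r) * (ψ t r - harmonicMap lam r))
    - v r / sinh r ^ 2 * ((ψ t r - harmonicMap lam r)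
      * (1 / 2 * (sinh (2 * ψ t r) - sinh (2 * harmonicMap lam r))))
    + (deriv w r / sinh r ^ 2 - 2 * w r * cosh r / sinh r ^ 3)
      * potential (harmonicMap lam r) (ψ t r)
    + w r / sinh r ^ 2 * potentialDrift lam (ψ t r) r

theorem LocallyAC.potential {lam : ℝ} (h0 : 0 ≤ lam) (h1 : lam < 1) {u : ℝ → ℝ} (hu : LocallyAC u) :
    LocallyAC fun r => potential (harmonicMap lam r) (u r) := by
  have hP : LocallyAC (harmonicMap lam) :=
    .of_contDiffOn ((contDiff_harmonicMap h0 h1).of_le (by exact_mod_cast le_top)).contDiffOn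
  have hs : ContDiff ℝ 1 fun x => sinh x ^ 2 := contDiff_sinh.pow 2
  have hs2 : ContDiff ℝ 1 fun x => sinh (2 * x) := contDiff_sinh.comp (contDiff_const.mul contDiff_id)
  exact (((hu.comp hs).sub (hP.comp hs)).sub ((hu.sub hP).mul (hP.comp hs2))).const_mul (1 / 2)

/-- The p-derivative of the potential is the nonlinearity; what remains is the effect of moving P
while the deviation p − P stays fixed. -/
theorem hasDerivAt_potential {lam : ℝ} (h0 : 0 ≤ lam) (h1 : lam < 1) {u : ℝ → ℝ} {u' r : ℝ}
    (hr : 0 < r) (hu : HasDerivAt u u' r) :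
    HasDerivAt (fun r => potential (harmonicMap lam r) (u r))
      (1 / 2 * (sinh (2 * u r) - sinh (2 * harmonicMap lam r))
        * (u' - sinh (harmonicMap lam r) / sinh r) + potentialDrift lam (u r) r) r := by
  have hP := hasDerivAt_harmonicMap h0 h1 hr
  have h := (((hu.sinh.fun_pow 2).fun_sub (hP.sinh.fun_pow 2)).fun_sub
    ((hu.fun_sub hP).fun_mul ((hP.const_mul 2).sinh))).const_mul (1 / 2)
  refine h.congr_deriv ?_
  rw [potentialDrift, sinh_two_mul (u r)]
  simp only [Nat.cast_ofNat, Nat.add_one_sub_one, pow_one]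
  rw [sinh_two_mul (harmonicMap lam r)]
  ring

namespace IsFiniteEnergyWaveMap

variable {lam : ℝ} {ψ ψ' : ℝ → ℝ → ℝ}

/-- The momentum identity with weight w plus the virial identity with weight v. The product of φ_r
with the nonlinearity is the r-derivative of the potential up to the drift, and is integrated by
parts. -/
theorem morawetz_identity (h : IsFiniteEnergyWaveMap lam ψ ψ') {lam' : ℝ} (h0 : 0 ≤ lam')
    (h1 : lam' < 1) {w v : ℝ → ℝ} (hw : IsTestFunction w) (hv : IsTestFunction v) {t : ℝ}
    (ht : 0 ≤ t) :
    Integrable (morawetzDensity lam' w v ψ ψ' t) ∧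
    HasDerivWithinAt (fun t => (∫ r, w r * (ψ' t r * (deriv (ψ t) r - sinh (harmonicMap lam' r)
          / sinh r))) + ∫ r, v r * (ψ' t r * (ψ t r - harmonicMap lam' r)))
      (∫ r, morawetzDensity lam' w v ψ ψ' t r) (Ici 0) t := by
  have hW := h.weakWave h0 h1
  have d1 := hW.hasDerivWithinAt_momentum hw ht
  have d2 := hW.hasDerivWithinAt_virial hW hv ht
  have i1 := hW.integrable_momentum hw ht
  have i2 := hW.integrable_virial hW hv ht
  have hF := (h.memH ht).ac.potential h0 h1
  have hWt : IsTestFunction fun r => w r * (sinh r)⁻¹ * (sinh r)⁻¹ := hw.mul_inv_sinh.mul_inv_sinh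
  have i3 := hF.integrable_mul_deriv hWt
  have i4 := (ContL2Loc.of_continuousOn hF.continuousOn).integrable_mul hWt.deriv (t := 0) le_rfl
  have e := hF.integral_mul_deriv hWt
  -- The last summand is an exact derivative with integral 0; adding it trades φ_r times the
  -- nonlinearity for the potential and the drift.
  have key : (fun r => ((w r * ((deriv (ψ t) r - sinh (harmonicMap lam' r) / sinh r)
        * source lam' ψ t r) - 1 / 2 * deriv w r * (ψ' t r ^ 2
          + (deriv (ψ t) r - sinh (harmonicMap lam' r) / sinh r) ^ 2))
      + (v r * (ψ' t r * ψ' t r - (deriv (ψ t) r - sinh (harmonicMap lam' r) / sinh r)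
        * (deriv (ψ t) r - sinh (harmonicMap lam' r) / sinh r)
          + source lam' ψ t r * (ψ t r - harmonicMap lam' r))
        - deriv v r * ((deriv (ψ t) r - sinh (harmonicMap lam' r) / sinh r)
          * (ψ t r - harmonicMap lam' r))))
      + (w r * (sinh r)⁻¹ * (sinh r)⁻¹ * deriv (fun r => potential (harmonicMap lam' r) (ψ t r)) r
        + deriv (fun r => w r * (sinh r)⁻¹ * (sinh r)⁻¹) r * potential (harmonicMap lam' r) (ψ t r)))
      =ᵐ[volume] morawetzDensity lam' w v ψ ψ' t := by
    filter_upwards [(ae_restrict_iff' measurableSet_Ioi).1 (h.memH ht).ac.ae_hasDerivAt] with r hr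
    rcases le_or_gt r 0 with h2 | h2
    · simp [morawetzDensity, hw.eq_zero h2, hv.eq_zero h2, hw.deriv.eq_zero h2, hv.deriv.eq_zero h2,
        hWt.deriv.eq_zero h2]
    · have hs : 0 < sinh r := sinh_pos_iff.2 h2
      have hinv := (hasDerivAt_sinh r).fun_inv hs.ne'
      rw [(hasDerivAt_potential h0 h1 h2 (hr h2)).deriv,
        ((hw.differentiable.differentiableAt.hasDerivAt.fun_mul hinv).fun_mul hinv).deriv,
        morawetzDensity, source]
      generalize potentialDrift lam' (ψ t r) r = A
      generalize potential (harmonicMap lam' r) (ψ t r) = B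
      generalize sinh (2 * ψ t r) = C
      generalize sinh (2 * harmonicMap lam' r) = D
      generalize sinh (harmonicMap lam' r) / sinh r = G
      field_simp
      ring
  refine ⟨((i1.add i2).add (i3.add i4)).congr key, (d1.add d2).congr_deriv ?_⟩
  rw [← integral_congr_ae key, integral_add (by exact i1.add i2) (by exact i3.add i4),
    integral_add i1 i2, integral_add i3 i4, e, neg_add_cancel, add_zero]

end IsFiniteEnergyWaveMap

/-! ### The energy density -/

/-- Twice the energy density with respect to `dr`. -/
noncomputable def energyDensity (ψ ψ' : ℝ → ℝ → ℝ) (t r : ℝ) : ℝ :=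
  ψ' t r ^ 2 * sinh r + deriv (ψ t) r ^ 2 * sinh r + sinh (ψ t r) ^ 2 / sinh r

/-- Twice the energy. -/
noncomputable def twiceEnergy (ψ ψ' : ℝ → ℝ → ℝ) (t : ℝ) : ℝ :=
  ∫ r in Ioi 0, energyDensity ψ ψ' t r

theorem ContL2Loc.continuousOn_integral_sq {f : ℝ → ℝ → ℝ} (hf : ContL2Loc f) {w : ℝ → ℝ}
    (hw : IsTestFunction w) : ContinuousOn (fun t => ∫ r, w r * (f t r * f t r)) (Ici 0) := by
  obtain ⟨χ, hχ, h1, -, -⟩ := hw.exists_eq_one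
  exact hf.continuousOn_integral hf hw hχ h1

theorem sub_le_integral_of_hasDerivWithinAt {g g' φ : ℝ → ℝ} {T : ℝ} (hT : 0 ≤ T)
    (hd : ∀ t, 0 ≤ t → HasDerivWithinAt g (g' t) (Ici 0) t) (hφ : ContinuousOn φ (Ici 0))
    (hle : ∀ t, 0 ≤ t → g' t ≤ φ t) : g T - g 0 ≤ ∫ t in 0..T, φ t := by
  have hsub : Icc 0 T ⊆ Ici 0 := fun x hx => hx.1
  refine intervalIntegral.sub_le_integral_of_hasDeriv_right_of_le hT
    (fun t ht => ((hd t ht.1).continuousWithinAt).mono hsub) (fun t ht => (hd t ht.1.le).mono ?_)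
    (hφ.mono hsub).integrableOn_Icc (fun t ht => hle t ht.1.le)
  exact fun x hx => (ht.1.trans hx).le

namespace IsFiniteEnergyWaveMap

variable {lam : ℝ} {ψ ψ' : ℝ → ℝ → ℝ}

theorem integrableOn_energyDensity (h : IsFiniteEnergyWaveMap lam ψ ψ') {t : ℝ} (ht : 0 ≤ t) :
    IntegrableOn (energyDensity ψ ψ' t) (Ioi 0) :=
  ((h.mem_energyClass t ht).integrableOn_velocity.add
    (h.mem_energyClass t ht).integrableOn_grad).add (h.mem_energyClass t ht).integrableOn_sinh

theorem twiceEnergy_eq (h : IsFiniteEnergyWaveMap lam ψ ψ') {t : ℝ} (ht : 0 ≤ t) :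
    twiceEnergy ψ ψ' t = (∫ r in Ioi 0, ψ' t r ^ 2 * sinh r)
      + (∫ r in Ioi 0, deriv (ψ t) r ^ 2 * sinh r) + ∫ r in Ioi 0, sinh (ψ t r) ^ 2 / sinh r := by
  have hm := h.mem_energyClass t ht
  rw [← integral_add hm.integrableOn_velocity hm.integrableOn_grad,
    ← integral_add (by exact hm.integrableOn_velocity.add hm.integrableOn_grad)
      hm.integrableOn_sinh]
  rfl

theorem energy_eq (h : IsFiniteEnergyWaveMap lam ψ ψ') {t : ℝ} (ht : 0 ≤ t) :
    energy (ψ t) (ψ' t) = ENNReal.ofReal (1 / 2 * twiceEnergy ψ ψ' t) := by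
  rw [(h.mem_energyClass t ht).energy_eq, h.twiceEnergy_eq ht]

theorem _root_.HypWaveMap.energyDensity_nonneg {t r : ℝ} (hr : 0 < r) :
    0 ≤ energyDensity ψ ψ' t r := by
  have hs : 0 < sinh r := sinh_pos_iff.2 hr
  rw [energyDensity]; positivity

theorem _root_.HypWaveMap.twiceEnergy_nonneg (t : ℝ) : 0 ≤ twiceEnergy ψ ψ' t :=
  setIntegral_nonneg measurableSet_Ioi fun _ hr => energyDensity_nonneg hr

theorem contL2_sinh (h : IsFiniteEnergyWaveMap lam ψ ψ') :
    ContL2 fun t r => sinh (ψ t r) / √(sinh r) :=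
  h.contL2_comp contDiff_sinh sinh_zero

theorem integral_velocity_sq (t : ℝ) : ∫ r in Ioi 0, ψ' t r ^ 2 * sinh r
    = ∫ r in Ioi 0, (√(sinh r) * ψ' t r) * (√(sinh r) * ψ' t r) := by
  refine setIntegral_congr_fun measurableSet_Ioi fun r hr => ?_
  have := mul_self_sqrt (sinh_pos_iff.2 hr).le
  linear_combination -(ψ' t r ^ 2) * this

theorem integral_sinh_sq (t : ℝ) : ∫ r in Ioi 0, sinh (ψ t r) ^ 2 / sinh r
    = ∫ r in Ioi 0, (sinh (ψ t r) / √(sinh r)) * (sinh (ψ t r) / √(sinh r)) := by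
  refine setIntegral_congr_fun measurableSet_Ioi fun r hr => ?_
  have := mul_self_sqrt (sinh_pos_iff.2 hr).le
  rw [div_mul_div_comm, this, sq]

theorem continuousOn_twiceEnergy (h : IsFiniteEnergyWaveMap lam ψ ψ') :
    ContinuousOn (twiceEnergy ψ ψ') (Ici 0) := by
  refine (((h.contL2_velocity.continuousOn_integral h.contL2_velocity).add
    (h.contL2_grad.continuousOn_integral h.contL2_grad)).add
    (h.contL2_sinh.continuousOn_integral h.contL2_sinh)).congr fun t ht => ?_
  rw [h.twiceEnergy_eq ht, integral_velocity_sq, integral_sinh_sq,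
    integral_velocity_sq (ψ' := fun t => deriv (ψ t))]
  rfl

theorem exists_twiceEnergy_le (h : IsFiniteEnergyWaveMap lam ψ ψ') (T : ℝ) :
    ∃ B, 0 ≤ B ∧ ∀ t ∈ Icc 0 T, twiceEnergy ψ ψ' t ≤ B := by
  obtain ⟨B, hB⟩ := isCompact_Icc.exists_bound_of_continuousOn
    (h.continuousOn_twiceEnergy.mono fun x (hx : x ∈ Icc 0 T) => hx.1)
  exact ⟨|B|, abs_nonneg _, fun t ht =>
    ((le_abs_self _).trans (hB t ht)).trans (le_abs_self _)⟩

theorem abs_integral_le (h : IsFiniteEnergyWaveMap lam ψ ψ') {t : ℝ} (ht : 0 ≤ t) {k : ℝ → ℝ}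
    {C : ℝ} (h0 : ∀ r, r ≤ 0 → k r = 0) (hk : ∀ r, 0 < r → |k r| ≤ C * energyDensity ψ ψ' t r) :
    |∫ r, k r| ≤ C * twiceEnergy ψ ψ' t := by
  rw [← integral_Ioi_eq (k := k) (fun r _ => rfl) h0, twiceEnergy, ← integral_const_mul]
  rw [← Real.norm_eq_abs]
  refine norm_integral_le_of_norm_le ((h.integrableOn_energyDensity ht).const_mul C) ?_
  filter_upwards [ae_restrict_mem measurableSet_Ioi] with r hr using hk r hr

theorem integral_le (h : IsFiniteEnergyWaveMap lam ψ ψ') {t : ℝ} (ht : 0 ≤ t) {k l : ℝ → ℝ}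
    {C : ℝ} (hk : Integrable k) (hl : Integrable l) (h0 : ∀ r, r ≤ 0 → k r = l r)
    (hle : ∀ᵐ r ∂volume.restrict (Ioi 0), k r ≤ l r + C * energyDensity ψ ψ' t r) :
    ∫ r, k r ≤ (∫ r, l r) + C * twiceEnergy ψ ψ' t := by
  have e : ∫ r, (k r - l r) = ∫ r in Ioi 0, (k r - l r) :=
    (integral_Ioi_eq (fun r _ => rfl) fun r hr => by rw [h0 r hr, sub_self]).symm
  have : ∫ r in Ioi 0, (k r - l r) ≤ ∫ r in Ioi 0, C * energyDensity ψ ψ' t r := by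
    refine integral_mono_ae (hk.sub hl).integrableOn
      ((h.integrableOn_energyDensity ht).const_mul C) ?_
    filter_upwards [hle] with r hr
    have : k r - l r ≤ C * energyDensity ψ ψ' t r := by linarith
    exact this
  rw [← e, integral_const_mul, integral_sub hk hl] at this
  rw [twiceEnergy]; linarith

end IsFiniteEnergyWaveMap

/-! ### Local smoothing -/

/-- The terms in the solution alone that do not involve θ'. The only positive one comes from the
correction J and is absorbed by the S² term. -/
theorem smoothing_pointwise_pot {s c h θ p S S2 : ℝ} (hs : 0 < s) (hc1 : 1 ≤ c)
    (h0 : 0 < h) (h1 : h ≤ 1 / 2) (hθ : 0 ≤ θ) (hS : p ^ 2 ≤ S ^ 2) (hS2 : 2 * p ^ 2 ≤ p * S2) :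
    θ * c * (-(1 / 4 * (1 / (s * (s + h))) * (p * S2)) - 1 / 2 * (1 / (s + h) ^ 2) * S ^ 2
          + 1 / 4 * ((2 * h ^ 2 * s + s - h) / (s + h) ^ 3) * p ^ 2)
      ≤ -(1 / 2 * (θ * (1 / (s * (s + h))) * p ^ 2)) := by
  have hsh : 0 < s + h := by positivity
  have u1 : 1 / 4 * (1 / (s * (s + h))) * (2 * p ^ 2) ≤ 1 / 4 * (1 / (s * (s + h))) * (p * S2) := by
    gcongr
  have u2 : 1 / 2 * (1 / (s + h) ^ 2) * p ^ 2 ≤ 1 / 2 * (1 / (s + h) ^ 2) * S ^ 2 := by gcongr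
  have u3 : 1 / 4 * ((2 * h ^ 2 * s + s - h) / (s + h) ^ 3) * p ^ 2
      ≤ 1 / 2 * (1 / (s + h) ^ 2) * p ^ 2 := by
    gcongr ?_ * _
    rw [← mul_div_assoc, ← mul_div_assoc, div_le_div_iff₀ (by positivity) (by positivity)]
    have h2 : h ^ 2 ≤ 1 / 4 := by nlinarith
    have : 2 * h ^ 2 * s + s - h ≤ 2 * (s + h) := by
      nlinarith [mul_le_mul_of_nonneg_right h2 hs.le]
    calc _ ≤ 1 / 4 * (2 * (s + h)) * (s + h) ^ 2 := by gcongr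
      _ = _ := by ring
  have u4 : θ * c * (-(1 / 4 * (1 / (s * (s + h))) * (p * S2)) - 1 / 2 * (1 / (s + h) ^ 2) * S ^ 2
        + 1 / 4 * ((2 * h ^ 2 * s + s - h) / (s + h) ^ 3) * p ^ 2)
      ≤ θ * c * (-(1 / 4 * (1 / (s * (s + h))) * (2 * p ^ 2))) := by
    gcongr; linarith
  have u5 : 0 ≤ θ * (1 / (s * (s + h))) * p ^ 2 := by positivity
  nlinarith

/-- Whatever carries θ' is an error controlled by the energy density; the bounds by 4 hold because θ
lives on r ≤ 2. -/
theorem smoothing_pointwise_err {s c h θ' a b p S : ℝ} (hs : 0 < s) (hs4 : s ≤ 4) (hc1 : 1 ≤ c)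
    (hc4 : c ≤ 4) (h0 : 0 < h) (h1 : h ≤ 1 / 2) (hS : p ^ 2 ≤ S ^ 2) :
    θ' * (s / (s + h)) * (-(1 / 2 * s * (a ^ 2 + b ^ 2)) - 1 / 2 * c * (b * p)
          + 1 / 2 * (1 / s) * S ^ 2 + 1 / 4 * ((s * h - 1) / (s + h)) * p ^ 2)
      ≤ 3 * |θ'| * (s / (s + h)) * (a ^ 2 * s + b ^ 2 * s + S ^ 2 / s) := by
  have hsh : 0 < s + h := by positivity
  have u1 : |c * (b * p)| ≤ 2 * (b ^ 2 * s + p ^ 2 / s) := by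
    have : |b * p| ≤ 1 / 2 * (b ^ 2 * s + p ^ 2 / s) := by
      rw [abs_le]
      have e1 : 1 / 2 * (b ^ 2 * s + p ^ 2 / s) - b * p = 1 / 2 * ((b * s - p) ^ 2 / s) := by
        field_simp; ring
      have e2 : 1 / 2 * (b ^ 2 * s + p ^ 2 / s) + b * p = 1 / 2 * ((b * s + p) ^ 2 / s) := by
        field_simp; ring
      have e3 : 0 ≤ 1 / 2 * ((b * s - p) ^ 2 / s) := by positivity
      have e4 : 0 ≤ 1 / 2 * ((b * s + p) ^ 2 / s) := by positivity
      constructor <;> linarith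
    rw [abs_mul, abs_of_nonneg (by linarith : (0 : ℝ) ≤ c)]
    nlinarith [abs_nonneg (b * p)]
  have u2 : |(s * h - 1) / (s + h)| ≤ 3 / s := by
    rw [abs_div, abs_of_pos hsh]
    have : |s * h - 1| ≤ 3 := by
      rw [abs_le]; constructor <;> nlinarith
    gcongr; linarith
  have u3 : p ^ 2 / s ≤ S ^ 2 / s := by gcongr
  have u4 : |(s * h - 1) / (s + h) * p ^ 2| ≤ 3 * (S ^ 2 / s) := by
    rw [abs_mul, abs_of_nonneg (sq_nonneg p)]
    calc _ ≤ 3 / s * p ^ 2 := by gcongr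
      _ = 3 * (p ^ 2 / s) := by ring
      _ ≤ _ := by linarith
  have u5 : |-(1 / 2 * s * (a ^ 2 + b ^ 2)) - 1 / 2 * c * (b * p)
        + 1 / 2 * (1 / s) * S ^ 2 + 1 / 4 * ((s * h - 1) / (s + h)) * p ^ 2|
      ≤ 3 * (a ^ 2 * s + b ^ 2 * s + S ^ 2 / s) := by
    have v1 := abs_le.1 u1
    have v2 := abs_le.1 u4
    have v3 : 0 ≤ a ^ 2 * s := by positivity
    have v4 : 0 ≤ b ^ 2 * s := by positivity
    have v5 : 0 ≤ S ^ 2 / s := by positivity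
    have v6 : 1 / 2 * (1 / s) * S ^ 2 = 1 / 2 * (S ^ 2 / s) := by ring
    rw [v6, abs_le]
    constructor <;> linarith
  calc _ ≤ |θ' * (s / (s + h)) * (-(1 / 2 * s * (a ^ 2 + b ^ 2)) - 1 / 2 * c * (b * p)
        + 1 / 2 * (1 / s) * S ^ 2 + 1 / 4 * ((s * h - 1) / (s + h)) * p ^ 2)| := le_abs_self _
    _ = |θ'| * (s / (s + h)) * |-(1 / 2 * s * (a ^ 2 + b ^ 2)) - 1 / 2 * c * (b * p)
        + 1 / 2 * (1 / s) * S ^ 2 + 1 / 4 * ((s * h - 1) / (s + h)) * p ^ 2| := by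
      rw [abs_mul, abs_mul, abs_of_pos (by positivity : 0 < s / (s + h))]
    _ ≤ |θ'| * (s / (s + h)) * (3 * (a ^ 2 * s + b ^ 2 * s + S ^ 2 / s)) :=
        mul_le_mul_of_nonneg_left u5 (by positivity)
    _ = _ := by ring

/-- The pointwise estimate behind local smoothing, for the Morawetz weights
`w = θ s² / (s + h)` and `v = θ s c / (2 (s + h))`; the last two terms come from integrating
by parts the term with the product of the solution and its derivative. -/
theorem smoothing_pointwise {s c h θ θ' a b p S S2 : ℝ} (hs : 0 < s) (hs4 : s ≤ 4) (hc1 : 1 ≤ c)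
    (hc4 : c ≤ 4) (hcs : c ^ 2 = 1 + s ^ 2) (h0 : 0 < h) (h1 : h ≤ 1 / 2) (hθ : 0 ≤ θ)
    (hS : p ^ 2 ≤ S ^ 2) (hS2 : 2 * p ^ 2 ≤ p * S2) :
    a ^ 2 * (θ * (s * c / (2 * (s + h)))
        - 1 / 2 * (θ' * (s ^ 2 / (s + h)) + θ * (c * (s ^ 2 + 2 * h * s) / (s + h) ^ 2)))
      + b ^ 2 * (θ * (s ^ 2 / (s + h)) * (c / s)
        - 1 / 2 * (θ' * (s ^ 2 / (s + h)) + θ * (c * (s ^ 2 + 2 * h * s) / (s + h) ^ 2))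
        - θ * (s * c / (2 * (s + h))))
      + (θ * (s * c / (2 * (s + h))) * (c / s) - (θ' * (s * c / (2 * (s + h)))
        + θ * (((c ^ 2 + s ^ 2) * (s + h) - s * c ^ 2) / (2 * (s + h) ^ 2)))) * (b * p)
      - θ * (s * c / (2 * (s + h))) / s ^ 2 * (p * (1 / 2 * S2))
      + ((θ' * (s ^ 2 / (s + h)) + θ * (c * (s ^ 2 + 2 * h * s) / (s + h) ^ 2)) / s ^ 2
        - 2 * (θ * (s ^ 2 / (s + h))) * c / s ^ 3) * (1 / 2 * S ^ 2)
      + (θ * (s * (s * h - 1) / (2 * (s + h) ^ 2)) * (p * b)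
        + (θ' * (s * (s * h - 1) / (2 * (s + h) ^ 2))
          + θ * (c * (2 * h ^ 2 * s + s - h) / (2 * (s + h) ^ 3))) * (1 / 2 * p ^ 2))
      ≤ -(1 / 2 * (θ * (h * s / (s + h) ^ 2) * (a ^ 2 + b ^ 2) + θ * (1 / (s * (s + h))) * p ^ 2))
        + 3 * |θ'| * (s / (s + h)) * (a ^ 2 * s + b ^ 2 * s + S ^ 2 / s) := by
  have hsh : 0 < s + h := by positivity
  -- After regrouping, J has reduced the cross terms b p without θ' to a multiple of c² − 1 − s² =
  -- 0.
  have e : a ^ 2 * (θ * (s * c / (2 * (s + h)))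
        - 1 / 2 * (θ' * (s ^ 2 / (s + h)) + θ * (c * (s ^ 2 + 2 * h * s) / (s + h) ^ 2)))
      + b ^ 2 * (θ * (s ^ 2 / (s + h)) * (c / s)
        - 1 / 2 * (θ' * (s ^ 2 / (s + h)) + θ * (c * (s ^ 2 + 2 * h * s) / (s + h) ^ 2))
        - θ * (s * c / (2 * (s + h))))
      + (θ * (s * c / (2 * (s + h))) * (c / s) - (θ' * (s * c / (2 * (s + h)))
        + θ * (((c ^ 2 + s ^ 2) * (s + h) - s * c ^ 2) / (2 * (s + h) ^ 2)))) * (b * p)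
      - θ * (s * c / (2 * (s + h))) / s ^ 2 * (p * (1 / 2 * S2))
      + ((θ' * (s ^ 2 / (s + h)) + θ * (c * (s ^ 2 + 2 * h * s) / (s + h) ^ 2)) / s ^ 2
        - 2 * (θ * (s ^ 2 / (s + h))) * c / s ^ 3) * (1 / 2 * S ^ 2)
      + (θ * (s * (s * h - 1) / (2 * (s + h) ^ 2)) * (p * b)
        + (θ' * (s * (s * h - 1) / (2 * (s + h) ^ 2))
          + θ * (c * (2 * h ^ 2 * s + s - h) / (2 * (s + h) ^ 3))) * (1 / 2 * p ^ 2))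
      = -(1 / 2 * θ * c * (h * s / (s + h) ^ 2) * (a ^ 2 + b ^ 2))
        + θ * c * (-(1 / 4 * (1 / (s * (s + h))) * (p * S2)) - 1 / 2 * (1 / (s + h) ^ 2) * S ^ 2
          + 1 / 4 * ((2 * h ^ 2 * s + s - h) / (s + h) ^ 3) * p ^ 2)
        + θ' * (s / (s + h)) * (-(1 / 2 * s * (a ^ 2 + b ^ 2)) - 1 / 2 * c * (b * p)
          + 1 / 2 * (1 / s) * S ^ 2 + 1 / 4 * ((s * h - 1) / (s + h)) * p ^ 2)
        + θ * (1 / 2 * s * (c ^ 2 - 1 - s ^ 2) / (s + h) ^ 2) * (b * p) := by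
    field_simp
    ring
  have hx : θ * (1 / 2 * s * (c ^ 2 - 1 - s ^ 2) / (s + h) ^ 2) * (b * p) = 0 := by
    rw [hcs]; ring
  rw [e, hx, add_zero]
  have t1 : 1 / 2 * (θ * (h * s / (s + h) ^ 2) * (a ^ 2 + b ^ 2))
      ≤ 1 / 2 * θ * c * (h * s / (s + h) ^ 2) * (a ^ 2 + b ^ 2) := by
    have : 0 ≤ θ * (h * s / (s + h) ^ 2) * (a ^ 2 + b ^ 2) := by positivity
    nlinarith
  have t2 := smoothing_pointwise_pot hs hc1 h0 h1 hθ hS hS2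
  have t3 := smoothing_pointwise_err (θ' := θ') (a := a) (b := b) hs hs4 hc1 hc4 h0 h1 hS
  linarith

theorem cosh_two_le : cosh 2 ≤ 4 := by
  have h1 := exp_one_lt_d9
  have h2 := exp_one_gt_d9
  have h3 : exp (-1) ≤ 0.37 := by
    rw [exp_neg, inv_eq_one_div, div_le_iff₀ (exp_pos 1)]; linarith
  have h4 : cosh 1 ≤ 1.56 := by rw [cosh_eq]; linarith
  have h5 : cosh 2 = 2 * cosh 1 ^ 2 - 1 := by
    rw [show (2 : ℝ) = 2 * 1 by norm_num, cosh_two_mul, sinh_sq]; ring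
  rw [h5]
  nlinarith [one_le_cosh 1]

theorem abs_mul_le_of_pos {x y s : ℝ} (hs : 0 < s) : |x * y| ≤ 1 / 2 * (x ^ 2 * s + y ^ 2 / s) := by
  rw [abs_le]
  have e1 : 1 / 2 * (x ^ 2 * s + y ^ 2 / s) - x * y = 1 / 2 * ((x * s - y) ^ 2 / s) := by
    field_simp; ring
  have e2 : 1 / 2 * (x ^ 2 * s + y ^ 2 / s) + x * y = 1 / 2 * ((x * s + y) ^ 2 / s) := by
    field_simp; ring
  have e3 : 0 ≤ 1 / 2 * ((x * s - y) ^ 2 / s) := by positivity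
  have e4 : 0 ≤ 1 / 2 * ((x * s + y) ^ 2 / s) := by positivity
  constructor <;> linarith

theorem two_mul_sq_le_mul_sinh (p : ℝ) : 2 * p ^ 2 ≤ p * sinh (2 * p) := by
  rcases le_total 0 p with h | h
  · have := self_le_sinh_iff.2 (by linarith : 0 ≤ 2 * p)
    nlinarith
  · have := self_le_sinh_iff.2 (by linarith : 0 ≤ 2 * -p)
    have e : sinh (2 * p) = -sinh (2 * -p) := by rw [← sinh_neg]; ring_nf
    rw [e]; nlinarith

/-- One form, with the factor 2 and the power n, serves several weights; hence the redundant 2 in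
some of them later. -/
theorem contDiffOn_smoothingWeight {h : ℝ} (h0 : 0 < h) {g : ℝ → ℝ} (hg : ContDiff ℝ (⊤ : ℕ∞) g)
    (n : ℕ) : ContDiffOn ℝ (⊤ : ℕ∞) (fun r => g r / (2 * (sinh r + h) ^ n)) (Ioi 0) := by
  refine hg.contDiffOn.div (contDiff_const.mul ((contDiff_sinh.add contDiff_const).pow n)).contDiffOn
    fun r hr => ?_
  have := sinh_pos_iff.2 (mem_Ioi.1 hr)
  positivity

theorem contDiffOn_smoothingWeight_div {h : ℝ} (h0 : 0 < h) :
    ContDiffOn ℝ (⊤ : ℕ∞) (fun r => 1 / (sinh r * (sinh r + h))) (Ioi 0) := by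
  refine contDiffOn_const.div
    (contDiff_sinh.mul (contDiff_sinh.add contDiff_const)).contDiffOn fun r hr => ?_
  have := sinh_pos_iff.2 (mem_Ioi.1 hr)
  positivity

namespace IsFiniteEnergyWaveMap

variable {lam : ℝ} {ψ ψ' : ℝ → ℝ → ℝ}

/-- The integrand is the derivative of J ψ² / 2, which has compact support; this is the correction
by J in `smoothing_pointwise`. -/
theorem integral_add_half_sq (h : IsFiniteEnergyWaveMap lam ψ ψ') {J : ℝ → ℝ}
    (hJ : IsTestFunction J) {t : ℝ} (ht : 0 ≤ t) :
    Integrable (fun r => J r * (ψ t r * deriv (ψ t) r) + deriv J r * (1 / 2 * ψ t r ^ 2)) ∧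
    ∫ r, (J r * (ψ t r * deriv (ψ t) r) + deriv J r * (1 / 2 * ψ t r ^ 2)) = 0 := by
  have hac : LocallyAC fun r => 1 / 2 * ψ t r ^ 2 :=
    ((h.memH ht).ac.comp (F := fun x => x ^ 2) (by fun_prop)).const_mul (1 / 2)
  have i1 := hac.integrable_mul_deriv hJ
  have i2 := (ContL2Loc.of_continuousOn hac.continuousOn).integrable_mul hJ.deriv (t := 0) le_rfl
  have e : (fun r => J r * deriv (fun r => 1 / 2 * ψ t r ^ 2) r + deriv J r * (1 / 2 * ψ t r ^ 2))
      =ᵐ[volume] fun r => J r * (ψ t r * deriv (ψ t) r) + deriv J r * (1 / 2 * ψ t r ^ 2) := by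
    filter_upwards [(ae_restrict_iff' measurableSet_Ioi).1 (h.memH ht).ac.ae_hasDerivAt] with r hr
    rcases le_or_gt r 0 with h2 | h2
    · simp [hJ.eq_zero h2]
    · rw [(((hr h2).fun_pow 2).const_mul (1 / 2)).deriv]
      simp only [Nat.cast_ofNat, Nat.add_one_sub_one, pow_one]
      ring
  exact ⟨(i1.add i2).congr e, by
    rw [← integral_congr_ae e, integral_add i1 i2, hac.integral_mul_deriv hJ, neg_add_cancel]⟩

/-- A Morawetz estimate around the trivial map with weights flattened at scale ε. The gain on the
left is the near-origin control that the energy lacks. A cutoff derivative of size δ / sinh r costs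
δ / ε, harmless when δ → 0 at fixed ε. -/
theorem local_smoothing (h : IsFiniteEnergyWaveMap lam ψ ψ') {θ : ℝ → ℝ} (hθ : IsTestFunction θ)
    (hθ0 : ∀ r, 0 ≤ θ r) (hθ1 : ∀ r, θ r ≤ 1) (hθ2 : ∀ r, 2 ≤ r → θ r = 0) {δ K : ℝ} (hδ : 0 ≤ δ)
    (hK : 0 ≤ K) (hθd : ∀ r, 0 < r → r < 2 → |deriv θ r| ≤ δ / sinh r + K) {T B : ℝ} (hT : 0 ≤ T)
    (hB : ∀ t ∈ Icc 0 T, twiceEnergy ψ ψ' t ≤ B) {ε : ℝ} (h0 : 0 < ε) (h1 : ε ≤ 1 / 2) :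
    ∫ t in 0..T, ((∫ r, θ r * (2 * ε * sinh r / (2 * (sinh r + ε) ^ 2)) * (ψ' t r * ψ' t r))
      + ∫ r, θ r * (1 / (sinh r * (sinh r + ε))) * (ψ t r * ψ t r))
      ≤ 8 * B + 6 * (δ / ε + K) * (B * T) := by
  have hs2 : ContDiff ℝ (⊤ : ℕ∞) fun r => 2 * sinh r ^ 2 := contDiff_const.mul (contDiff_sinh.pow 2)
  have hsc : ContDiff ℝ (⊤ : ℕ∞) fun r => sinh r * cosh r := contDiff_sinh.mul contDiff_cosh
  have hsj : ContDiff ℝ (⊤ : ℕ∞) fun r => sinh r * (sinh r * ε - 1) :=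
    contDiff_sinh.mul ((contDiff_sinh.mul contDiff_const).sub contDiff_const)
  have hse : ContDiff ℝ (⊤ : ℕ∞) fun r => 2 * ε * sinh r := contDiff_const.mul contDiff_sinh
  have hw := hθ.mul_contDiffOn (contDiffOn_smoothingWeight h0 hs2 1)
  have hv := hθ.mul_contDiffOn (contDiffOn_smoothingWeight h0 hsc 1)
  have hJ := hθ.mul_contDiffOn (contDiffOn_smoothingWeight h0 hsj 2)
  have hω₁ := hθ.mul_contDiffOn (contDiffOn_smoothingWeight h0 hse 2)
  have hω₂ := hθ.mul_contDiffOn (contDiffOn_smoothingWeight_div h0)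
  -- θ attains its minimum 0 at such points, the endpoint 2 included.
  have hθd2 : ∀ r, 2 ≤ r → deriv θ r = 0 := fun r hr =>
    IsLocalMin.deriv_eq_zero (Eventually.of_forall fun x => by rw [hθ2 r hr]; exact hθ0 x)
  set w : ℝ → ℝ := fun r => θ r * (2 * sinh r ^ 2 / (2 * (sinh r + ε) ^ 1)) with hwdef
  set v : ℝ → ℝ := fun r => θ r * (sinh r * cosh r / (2 * (sinh r + ε) ^ 1)) with hvdef
  set J : ℝ → ℝ := fun r => θ r * (sinh r * (sinh r * ε - 1) / (2 * (sinh r + ε) ^ 2)) with hJdef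
  set ω₁ : ℝ → ℝ := fun r => θ r * (2 * ε * sinh r / (2 * (sinh r + ε) ^ 2)) with hω₁def
  set ω₂ : ℝ → ℝ := fun r => θ r * (1 / (sinh r * (sinh r + ε))) with hω₂def
  set C : ℝ := 3 * (δ / ε + K) with hC
  have hC0 : 0 ≤ C := by positivity
  have hderiv : ∀ r, 0 < r →
      deriv w r = deriv θ r * (sinh r ^ 2 / (sinh r + ε))
        + θ r * (cosh r * (sinh r ^ 2 + 2 * ε * sinh r) / (sinh r + ε) ^ 2) ∧
      deriv v r = deriv θ r * (sinh r * cosh r / (2 * (sinh r + ε)))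
        + θ r * (((cosh r ^ 2 + sinh r ^ 2) * (sinh r + ε) - sinh r * cosh r ^ 2)
          / (2 * (sinh r + ε) ^ 2)) ∧
      deriv J r = deriv θ r * (sinh r * (sinh r * ε - 1) / (2 * (sinh r + ε) ^ 2))
        + θ r * (cosh r * (2 * ε ^ 2 * sinh r + sinh r - ε) / (2 * (sinh r + ε) ^ 3)) := by
    intro r hr
    have hs : 0 < sinh r := sinh_pos_iff.2 hr
    have hd := hθ.differentiable.differentiableAt.hasDerivAt (x := r)
    have d1 := hasDerivAt_sinh r
    have d2 := hasDerivAt_cosh r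
    have den1 : HasDerivAt (fun r => 2 * (sinh r + ε) ^ 1) (2 * cosh r) r := by
      simpa using (d1.add_const ε).const_mul 2
    have den2 : HasDerivAt (fun r => 2 * (sinh r + ε) ^ 2) (2 * (2 * (sinh r + ε) * cosh r)) r := by
      simpa using ((d1.add_const ε).fun_pow 2).const_mul 2
    have num : HasDerivAt (fun r => 2 * sinh r ^ 2) (2 * (2 * sinh r * cosh r)) r := by
      simpa using (d1.fun_pow 2).const_mul 2
    refine ⟨?_, ?_, ?_⟩
    · rw [hwdef, (hd.fun_mul (num.fun_div den1 (by positivity))).deriv]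
      field_simp; ring
    · rw [hvdef, (hd.fun_mul ((d1.fun_mul d2).fun_div den1 (by positivity))).deriv]
      field_simp
    · rw [hJdef, (hd.fun_mul ((d1.fun_mul ((d1.mul_const ε).sub_const 1)).fun_div den2
        (by positivity))).deriv]
      field_simp; ring
  have hpt : ∀ t r, 0 < r → morawetzDensity 0 w v ψ ψ' t r
      + (J r * (ψ t r * deriv (ψ t) r) + deriv J r * (1 / 2 * ψ t r ^ 2))
      ≤ -(1 / 2) * (ω₁ r * (ψ' t r * ψ' t r) + ω₁ r * (deriv (ψ t) r * deriv (ψ t) r)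
        + ω₂ r * (ψ t r * ψ t r)) + C * energyDensity ψ ψ' t r := by
    intro t r hr
    have hs : 0 < sinh r := sinh_pos_iff.2 hr
    obtain ⟨e1, e2, e3⟩ := hderiv r hr
    have hQ := energyDensity_nonneg (ψ := ψ) (ψ' := ψ') (t := t) hr
    rcases lt_or_ge r 2 with hr2 | hr2
    · have hc4 : cosh r ≤ 4 := (cosh_le_cosh.2 (by
        rw [abs_of_pos hr, abs_of_pos two_pos]; exact hr2.le)).trans cosh_two_le
      have key := smoothing_pointwise (θ' := deriv θ r) (a := ψ' t r) (b := deriv (ψ t) r) hs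
        ((sinh_lt_cosh r).le.trans hc4) (one_le_cosh r) hc4 (by rw [cosh_sq]; ring) h0 h1 (hθ0 r)
        (sq_le_sinh_sq (ψ t r)) (two_mul_sq_le_mul_sinh (ψ t r))
      have e4 : morawetzDensity 0 w v ψ ψ' t r = ψ' t r ^ 2 * (v r - 1 / 2 * deriv w r)
          + deriv (ψ t) r ^ 2 * (w r * (cosh r / sinh r) - 1 / 2 * deriv w r - v r)
          + (v r * (cosh r / sinh r) - deriv v r) * (deriv (ψ t) r * ψ t r)
          - v r / sinh r ^ 2 * (ψ t r * (1 / 2 * sinh (2 * ψ t r)))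
          + (deriv w r / sinh r ^ 2 - 2 * w r * cosh r / sinh r ^ 3) * (1 / 2 * sinh (ψ t r) ^ 2) := by
        simp [morawetzDensity, potentialDrift, potential, harmonicMap_zero_left]
      have hw' : w r = θ r * (sinh r ^ 2 / (sinh r + ε)) := by rw [hwdef]; field_simp
      have hv' : v r = θ r * (sinh r * cosh r / (2 * (sinh r + ε))) := by rw [hvdef]; simp
      have hω : ω₁ r = θ r * (ε * sinh r / (sinh r + ε) ^ 2) := by rw [hω₁def]; field_simp
      have hω₂' : ω₂ r = θ r * (1 / (sinh r * (sinh r + ε))) := by rw [hω₂def]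
      rw [e4, e1, e2, e3, hw', hv', hω]
      have hfin : 3 * |deriv θ r| * (sinh r / (sinh r + ε)) * energyDensity ψ ψ' t r
          ≤ C * energyDensity ψ ψ' t r := by
        refine mul_le_mul_of_nonneg_right ?_ hQ
        have a1 : |deriv θ r| * (sinh r / (sinh r + ε)) ≤ δ / ε + K := by
          calc _ ≤ (δ / sinh r + K) * (sinh r / (sinh r + ε)) := by
                gcongr; exact hθd r hr hr2
            _ = δ / (sinh r + ε) + K * (sinh r / (sinh r + ε)) := by field_simp
            _ ≤ δ / ε + K * 1 := by
                gcongr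
                · linarith
                · rw [div_le_one (by positivity)]; linarith
            _ = _ := by ring
        rw [hC]; linarith
      refine key.trans (le_of_eq_of_le ?_ (add_le_add le_rfl hfin))
      rw [energyDensity, hω₂']
      ring
    · have z1 : θ r = 0 := hθ2 r hr2
      have z2 : deriv θ r = 0 := hθd2 r hr2
      have w0 : w r = 0 := by rw [hwdef]; simp [z1]
      have v0 : v r = 0 := by rw [hvdef]; simp [z1]
      have J0 : J r = 0 := by rw [hJdef]; simp [z1]
      have o1 : ω₁ r = 0 := by rw [hω₁def]; simp [z1]
      have o2 : ω₂ r = 0 := by rw [hω₂def]; simp [z1]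
      rw [z1, z2, zero_mul, zero_mul, add_zero] at e1 e2 e3
      rw [morawetzDensity, e1, e2, e3, w0, v0, J0, o1, o2]
      simp only [mul_zero, zero_mul, sub_zero, add_zero, zero_div]
      positivity
  set g' : ℝ → ℝ := fun t => ∫ r, morawetzDensity 0 w v ψ ψ' t r with hg'
  set I : ℝ → ℝ := fun t => (∫ r, ω₁ r * (ψ' t r * ψ' t r)) + ∫ r, ω₂ r * (ψ t r * ψ t r) with hI
  have cI : ContinuousOn I (Ici 0) := (h.contL2Loc_velocity.continuousOn_integral_sq hω₁).add
    (h.contL2Loc_self.continuousOn_integral_sq hω₂)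
  have cE := h.continuousOn_twiceEnergy
  have hslope : ∀ t, 0 ≤ t → g' t ≤ -(1 / 2) * I t + C * twiceEnergy ψ ψ' t := by
    intro t ht
    obtain ⟨im, -⟩ := h.morawetz_identity (lam' := 0) le_rfl one_pos hw hv ht
    obtain ⟨iJ, eJ⟩ := h.integral_add_half_sq hJ ht
    have i1 := h.contL2Loc_velocity.integrable_mul_mul h.contL2Loc_velocity hω₁ ht ht
    have i2 := h.contL2Loc_deriv.integrable_mul_mul h.contL2Loc_deriv hω₁ ht ht
    have i3 := h.contL2Loc_self.integrable_mul_mul h.contL2Loc_self hω₂ ht ht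
    have hle : ∫ r, (morawetzDensity 0 w v ψ ψ' t r + (J r * (ψ t r * deriv (ψ t) r)
        + deriv J r * (1 / 2 * ψ t r ^ 2)))
        ≤ (∫ r, -(1 / 2) * (ω₁ r * (ψ' t r * ψ' t r) + ω₁ r * (deriv (ψ t) r * deriv (ψ t) r)
          + ω₂ r * (ψ t r * ψ t r))) + C * twiceEnergy ψ ψ' t :=
      h.integral_le ht (im.add iJ) (((i1.add i2).add i3).const_mul (-(1 / 2)))
      (fun r hr => by
        simp [morawetzDensity, hw.eq_zero hr, hv.eq_zero hr, hw.deriv.eq_zero hr,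
          hv.deriv.eq_zero hr, hJ.eq_zero hr, hJ.deriv.eq_zero hr, hω₁.eq_zero hr, hω₂.eq_zero hr])
      ((ae_restrict_mem measurableSet_Ioi).mono fun r hr => hpt t r hr)
    have s1 : ∫ r, (morawetzDensity 0 w v ψ ψ' t r + (J r * (ψ t r * deriv (ψ t) r)
        + deriv J r * (1 / 2 * ψ t r ^ 2))) = g' t := by
      rw [integral_add im iJ, eJ, add_zero]
    have s2 : ∫ r, -(1 / 2) * (ω₁ r * (ψ' t r * ψ' t r)
        + ω₁ r * (deriv (ψ t) r * deriv (ψ t) r) + ω₂ r * (ψ t r * ψ t r))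
        = -(1 / 2) * (I t + ∫ r, ω₁ r * (deriv (ψ t) r * deriv (ψ t) r)) := by
      rw [integral_const_mul, integral_add (by exact i1.add i2) i3, integral_add i1 i2, hI]
      ring
    rw [s1, s2] at hle
    -- The gain in ψ_r² is discarded.
    have : 0 ≤ ∫ r, ω₁ r * (deriv (ψ t) r * deriv (ψ t) r) := by
      refine integral_nonneg fun r => ?_
      rcases le_or_gt r 0 with hr | hr
      · simp [hω₁.eq_zero hr]
      · have hs : 0 < sinh r := sinh_pos_iff.2 hr
        have := hθ0 r
        have : 0 ≤ ω₁ r := by rw [hω₁def]; positivity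
        exact mul_nonneg this (mul_self_nonneg _)
    linarith
  have hM : ∀ t, 0 ≤ t → |(∫ r, w r * (ψ' t r * (deriv (ψ t) r - sinh (harmonicMap 0 r) / sinh r)))
      + ∫ r, v r * (ψ' t r * (ψ t r - harmonicMap 0 r))| ≤ 2 * twiceEnergy ψ ψ' t := by
    intro t ht
    have b1 := h.abs_integral_le (C := 1 / 2) ht
      (k := fun r => w r * (ψ' t r * (deriv (ψ t) r - sinh (harmonicMap 0 r) / sinh r)))
      (fun r hr => by simp [hw.eq_zero hr]) (fun r hr => by
        have hs : 0 < sinh r := sinh_pos_iff.2 hr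
        have hw1 : |w r| ≤ sinh r := by
          have : 0 ≤ w r := by have := hθ0 r; rw [hwdef]; positivity
          rw [abs_of_nonneg this]
          calc w r = θ r * (2 * sinh r ^ 2 / (2 * (sinh r + ε) ^ 1)) := by rw [hwdef]
            _ ≤ 1 * (2 * sinh r ^ 2 / (2 * (sinh r + ε) ^ 1)) := by gcongr; exact hθ1 r
            _ ≤ sinh r := by
              rw [one_mul, pow_one, div_le_iff₀ (by positivity)]; nlinarith
        simp only [harmonicMap_zero_left, sinh_zero, zero_div, sub_zero]
        rw [abs_mul, energyDensity]
        have : 0 ≤ sinh (ψ t r) ^ 2 / sinh r := by positivity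
        have h2 : |ψ' t r * deriv (ψ t) r| ≤ 1 / 2 * (ψ' t r ^ 2 + deriv (ψ t) r ^ 2) := by
          simpa using abs_mul_le_of_pos (x := ψ' t r) (y := deriv (ψ t) r) one_pos
        calc _ ≤ sinh r * (1 / 2 * (ψ' t r ^ 2 + deriv (ψ t) r ^ 2)) := by gcongr
          _ ≤ _ := by linarith)
    have b2 := h.abs_integral_le (C := 1) ht
      (k := fun r => v r * (ψ' t r * (ψ t r - harmonicMap 0 r)))
      (fun r hr => by simp [hv.eq_zero hr]) (fun r hr => by
        have hs : 0 < sinh r := sinh_pos_iff.2 hr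
        have hc := cosh_pos r
        have hv1 : |v r| ≤ 2 := by
          have : 0 ≤ v r := by have := hθ0 r; rw [hvdef]; positivity
          rw [abs_of_nonneg this]
          rcases lt_or_ge r 2 with hr2 | hr2
          · have hc4 : cosh r ≤ 4 := (cosh_le_cosh.2 (by
              rw [abs_of_pos hr, abs_of_pos two_pos]; exact hr2.le)).trans cosh_two_le
            calc v r = θ r * (sinh r * cosh r / (2 * (sinh r + ε) ^ 1)) := by rw [hvdef]
              _ ≤ 1 * (sinh r * cosh r / (2 * (sinh r + ε) ^ 1)) := by gcongr; exact hθ1 r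
              _ ≤ 2 := by
                rw [one_mul, pow_one, div_le_iff₀ (by positivity)]; nlinarith
          · rw [hvdef]; simp [hθ2 r hr2]
        simp only [harmonicMap_zero_left, sub_zero]
        rw [abs_mul, energyDensity]
        have h3 : 0 ≤ deriv (ψ t) r ^ 2 * sinh r := by positivity
        have h4 : ψ t r ^ 2 / sinh r ≤ sinh (ψ t r) ^ 2 / sinh r := by
          gcongr ?_ / _; exact sq_le_sinh_sq _
        calc _ ≤ 2 * (1 / 2 * (ψ' t r ^ 2 * sinh r + ψ t r ^ 2 / sinh r)) := by
              gcongr; exact abs_mul_le_of_pos hs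
          _ ≤ _ := by linarith)
    have hE := twiceEnergy_nonneg (ψ := ψ) (ψ' := ψ') t
    calc _ ≤ _ := abs_add_le _ _
      _ ≤ 1 / 2 * twiceEnergy ψ ψ' t + 1 * twiceEnergy ψ ψ' t := add_le_add b1 b2
      _ ≤ _ := by linarith
  have hfin := sub_le_integral_of_hasDerivWithinAt hT
    (fun t ht => (h.morawetz_identity (lam' := 0) le_rfl one_pos hw hv ht).2)
    (φ := fun t => -(1 / 2) * I t + C * twiceEnergy ψ ψ' t)
    ((cI.const_mul _).add (cE.const_mul _)) hslope
  have hsub : uIcc 0 T ⊆ Ici 0 := by rw [uIcc_of_le hT]; exact fun x hx => hx.1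
  have hIi : IntervalIntegrable I volume 0 T := (cI.mono hsub).intervalIntegrable
  have hEi : IntervalIntegrable (twiceEnergy ψ ψ') volume 0 T := (cE.mono hsub).intervalIntegrable
  rw [intervalIntegral.integral_add (hIi.const_mul _) (hEi.const_mul _), intervalIntegral.integral_const_mul,
    intervalIntegral.integral_const_mul] at hfin
  have hEint : ∫ t in 0..T, twiceEnergy ψ ψ' t ≤ B * T := by
    have := intervalIntegral.integral_mono_on hT hEi
      (intervalIntegrable_const (c := B)) (fun t ht => hB t ht)
    simpa [mul_comm] using this
  have m1 := abs_le.1 (hM T hT)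
  have m2 := abs_le.1 (hM 0 le_rfl)
  have m3 := hB T ⟨hT, le_rfl⟩
  have m4 := hB 0 ⟨le_rfl, hT⟩
  have m5 : C * ∫ t in 0..T, twiceEnergy ψ ψ' t ≤ C * (B * T) := by gcongr
  -- The functional is at most 2 B at each end; the factor 1/2 in front of the gain doubles
  -- everything.
  have m6 : ∫ t in 0..T, I t ≤ 8 * B + 2 * (C * (B * T)) := by linarith
  refine m6.trans_eq ?_
  rw [hC]; ring

end IsFiniteEnergyWaveMap

/-! ### Time averages -/

/-- Cauchy–Schwarz, from the nonnegativity of the variance of a about its mean m. -/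
theorem sq_integral_le {a : ℝ → ℝ} {t ε : ℝ} (hε : 0 ≤ ε) (ha : ContinuousOn a (Icc t (t + ε))) :
    (∫ τ in t..(t + ε), a τ) ^ 2 ≤ ε * ∫ τ in t..(t + ε), a τ ^ 2 := by
  rcases hε.eq_or_lt with rfl | hε
  · simp
  have hu : uIcc t (t + ε) = Icc t (t + ε) := uIcc_of_le (by linarith)
  have i1 : IntervalIntegrable a volume t (t + ε) := by
    rw [← hu] at ha; exact ha.intervalIntegrable
  have i2 : IntervalIntegrable (fun τ => a τ ^ 2) volume t (t + ε) := by
    rw [← hu] at ha; exact (ha.pow 2).intervalIntegrable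
  set m := (∫ τ in t..(t + ε), a τ) / ε with hm
  have h1 : 0 ≤ ∫ τ in t..(t + ε), (a τ - m) ^ 2 :=
    intervalIntegral.integral_nonneg (by linarith) fun _ _ => sq_nonneg _
  have h2 : ∫ τ in t..(t + ε), (a τ - m) ^ 2
      = (∫ τ in t..(t + ε), a τ ^ 2) - 2 * m * (∫ τ in t..(t + ε), a τ) + ε * m ^ 2 := by
    have : (fun τ => (a τ - m) ^ 2) = fun τ => a τ ^ 2 - 2 * m * a τ + m ^ 2 := by ext; ring
    rw [this, intervalIntegral.integral_add (i2.sub (i1.const_mul _)) intervalIntegrable_const,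
      intervalIntegral.integral_sub i2 (i1.const_mul _), intervalIntegral.integral_const_mul,
      intervalIntegral.integral_const]
    simp
  have h3 : ∫ τ in t..(t + ε), a τ = ε * m := by rw [hm]; field_simp
  rw [h2, h3] at h1
  rw [h3]
  nlinarith

theorem integral_comp_max {Y : ℝ → ℝ} {a b : ℝ} (ha : 0 ≤ a) (hb : 0 ≤ b) :
    ∫ t in a..b, Y (max t 0) = ∫ t in a..b, Y t := by
  refine intervalIntegral.integral_congr fun t ht => ?_
  have : 0 ≤ t := le_trans (le_min ha hb) ht.1
  simp only [max_eq_left this]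

theorem continuous_comp_max {Y : ℝ → ℝ} (hY : ContinuousOn Y (Ici 0)) :
    Continuous fun t => Y (max t 0) :=
  hY.comp_continuous (by fun_prop) fun _ => mem_Ici.2 (le_max_right _ _)

theorem intervalIntegrable_of_continuousOn_Ici {Y : ℝ → ℝ} (hY : ContinuousOn Y (Ici 0)) {a b : ℝ}
    (ha : 0 ≤ a) (hb : 0 ≤ b) : IntervalIntegrable Y volume a b :=
  (hY.mono fun _ ht => mem_Ici.2 (le_trans (le_min ha hb) ht.1)).intervalIntegrable

theorem continuousOn_comp_add {Y : ℝ → ℝ} (hY : ContinuousOn Y (Ici 0)) {ε : ℝ} (hε : 0 ≤ ε) :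
    ContinuousOn (fun t => Y (t + ε)) (Ici 0) :=
  hY.comp (by fun_prop) fun _ ht => mem_Ici.2 (add_nonneg ht hε)

theorem continuousOn_average {Y : ℝ → ℝ} (hY : ContinuousOn Y (Ici 0)) {ε : ℝ} (hε : 0 ≤ ε) :
    ContinuousOn (fun t => ∫ τ in t..(t + ε), Y τ) (Ici 0) := by
  have hc := continuous_comp_max hY
  have hp : Continuous fun t => ∫ τ in 0..t, Y (max τ 0) :=
    intervalIntegral.continuous_primitive (fun a b => hc.intervalIntegrable a b) 0
  refine ((hp.comp (continuous_add_const ε)).sub hp).continuousOn.congr fun t ht => ?_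
  simp only [Pi.sub_apply, Function.comp_apply]
  rw [intervalIntegral.integral_interval_sub_left (hc.intervalIntegrable _ _)
    (hc.intervalIntegrable _ _), integral_comp_max ht (add_nonneg ht hε)]

/-- The integral of an increment telescopes to the two end intervals of length ε. -/
theorem integral_comp_add_sub {K : ℝ → ℝ} (hK : ContinuousOn K (Ici 0)) {T ε : ℝ} (hT : 0 ≤ T)
    (hε : 0 ≤ ε) : ∫ t in 0..T, (K (t + ε) - K t)
      = (∫ t in T..(T + ε), K t) - ∫ t in 0..(0 + ε), K t := by
  have hi : ∀ a b, 0 ≤ a → 0 ≤ b → IntervalIntegrable K volume a b :=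
    fun a b => intervalIntegrable_of_continuousOn_Ici hK
  rw [intervalIntegral.integral_sub
    (intervalIntegrable_of_continuousOn_Ici (continuousOn_comp_add hK hε) le_rfl hT)
    (hi _ _ le_rfl hT), intervalIntegral.integral_comp_add_right]
  have e1 := intervalIntegral.integral_add_adjacent_intervals
    (hi 0 (0 + ε) le_rfl (by linarith)) (hi (0 + ε) (T + ε) (by linarith) (by linarith))
  have e2 := intervalIntegral.integral_add_adjacent_intervals
    (hi 0 T le_rfl hT) (hi T (T + ε) hT (by linarith))
  linarith

/-- The average is an increment of the primitive, so telescoping and monotonicity of the primitive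
replace Fubini. -/
theorem integral_average_le {Y : ℝ → ℝ} (hY : ContinuousOn Y (Ici 0)) (hY0 : ∀ t, 0 ≤ t → 0 ≤ Y t)
    {T ε : ℝ} (hT : 0 ≤ T) (hε : 0 ≤ ε) :
    ∫ t in 0..T, (∫ τ in t..(t + ε), Y τ) ≤ ε * ∫ t in 0..(T + ε), Y t := by
  have hc := continuous_comp_max hY
  have hp : Continuous fun t => ∫ τ in 0..t, Y (max τ 0) :=
    intervalIntegral.continuous_primitive (fun a b => hc.intervalIntegrable a b) 0
  have hpos : ∀ a b, a ≤ b → 0 ≤ ∫ τ in a..b, Y (max τ 0) := fun a b hab =>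
    intervalIntegral.integral_nonneg hab fun t _ => hY0 _ (le_max_right _ _)
  have e : ∫ t in 0..T, (∫ τ in t..(t + ε), Y τ)
      = ∫ t in 0..T, ((∫ τ in 0..(t + ε), Y (max τ 0)) - ∫ τ in 0..t, Y (max τ 0)) := by
    refine intervalIntegral.integral_congr fun t ht => ?_
    rw [uIcc_of_le hT] at ht
    rw [intervalIntegral.integral_interval_sub_left (hc.intervalIntegrable _ _)
      (hc.intervalIntegrable _ _), integral_comp_max ht.1 (add_nonneg ht.1 hε)]
  rw [e, integral_comp_add_sub (K := fun t => ∫ τ in 0..t, Y (max τ 0)) hp.continuousOn hT hε,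
    ← integral_comp_max (Y := Y) le_rfl (by linarith : 0 ≤ T + ε)]
  have h1 : 0 ≤ ∫ t in 0..(0 + ε), ∫ τ in 0..t, Y (max τ 0) :=
    intervalIntegral.integral_nonneg (by linarith) fun t ht => hpos _ _ ht.1
  have h2 : ∫ t in T..(T + ε), ∫ τ in 0..t, Y (max τ 0)
      ≤ ∫ t in T..(T + ε), ∫ τ in 0..(T + ε), Y (max τ 0) := by
    refine intervalIntegral.integral_mono_on (by linarith) (hp.intervalIntegrable _ _)
      intervalIntegrable_const fun t ht => ?_
    rw [← intervalIntegral.integral_add_adjacent_intervals (hc.intervalIntegrable 0 t)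
      (hc.intervalIntegrable t (T + ε))]
    linarith [hpos t (T + ε) ht.2]
  rw [intervalIntegral.integral_const, add_sub_cancel_left, smul_eq_mul] at h2
  linarith

theorem integral_comp_add_le {Y : ℝ → ℝ} (hY : ContinuousOn Y (Ici 0)) (hY0 : ∀ t, 0 ≤ t → 0 ≤ Y t)
    {T ε : ℝ} (hT : 0 ≤ T) (hε : 0 ≤ ε) :
    ∫ t in 0..T, Y (t + ε) ≤ ∫ t in 0..(T + ε), Y t := by
  rw [intervalIntegral.integral_comp_add_right,
    ← intervalIntegral.integral_add_adjacent_intervals (b := 0 + ε)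
      (intervalIntegrable_of_continuousOn_Ici hY le_rfl (by linarith))
      (intervalIntegrable_of_continuousOn_Ici hY (by linarith) (by linarith))]
  have : 0 ≤ ∫ t in 0..(0 + ε), Y t :=
    intervalIntegral.integral_nonneg (by linarith) fun t ht => hY0 t ht.1
  linarith

theorem integral_le_integral_add {Y : ℝ → ℝ} (hY : ContinuousOn Y (Ici 0))
    (hY0 : ∀ t, 0 ≤ t → 0 ≤ Y t) {T S : ℝ} (hT : 0 ≤ T) (hS : T ≤ S) :
    ∫ t in 0..T, Y t ≤ ∫ t in 0..S, Y t := by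
  rw [← intervalIntegral.integral_add_adjacent_intervals (b := T) (c := S)
      (intervalIntegrable_of_continuousOn_Ici hY le_rfl hT)
      (intervalIntegrable_of_continuousOn_Ici hY hT (hT.trans hS))]
  have : 0 ≤ ∫ t in T..S, Y t :=
    intervalIntegral.integral_nonneg hS fun t ht => hY0 t (hT.trans ht.1)
  linarith

/-! ### Time differences -/

namespace IsFiniteEnergyWaveMap

variable {lam : ℝ} {ψ ψ' : ℝ → ℝ → ℝ}

theorem weakWave_self (h : IsFiniteEnergyWaveMap lam ψ ψ') :
    WeakWave ψ ψ' (fun t => deriv (ψ t)) (source 0 ψ) := by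
  simpa [harmonicMap_zero_left] using h.weakWave le_rfl one_pos

theorem contL2Loc_sub (h : IsFiniteEnergyWaveMap lam ψ ψ') {ε : ℝ} (hε : 0 ≤ ε) :
    ContL2Loc fun t r => ψ (t + ε) r - ψ t r :=
  (h.contL2Loc_self.comp_add hε).sub h.contL2Loc_self

/-- w ψ is differentiable as a curve in L² with derivative w ψ_t; the fundamental theorem and
Cauchy–Schwarz in time give the factor ε. -/
theorem integral_sq_sub_le (h : IsFiniteEnergyWaveMap lam ψ ψ') {w : ℝ → ℝ} (hw : IsTestFunction w)
    {t ε : ℝ} (ht : 0 ≤ t) (hε : 0 ≤ ε) :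
    ∫ r, (w r * w r) * ((ψ (t + ε) r - ψ t r) * (ψ (t + ε) r - ψ t r))
      ≤ ε * ∫ τ in t..(t + ε), ∫ r, (w r * w r) * (ψ' τ r * ψ' τ r) := by
  have hΔ := h.contL2Loc_sub hε
  have hψ := h.contL2Loc_self
  have hsub : uIcc t (t + ε) ⊆ Ici 0 := fun x hx => by
    rw [uIcc_of_le (by linarith)] at hx; exact ht.trans hx.1
  have hcont := (h.contL2Loc_velocity.continuousOn_lift hw).mono hsub
  have e1 : lift w (fun t r => ψ (t + ε) r - ψ t r) t = lift w ψ (t + ε) - lift w ψ t := by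
    rw [hΔ.lift_eq hw ht, hψ.lift_eq hw ht, hψ.lift_eq hw (add_nonneg ht hε), ← MemLp.toLp_sub]
    refine MemLp.toLp_congr _ _ (Eventually.of_forall fun r => ?_)
    simp only [Pi.sub_apply]; ring
  have e2 : lift w ψ (t + ε) - lift w ψ t = ∫ τ in t..(t + ε), lift w ψ' τ := by
    refine (intervalIntegral.integral_eq_sub_of_hasDeriv_right
      ((hψ.continuousOn_lift hw).mono hsub) (fun τ hτ => ?_) hcont.intervalIntegrable).symm
    rw [min_eq_left (by linarith), max_eq_right (by linarith)] at hτ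
    have hτ0 : 0 ≤ τ := ht.trans hτ.1.le
    exact (h.weakWave_self.hasDerivWithinAt_lift hw hτ0).mono fun x hx => hτ0.trans (le_of_lt hx)
  rw [← hΔ.inner_lift hΔ hw hw ht ht, real_inner_self_eq_norm_sq, e1, e2]
  have h3 : ‖∫ τ in t..(t + ε), lift w ψ' τ‖ ≤ ∫ τ in t..(t + ε), ‖lift w ψ' τ‖ :=
    intervalIntegral.norm_integral_le_integral_norm (by linarith)
  have h4 := sq_integral_le hε (a := fun τ => ‖lift w ψ' τ‖) (t := t)
    (by rw [uIcc_of_le (by linarith)] at hcont; exact hcont.norm)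
  have h5 : ∫ τ in t..(t + ε), ‖lift w ψ' τ‖ ^ 2
      = ∫ τ in t..(t + ε), ∫ r, (w r * w r) * (ψ' τ r * ψ' τ r) := by
    refine intervalIntegral.integral_congr fun τ hτ => ?_
    rw [← real_inner_self_eq_norm_sq, h.contL2Loc_velocity.inner_lift h.contL2Loc_velocity hw hw
      (hsub hτ) (hsub hτ)]
  rw [← h5]
  exact (pow_le_pow_left₀ (norm_nonneg _) h3 2).trans h4

end IsFiniteEnergyWaveMap

/-! ### Time differences near the origin -/

/-- A cutoff to `r ≤ 2` that equals `cutoff N` for `r ≤ 1`. -/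
noncomputable def innerCutoff (N r : ℝ) : ℝ := cutoff N r * smoothTransition (2 - r)

theorem isTestFunction_innerCutoff {N : ℝ} (hN : 0 < N) : IsTestFunction (innerCutoff N) :=
  (isTestFunction_cutoff hN).mul_contDiffOn
    (smoothTransition.contDiff.comp (contDiff_const.sub contDiff_id)).contDiffOn

theorem innerCutoff_nonneg (N r : ℝ) : 0 ≤ innerCutoff N r :=
  mul_nonneg (cutoff_nonneg _ _) (smoothTransition.nonneg _)

theorem innerCutoff_le_one (N r : ℝ) : innerCutoff N r ≤ 1 :=
  mul_le_one₀ (cutoff_le_one _ _) (smoothTransition.nonneg _) (smoothTransition.le_one _)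

theorem innerCutoff_of_le_one (N : ℝ) {r : ℝ} (hr : r ≤ 1) : innerCutoff N r = cutoff N r := by
  rw [innerCutoff, smoothTransition.one_of_one_le (by linarith), mul_one]

theorem innerCutoff_of_two_le (N : ℝ) {r : ℝ} (hr : 2 ≤ r) : innerCutoff N r = 0 := by
  rw [innerCutoff, smoothTransition.zero_of_nonpos (by linarith), mul_zero]

/-- The logarithmic cutoff contributes a multiple of coth r / N, with cosh r ≤ 4 on r < 2; the fixed
outer cutoff contributes a constant. -/
theorem exists_deriv_innerCutoff_bound : ∃ K : ℝ, 0 ≤ K ∧ ∀ N : ℝ, 0 < N → ∀ r : ℝ, 0 < r → r < 2 →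
    |deriv (innerCutoff N) r| ≤ K / N / sinh r + K := by
  obtain ⟨K₁, hK₁, h1⟩ := exists_deriv_cutoff_bound
  obtain ⟨K₂, hK₂, h2⟩ := exists_deriv_smoothTransition_bound
  refine ⟨4 * K₁ + K₂, by positivity, fun N hN r hr hr2 => ?_⟩
  have hs : 0 < sinh r := sinh_pos_iff.2 hr
  have hc4 : cosh r ≤ 4 := (cosh_le_cosh.2 (by
    rw [abs_of_pos hr, abs_of_pos two_pos]; exact hr2.le)).trans cosh_two_le
  have hd := (isTestFunction_cutoff hN).differentiable.differentiableAt.hasDerivAt (x := r)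
  have hst : HasDerivAt (fun r => smoothTransition (2 - r)) (deriv smoothTransition (2 - r) * -1) r :=
    HasDerivAt.comp r (((smoothTransition.contDiff (n := 1)).differentiable
      (by simp)).differentiableAt.hasDerivAt) ((hasDerivAt_id r).const_sub 2)
  have e : deriv (innerCutoff N) r = deriv (cutoff N) r * smoothTransition (2 - r)
      + cutoff N r * (deriv smoothTransition (2 - r) * -1) := (hd.mul hst).deriv
  rw [e]
  have a1 : |deriv (cutoff N) r * smoothTransition (2 - r)| ≤ 4 * K₁ / N / sinh r := by
    rw [abs_mul, abs_of_nonneg (smoothTransition.nonneg _)]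
    calc _ ≤ K₁ / N * (cosh r / sinh r) * 1 := by
          gcongr
          · exact smoothTransition.nonneg _
          · exact h1 N hN r hr
          · exact smoothTransition.le_one _
      _ ≤ K₁ / N * (4 / sinh r) * 1 := by gcongr
      _ = _ := by field_simp
  have a2 : |cutoff N r * (deriv smoothTransition (2 - r) * -1)| ≤ K₂ := by
    rw [abs_mul, abs_of_nonneg (cutoff_nonneg _ _), abs_mul, abs_neg, abs_one, mul_one]
    calc _ ≤ 1 * K₂ := by
          gcongr
          · exact cutoff_le_one _ _
          · exact h2 _
      _ = _ := one_mul _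
  have a3 : 4 * K₁ / N / sinh r ≤ (4 * K₁ + K₂) / N / sinh r := by gcongr; linarith
  calc _ ≤ _ := abs_add_le _ _
    _ ≤ 4 * K₁ / N / sinh r + K₂ := add_le_add a1 a2
    _ ≤ _ := by linarith

/-- 1 / s = s / (s + e)² + e (2 s + e) / (s (s + e)²). The first part is to be paired with ψ_t², the
second is at most 2 e / (s (s + e)) and is paired with ψ². The alternatives in the last hypothesis
correspond to r ≤ 1 and r > 1, where 1 / s ≤ s suffices. -/
theorem sq_sub_pointwise {s e c θ p q w₁ w₂ : ℝ} (hs : 0 < s) (he : 0 < e) (hθ : 0 ≤ θ)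
    (hw₂ : w₂ = θ * (s / (s + e) ^ 2)) (hw₁ : 0 ≤ w₁)
    (h : c = θ ∨ (1 ≤ s ∧ 0 ≤ c ∧ w₁ = c * s)) :
    c * s⁻¹ * ((p - q) * (p - q)) ≤ w₁ * ((p - q) * (p - q)) + w₂ * ((p - q) * (p - q))
      + 4 * e * (θ * (1 / (s * (s + e))) * (p * p) + θ * (1 / (s * (s + e))) * (q * q)) := by
  have hD : 0 ≤ (p - q) * (p - q) := mul_self_nonneg _
  have hz : 0 ≤ 4 * e * (θ * (1 / (s * (s + e))) * (p * p) + θ * (1 / (s * (s + e))) * (q * q)) := by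
    have := mul_self_nonneg p
    have := mul_self_nonneg q
    positivity
  have hw₂0 : 0 ≤ w₂ := by rw [hw₂]; positivity
  rcases h with rfl | ⟨h1, hc, rfl⟩
  · have e1 : c * s⁻¹ * ((p - q) * (p - q)) = w₂ * ((p - q) * (p - q))
        + e * (c * ((2 * s + e) / (s * (s + e) ^ 2))) * ((p - q) * (p - q)) := by
      rw [hw₂]; field_simp; ring
    have e2 : (2 * s + e) / (s * (s + e) ^ 2) ≤ 2 * (1 / (s * (s + e))) := by
      rw [mul_one_div, div_le_div_iff₀ (by positivity) (by positivity)]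
      have : 0 ≤ s * (s + e) * e := by positivity
      nlinarith
    have e3 : e * (c * ((2 * s + e) / (s * (s + e) ^ 2))) * ((p - q) * (p - q))
        ≤ e * (c * (2 * (1 / (s * (s + e))))) * (2 * (p * p + q * q)) := by
      refine mul_le_mul (by gcongr) ?_ hD (by positivity)
      nlinarith [sq_nonneg (p + q)]
    have e4 : 0 ≤ w₁ * ((p - q) * (p - q)) := by positivity
    rw [e1]
    linarith
  · have e1 : c * s⁻¹ ≤ c * s := by
      gcongr
      exact (inv_le_one_of_one_le₀ h1).trans h1
    have e2 : c * s⁻¹ * ((p - q) * (p - q)) ≤ c * s * ((p - q) * (p - q)) := by gcongr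
    have e3 : 0 ≤ w₂ * ((p - q) * (p - q)) := by positivity
    linarith

namespace IsFiniteEnergyWaveMap

variable {lam : ℝ} {ψ ψ' : ℝ → ℝ → ℝ}

theorem integral_test_sq_velocity_le (h : IsFiniteEnergyWaveMap lam ψ ψ') {w : ℝ → ℝ}
    (hw0 : ∀ r, r ≤ 0 → w r = 0) (hw1 : ∀ r, 0 < r → 0 ≤ w r ∧ w r ≤ sinh r) {t : ℝ} (ht : 0 ≤ t) :
    ∫ r, w r * (ψ' t r * ψ' t r) ≤ twiceEnergy ψ ψ' t := by
  have := h.abs_integral_le (C := 1) ht (k := fun r => w r * (ψ' t r * ψ' t r))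
    (fun r hr => by simp [hw0 r hr]) (fun r hr => by
      have hs : 0 < sinh r := sinh_pos_iff.2 hr
      obtain ⟨a, b⟩ := hw1 r hr
      have h1 : 0 ≤ sinh (ψ t r) ^ 2 / sinh r := by positivity
      have h2 : 0 ≤ deriv (ψ t) r ^ 2 * sinh r := by positivity
      have h3 := mul_self_nonneg (ψ' t r)
      rw [abs_of_nonneg (mul_nonneg a h3), energyDensity]
      nlinarith)
  linarith [le_abs_self (∫ r, w r * (ψ' t r * ψ' t r))]

/-- Time differences are small near the origin on average. -/
theorem exists_integral_sq_sub_le (h : IsFiniteEnergyWaveMap lam ψ ψ') {T : ℝ} (hT : 0 ≤ T) :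
    ∃ A, 0 ≤ A ∧ ∀ ε, 0 < ε → ε ≤ 1 / 2 → ∃ A', 0 ≤ A' ∧ ∀ n : ℕ,
      ∫ t in 0..T, (∫ r, cutoff (n + 1) r ^ 2 * (sinh r)⁻¹
          * ((ψ (t + ε) r - ψ t r) * (ψ (t + ε) r - ψ t r)))
        ≤ ε * (A + A' / (n + 1)) := by
  obtain ⟨K, hK, hKb⟩ := exists_deriv_innerCutoff_bound
  -- One more unit of time covers the translates by ε ≤ 1/2. B comes from continuity on a compact
  -- time interval, so no monotonicity of the energy is used.
  obtain ⟨B, hB0, hB⟩ := h.exists_twiceEnergy_le (T + 1)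
  -- A does not depend on ε. A' carries the cutoff cost δ / ε with δ = 2 K / (n + 1); it blows up as
  -- ε → 0, but n → ∞ is taken first.
  refine ⟨B * T + 8 * (8 * B + 6 * (2 * K) * (B * (T + 1))), by positivity, fun ε h0 h1 =>
    ⟨8 * (6 * (2 * K / ε) * (B * (T + 1))), by positivity, fun n => ?_⟩⟩
  have hN : (0 : ℝ) < n + 1 := by positivity
  have hη := isTestFunction_cutoff hN
  have hχ := isTestFunction_innerCutoff hN
  have hT1 : 0 ≤ T + 1 := by linarith
  set η := cutoff (n + 1) with hηdef
  set χ := innerCutoff (n + 1) with hχdef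
  have hsq : ContDiffOn ℝ (⊤ : ℕ∞) (fun r => √(sinh r)) (Ioi 0) :=
    contDiff_sinh.contDiffOn.sqrt fun r hr => (sinh_pos_iff.2 hr).ne'
  have hsq2 : ContDiffOn ℝ (⊤ : ℕ∞) (fun r => √(sinh r) / (sinh r + ε)) (Ioi 0) :=
    hsq.div (contDiff_sinh.add contDiff_const).contDiffOn fun r hr => by
      have := sinh_pos_iff.2 (mem_Ioi.1 hr)
      positivity
  have hse : ContDiff ℝ (⊤ : ℕ∞) fun r => 2 * ε * sinh r := contDiff_const.mul contDiff_sinh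
  have hθ : IsTestFunction fun r => χ r * χ r := hχ.mul hχ
  have hw₁ := hη.mul_contDiffOn hsq
  have hw₂ := hχ.mul_contDiffOn hsq2
  have hω₁ := hθ.mul_contDiffOn (contDiffOn_smoothingWeight h0 hse 2)
  have hω₂ := hθ.mul_contDiffOn (contDiffOn_smoothingWeight_div h0)
  have hη2 : IsTestFunction fun r => η r ^ 2 * (sinh r)⁻¹ := by
    simpa [sq] using (hη.mul hη).mul_inv_sinh
  have hχ0 : ∀ r, 0 ≤ χ r := innerCutoff_nonneg _
  have hχ1 : ∀ r, χ r ≤ 1 := innerCutoff_le_one _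
  have hη0 : ∀ r, 0 ≤ η r := cutoff_nonneg _
  have hη1 : ∀ r, η r ≤ 1 := cutoff_le_one _
  have hsm := h.local_smoothing hθ (fun r => mul_self_nonneg _)
    (fun r => mul_le_one₀ (hχ1 r) (hχ0 r) (hχ1 r))
    (fun r hr => by rw [hχdef, innerCutoff_of_two_le _ hr, mul_zero])
    (δ := 2 * K / (n + 1)) (K := 2 * K) (by positivity) (by positivity)
    (fun r hr hr2 => by
      rw [(hχ.differentiable.differentiableAt.hasDerivAt.fun_mul
        hχ.differentiable.differentiableAt.hasDerivAt).deriv]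
      have a1 := hKb (n + 1) hN r hr hr2
      rw [← hχdef] at a1
      calc _ = 2 * (|deriv χ r| * χ r) := by
            rw [show deriv χ r * χ r + χ r * deriv χ r = 2 * (deriv χ r * χ r) by ring, abs_mul,
              abs_two, abs_mul, abs_of_nonneg (hχ0 r)]
        _ ≤ 2 * (|deriv χ r| * 1) := by gcongr; exact hχ1 r
        _ ≤ 2 * (K / (n + 1) / sinh r + K) := by linarith
        _ = _ := by ring)
    hT1 hB h0 h1
  have hv := h.contL2Loc_velocity
  have hψ := h.contL2Loc_self
  have hΔ := h.contL2Loc_sub h0.le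
  set Y₁ : ℝ → ℝ := fun t => ∫ r, (η r * √(sinh r)) * (η r * √(sinh r)) * (ψ' t r * ψ' t r) with hY₁
  set Y₂ : ℝ → ℝ := fun t => ∫ r, (χ r * (√(sinh r) / (sinh r + ε)))
    * (χ r * (√(sinh r) / (sinh r + ε))) * (ψ' t r * ψ' t r) with hY₂
  set Z₁ : ℝ → ℝ := fun t => ∫ r, χ r * χ r * (2 * ε * sinh r / (2 * (sinh r + ε) ^ 2))
    * (ψ' t r * ψ' t r) with hZ₁
  set Z₂ : ℝ → ℝ := fun t => ∫ r, χ r * χ r * (1 / (sinh r * (sinh r + ε))) * (ψ t r * ψ t r) with hZ₂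
  have cY₁ : ContinuousOn Y₁ (Ici 0) := hv.continuousOn_integral_sq (hw₁.mul hw₁)
  have cY₂ : ContinuousOn Y₂ (Ici 0) := hv.continuousOn_integral_sq (hw₂.mul hw₂)
  have cZ₁ : ContinuousOn Z₁ (Ici 0) := hv.continuousOn_integral_sq hω₁
  have cZ₂ : ContinuousOn Z₂ (Ici 0) := hψ.continuousOn_integral_sq hω₂
  -- ε Y₂ is exactly the velocity density bounded by `local_smoothing`, so averaging Y₂ over a time
  -- ε leaves an O(1) quantity.
  have hYZ : ∀ t, ε * Y₂ t = Z₁ t := by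
    intro t
    rw [hY₂, hZ₁, ← integral_const_mul]
    refine integral_congr_ae (Eventually.of_forall fun r => ?_)
    rcases le_or_gt r 0 with hr | hr
    · simp [hχ.eq_zero hr]
    · have hs : 0 < sinh r := sinh_pos_iff.2 hr
      have := mul_self_sqrt hs.le
      have e : √(sinh r) / (sinh r + ε) * (√(sinh r) / (sinh r + ε)) = sinh r / (sinh r + ε) ^ 2 := by
        rw [div_mul_div_comm, this, sq]
      calc _ = ε * (χ r * χ r * (√(sinh r) / (sinh r + ε) * (√(sinh r) / (sinh r + ε)))
            * (ψ' t r * ψ' t r)) := by ring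
        _ = _ := by rw [e]; field_simp
  have pY₁ : ∀ t, 0 ≤ t → Y₁ t ≤ twiceEnergy ψ ψ' t := by
    intro t ht
    refine h.integral_test_sq_velocity_le (fun r hr => by simp [hη.eq_zero hr]) (fun r hr => ?_) ht
    have hs : 0 < sinh r := sinh_pos_iff.2 hr
    refine ⟨mul_self_nonneg _, ?_⟩
    calc _ = η r * η r * (√(sinh r) * √(sinh r)) := by ring
      _ ≤ 1 * (√(sinh r) * √(sinh r)) := by
        gcongr; exact mul_le_one₀ (hη1 r) (hη0 r) (hη1 r)
      _ = _ := by rw [mul_self_sqrt hs.le, one_mul]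
  have nY₂ : ∀ t, 0 ≤ t → 0 ≤ Y₂ t := fun t _ =>
    integral_nonneg fun r => mul_nonneg (mul_self_nonneg _) (mul_self_nonneg _)
  have nZ₂ : ∀ t, 0 ≤ t → 0 ≤ Z₂ t := fun t _ => by
    refine integral_nonneg fun r => ?_
    rcases le_or_gt r 0 with hr | hr
    · simp [hχ.eq_zero hr]
    · have hs : 0 < sinh r := sinh_pos_iff.2 hr
      exact mul_nonneg (mul_nonneg (mul_self_nonneg _) (by positivity)) (mul_self_nonneg _)
  have hslice : ∀ t, 0 ≤ t → ∫ r, η r ^ 2 * (sinh r)⁻¹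
      * ((ψ (t + ε) r - ψ t r) * (ψ (t + ε) r - ψ t r))
      ≤ ε * (∫ τ in t..(t + ε), Y₁ τ) + ε * (∫ τ in t..(t + ε), Y₂ τ)
        + 4 * ε * (Z₂ (t + ε) + Z₂ t) := by
    intro t ht
    have i0 := hΔ.integrable_mul_mul hΔ hη2 ht ht
    have i1 := hΔ.integrable_mul_mul hΔ (hw₁.mul hw₁) ht ht
    have i2 := hΔ.integrable_mul_mul hΔ (hw₂.mul hw₂) ht ht
    have i3 := hψ.integrable_mul_mul hψ hω₂ (add_nonneg ht h0.le) (add_nonneg ht h0.le)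
    have i4 := hψ.integrable_mul_mul hψ hω₂ ht ht
    have hpt : ∀ r, η r ^ 2 * (sinh r)⁻¹ * ((ψ (t + ε) r - ψ t r) * (ψ (t + ε) r - ψ t r))
        ≤ (η r * √(sinh r)) * (η r * √(sinh r)) * ((ψ (t + ε) r - ψ t r) * (ψ (t + ε) r - ψ t r))
          + (χ r * (√(sinh r) / (sinh r + ε))) * (χ r * (√(sinh r) / (sinh r + ε)))
            * ((ψ (t + ε) r - ψ t r) * (ψ (t + ε) r - ψ t r))
          + 4 * ε * (χ r * χ r * (1 / (sinh r * (sinh r + ε))) * (ψ (t + ε) r * ψ (t + ε) r)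
            + χ r * χ r * (1 / (sinh r * (sinh r + ε))) * (ψ t r * ψ t r)) := by
      intro r
      rcases le_or_gt r 0 with hr | hr
      · simp [hχ.eq_zero hr, hη.eq_zero hr]
      · have hs : 0 < sinh r := sinh_pos_iff.2 hr
        refine sq_sub_pointwise hs h0 (mul_self_nonneg _) ?_ (mul_self_nonneg _) ?_
        · calc _ = χ r * χ r * ((√(sinh r) * √(sinh r)) / (sinh r + ε) ^ 2) := by
                field_simp
            _ = _ := by rw [mul_self_sqrt hs.le]
        · rcases le_or_gt r 1 with hr1 | hr1
          · left; rw [hχdef, innerCutoff_of_le_one _ hr1, sq]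
          · right
            refine ⟨hr1.le.trans (self_le_sinh_iff.2 hr.le), sq_nonneg _, ?_⟩
            calc _ = η r ^ 2 * (√(sinh r) * √(sinh r)) := by ring
              _ = _ := by rw [mul_self_sqrt hs.le]
    have hle := integral_mono i0 ((i1.add i2).add ((i3.add i4).const_mul (4 * ε))) hpt
    rw [integral_add' (i1.add i2) ((i3.add i4).const_mul (4 * ε)), integral_add' i1 i2,
      integral_const_mul, integral_add' i3 i4] at hle
    have b1 := h.integral_sq_sub_le hw₁ ht h0.le
    have b2 := h.integral_sq_sub_le hw₂ ht h0.le
    linarith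
  have hcL : ContinuousOn (fun t => ∫ r, η r ^ 2 * (sinh r)⁻¹
      * ((ψ (t + ε) r - ψ t r) * (ψ (t + ε) r - ψ t r))) (Ici 0) := hΔ.continuousOn_integral_sq hη2
  have cA₁ := continuousOn_average cY₁ h0.le
  have cA₂ := continuousOn_average cY₂ h0.le
  have cZs := continuousOn_comp_add cZ₂ h0.le
  have ii : ∀ {f : ℝ → ℝ}, ContinuousOn f (Ici 0) → IntervalIntegrable f volume 0 T :=
    fun hf => intervalIntegrable_of_continuousOn_Ici hf le_rfl hT
  have hmain : ∫ t in 0..T, (∫ r, η r ^ 2 * (sinh r)⁻¹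
      * ((ψ (t + ε) r - ψ t r) * (ψ (t + ε) r - ψ t r)))
      ≤ ∫ t in 0..T, (ε * (∫ τ in t..(t + ε), Y₁ τ) + ε * (∫ τ in t..(t + ε), Y₂ τ)
        + 4 * ε * (Z₂ (t + ε) + Z₂ t)) :=
    intervalIntegral.integral_mono_on hT (ii hcL)
      ((((ii cA₁).const_mul ε).add ((ii cA₂).const_mul ε)).add
        (((ii cZs).add (ii cZ₂)).const_mul (4 * ε))) (fun t ht => hslice t ht.1)
  rw [intervalIntegral.integral_add (((ii cA₁).const_mul ε).add ((ii cA₂).const_mul ε))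
      (((ii cZs).add (ii cZ₂)).const_mul (4 * ε)),
    intervalIntegral.integral_add ((ii cA₁).const_mul ε) ((ii cA₂).const_mul ε),
    intervalIntegral.integral_const_mul, intervalIntegral.integral_const_mul,
    intervalIntegral.integral_const_mul, intervalIntegral.integral_add (ii cZs) (ii cZ₂)] at hmain
  have q1 : ∫ t in 0..T, (∫ τ in t..(t + ε), Y₁ τ) ≤ B * T := by
    have : ∀ t ∈ Icc 0 T, ∫ τ in t..(t + ε), Y₁ τ ≤ B := by
      intro t ht
      have := intervalIntegral.integral_mono_on (μ := volume) (by linarith : t ≤ t + ε)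
        (intervalIntegrable_of_continuousOn_Ici cY₁ ht.1 (by linarith [ht.1]))
        (intervalIntegrable_const (c := B)) (fun τ hτ => (pY₁ τ (ht.1.trans hτ.1)).trans
          (hB τ ⟨ht.1.trans hτ.1, by linarith [hτ.2, ht.2]⟩))
      rw [intervalIntegral.integral_const, add_sub_cancel_left, smul_eq_mul] at this
      nlinarith
    have := intervalIntegral.integral_mono_on hT (ii cA₁) (intervalIntegrable_const (c := B)) this
    rw [intervalIntegral.integral_const, smul_eq_mul] at this
    linarith
  have hTε : T + ε ≤ T + 1 := by linarith
  have hTε0 : 0 ≤ T + ε := by linarith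
  have nZ₁ : ∀ t, 0 ≤ t → 0 ≤ Z₁ t := fun t ht => by
    rw [← hYZ]; exact mul_nonneg h0.le (nY₂ t ht)
  have q2 : ∫ t in 0..T, (∫ τ in t..(t + ε), Y₂ τ) ≤ ∫ t in 0..(T + 1), Z₁ t := by
    refine (integral_average_le cY₂ nY₂ hT h0.le).trans ?_
    rw [← intervalIntegral.integral_const_mul]
    simp only [hYZ]
    exact integral_le_integral_add cZ₁ nZ₁ hTε0 hTε
  have q3 : ∫ t in 0..T, Z₂ (t + ε) ≤ ∫ t in 0..(T + 1), Z₂ t :=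
    (integral_comp_add_le cZ₂ nZ₂ hT h0.le).trans (integral_le_integral_add cZ₂ nZ₂ hTε0 hTε)
  have q4 : ∫ t in 0..T, Z₂ t ≤ ∫ t in 0..(T + 1), Z₂ t :=
    integral_le_integral_add cZ₂ nZ₂ hT (by linarith)
  have q5 : 0 ≤ ∫ t in 0..(T + 1), Z₁ t :=
    intervalIntegral.integral_nonneg hT1 fun t ht => nZ₁ t ht.1
  rw [intervalIntegral.integral_add (intervalIntegrable_of_continuousOn_Ici cZ₁ le_rfl hT1)
    (intervalIntegrable_of_continuousOn_Ici cZ₂ le_rfl hT1)] at hsm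
  refine hmain.trans ?_
  have q6 : (∫ t in 0..T, (∫ τ in t..(t + ε), Y₁ τ)) + (∫ t in 0..T, (∫ τ in t..(t + ε), Y₂ τ))
      + 4 * ((∫ t in 0..T, Z₂ (t + ε)) + ∫ t in 0..T, Z₂ t)
      ≤ B * T + 8 * (8 * B + 6 * (2 * K / (n + 1) / ε + 2 * K) * (B * (T + 1))) := by linarith
  calc _ = ε * ((∫ t in 0..T, (∫ τ in t..(t + ε), Y₁ τ)) + (∫ t in 0..T, (∫ τ in t..(t + ε), Y₂ τ))
      + 4 * ((∫ t in 0..T, Z₂ (t + ε)) + ∫ t in 0..T, Z₂ t)) := by ring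
    _ ≤ ε * (B * T + 8 * (8 * B + 6 * (2 * K / (n + 1) / ε + 2 * K) * (B * (T + 1)))) := by gcongr
    _ = _ := by field_simp; ring

end IsFiniteEnergyWaveMap

/-! ### Linear combinations of solutions, removal of cutoffs, and the cubic error of the
nonlinearity -/

theorem WeakWave.linear {u u' ux N u₂ u₂' ux₂ N₂ : ℝ → ℝ → ℝ} (h : WeakWave u u' ux N)
    (h₂ : WeakWave u₂ u₂' ux₂ N₂) (a b : ℝ) :
    WeakWave (fun t r => a * u t r + b * u₂ t r) (fun t r => a * u' t r + b * u₂' t r)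
      (fun t r => a * ux t r + b * ux₂ t r) (fun t r => a * N t r + b * N₂ t r) := by
  have key : ∀ {f g : ℝ → ℝ → ℝ}, ContL2Loc f → ContL2Loc g → ∀ {χ : ℝ → ℝ}, IsTestFunction χ →
      ∀ {t : ℝ}, 0 ≤ t → ∫ r, χ r * (a * f t r + b * g t r)
        = a * (∫ r, χ r * f t r) + b * ∫ r, χ r * g t r :=
    fun hf hg _ hχ _ ht =>
      integral_add_mul (fun r => by ring) (hf.integrable_mul hχ ht) (hg.integrable_mul hχ ht)
  refine ⟨(h.cont_u.const_mul a).add (h₂.cont_u.const_mul b),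
    (h.cont_u'.const_mul a).add (h₂.cont_u'.const_mul b),
    (h.cont_ux.const_mul a).add (h₂.cont_ux.const_mul b),
    (h.cont_N.const_mul a).add (h₂.cont_N.const_mul b), fun χ hχ t ht => ?_, fun χ hχ t ht => ?_,
    fun χ hχ t ht => ?_⟩
  · rw [key h.cont_ux h₂.cont_ux hχ ht, key h.cont_u h₂.cont_u hχ.deriv ht, h.grad χ hχ t ht,
      h₂.grad χ hχ t ht]
    ring
  · rw [key h.cont_u' h₂.cont_u' hχ ht]
    exact (((h.position χ hχ t ht).const_mul a).add ((h₂.position χ hχ t ht).const_mul b)).congr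
      (fun s hs => key h.cont_u h₂.cont_u hχ hs) (key h.cont_u h₂.cont_u hχ ht)
  · rw [key h.cont_N h₂.cont_N hχ ht, key h.cont_ux h₂.cont_ux hχ.deriv ht]
    refine ((((h.velocity χ hχ t ht).const_mul a).add ((h₂.velocity χ hχ t ht).const_mul b)).congr
      (fun s hs => key h.cont_u' h₂.cont_u' hχ hs) (key h.cont_u' h₂.cont_u' hχ ht)).congr_deriv ?_
    ring

theorem tendsto_integral_cutoff {k : ℝ → ℝ} (hk : IntegrableOn k (Ioi 0)) :
    Tendsto (fun n : ℕ => ∫ r, cutoff (n + 1) r ^ 2 * k r) atTop (𝓝 (∫ r in Ioi 0, k r)) := by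
  have e : ∀ n : ℕ, ∫ r, cutoff (n + 1) r ^ 2 * k r
      = ∫ r in Ioi 0, cutoff (n + 1) r ^ 2 * k r := fun n =>
    (integral_Ioi_eq (fun r _ => rfl) fun r hr => by
      rw [(isTestFunction_cutoff (by positivity : (0 : ℝ) < n + 1)).eq_zero hr]; ring).symm
  simp only [e]
  refine tendsto_integral_of_dominated_convergence (fun r => |k r|) (fun n => ?_) hk.norm
    (fun n => Eventually.of_forall fun r => ?_) ?_
  · exact (((isTestFunction_cutoff (by positivity : (0 : ℝ) < n + 1)).continuous.pow
      2).aestronglyMeasurable).mul hk.1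
  · rw [norm_mul, norm_of_nonneg (sq_nonneg _), Real.norm_eq_abs]
    have := pow_le_one₀ (n := 2) (cutoff_nonneg (n + 1) r) (cutoff_le_one (n + 1) r)
    exact mul_le_of_le_one_left (abs_nonneg _) this
  · filter_upwards [ae_restrict_mem measurableSet_Ioi] with r hr
    simpa using ((tendsto_cutoff hr).pow 2).mul_const (k r)

/-- For 0 ≤ y ≤ 1, cosh y ≤ 1 + y² and sinh y ≥ y; the expression is odd. -/
theorem abs_mul_cosh_sub_sinh_le {x : ℝ} (hx : |x| ≤ 1) : |x * cosh x - sinh x| ≤ |x| ^ 3 := by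
  have key : ∀ y : ℝ, 0 ≤ y → y ≤ 1 → |y * cosh y - sinh y| ≤ y ^ 3 := by
    intro y h0 h1
    have h2 := sinh_le_mul_cosh h0
    have h3 := self_le_sinh_iff.2 h0
    have h4 : cosh y ≤ 1 + y ^ 2 := by
      have h5 := cosh_le_exp_half_sq y
      have h6 := abs_exp_sub_one_le (x := y ^ 2 / 2) (by
        rw [abs_of_nonneg (by positivity)]; nlinarith)
      rw [abs_of_nonneg (by positivity : 0 ≤ y ^ 2 / 2)] at h6
      linarith [le_abs_self (exp (y ^ 2 / 2) - 1)]
    rw [abs_of_nonneg (by linarith)]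
    have := mul_le_mul_of_nonneg_left h4 h0
    nlinarith
  rcases le_total 0 x with h | h
  · rw [abs_of_nonneg h] at hx ⊢
    exact key x h hx
  · rw [abs_of_nonpos h] at hx ⊢
    have := key (-x) (by linarith) hx
    rw [cosh_neg, sinh_neg] at this
    rwa [show x * cosh x - sinh x = -(-x * cosh x - -sinh x) by ring, abs_neg]

/-- The error of the trapezoidal rule for ∫ sinh 2x dx over [a, b], in closed form; it is cubic in b
− a. -/
theorem sinh_sq_sub_identity (a b : ℝ) :
    1 / 2 * (sinh (2 * a) + sinh (2 * b)) * (b - a) - (sinh b ^ 2 - sinh a ^ 2)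
      = sinh (a + b) * ((b - a) * cosh (b - a) - sinh (b - a)) := by
  have ha := cosh_sq a
  have hb := cosh_sq b
  rw [sinh_two_mul, sinh_two_mul, sinh_add, cosh_sub, sinh_sub]
  linear_combination (-(b - a) * sinh b * cosh b + sinh b ^ 2) * ha
    + (-(b - a) * sinh a * cosh a - sinh a ^ 2) * hb

theorem abs_sinh_sq_sub_le {a b M μ : ℝ} (ha : |a| ≤ M) (hb : |b| ≤ M) (hμ : |b - a| ≤ μ)
    (hμ1 : μ ≤ 1) :
    |1 / 2 * (sinh (2 * a) + sinh (2 * b)) * (b - a) - (sinh b ^ 2 - sinh a ^ 2)|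
      ≤ sinh (2 * M) * μ * (b - a) ^ 2 := by
  have hM : 0 ≤ M := (abs_nonneg a).trans ha
  rw [sinh_sq_sub_identity, abs_mul, abs_sinh]
  have h1 : |a + b| ≤ 2 * M := (abs_add_le a b).trans (by linarith)
  have h2 := abs_mul_cosh_sub_sinh_le (hμ.trans hμ1)
  have h3 : |b - a| ^ 3 ≤ μ * (b - a) ^ 2 := by
    calc |b - a| ^ 3 = |b - a| * |b - a| ^ 2 := by ring
      _ ≤ μ * |b - a| ^ 2 := by gcongr
      _ = _ := by rw [sq_abs]
  calc _ ≤ sinh (2 * M) * (μ * (b - a) ^ 2) := by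
        exact mul_le_mul (sinh_le_sinh.2 h1) (h2.trans h3) (abs_nonneg _)
          (sinh_nonneg_iff.2 (by linarith))
    _ = _ := by ring

/-! ### Differentiability of the flow in `L²` -/

/-- A smooth compactly supported function on the line need not vanish near 0; multiplying by the
logarithmic cutoffs repairs this, with convergence by domination. -/
theorem dense_testFunctions : Dense {f : L2H | ∃ χ : ℝ → ℝ, IsTestFunction χ ∧ f =ᵐ[volume.restrict
    (Ioi 0)] χ} := by
  have hD := Lp.dense_hasCompactSupport_contDiff (E := ℝ) (F := ℝ) (μ := volume.restrict (Ioi 0))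
    (p := 2) (by simp)
  rw [← dense_closure]
  refine hD.mono ?_
  rintro f ⟨g, hfg, hc, hg⟩
  have hm : MemLp g 2 (volume.restrict (Ioi (0 : ℝ))) := hg.continuous.memLp_of_hasCompactSupport hc
  have hχ : ∀ n : ℕ, IsTestFunction fun r => cutoff (n + 1) r * g r := fun n =>
    (isTestFunction_cutoff (by positivity)).mul_contDiffOn hg.contDiffOn
  have hmn : ∀ n : ℕ, MemLp (fun r => cutoff (n + 1) r * g r) 2 (volume.restrict (Ioi (0 : ℝ))) :=
    fun n => (hχ n).continuous.memLp_of_hasCompactSupport (hχ n).hasCompactSupport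
  refine mem_closure_of_tendsto (f := fun n : ℕ => (hmn n).toLp) (b := atTop) ?_
    (Eventually.of_forall fun n => ⟨_, hχ n, (hmn n).coeFn_toLp⟩)
  have hf : f = hm.toLp g := by
    rw [← Lp.toLp_coeFn f (Lp.memLp f)]; exact MemLp.toLp_congr _ _ hfg
  rw [hf, tendsto_iff_norm_sub_tendsto_zero]
  have hint : Tendsto (fun n : ℕ => ∫ r in Ioi 0, (cutoff (n + 1) r * g r - g r) ^ 2) atTop
      (𝓝 (∫ r in Ioi (0 : ℝ), (0 : ℝ))) := by
    refine tendsto_integral_of_dominated_convergence (fun r => g r ^ 2) (fun n => ?_)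
      hm.integrable_sq (fun n => Eventually.of_forall fun r => ?_) ?_
    · exact (((hχ n).continuous.sub hg.continuous).pow 2).aestronglyMeasurable
    · rw [norm_of_nonneg (sq_nonneg _), show (cutoff (n + 1) r * g r - g r) ^ 2
        = (1 - cutoff (n + 1) r) ^ 2 * g r ^ 2 by ring]
      refine mul_le_of_le_one_left (sq_nonneg _) (pow_le_one₀ ?_ ?_)
      · linarith [cutoff_le_one (n + 1) r]
      · linarith [cutoff_nonneg (n + 1) r]
    · filter_upwards [ae_restrict_mem measurableSet_Ioi] with r hr
      have := (((tendsto_cutoff hr).mul_const (g r)).sub_const (g r)).pow 2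
      simpa using this
  rw [integral_zero] at hint
  have e : ∀ n, ‖(hmn n).toLp - hm.toLp g‖ = √(∫ r in Ioi 0, (cutoff (n + 1) r * g r - g r) ^ 2) := by
    intro n
    rw [← sqrt_sq (norm_nonneg _), ← real_inner_self_eq_norm_sq, ← MemLp.toLp_sub, L2.inner_def]
    congr 1
    refine integral_congr_ae ?_
    filter_upwards [((hmn n).sub hm).coeFn_toLp] with r hr
    rw [hr]; simp [sq]
  simp only [e]
  have := (continuous_sqrt.tendsto 0).comp hint
  rw [sqrt_zero] at this
  exact this

namespace IsFiniteEnergyWaveMap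

variable {lam : ℝ} {ψ ψ' : ℝ → ℝ → ℝ}

theorem hardy_sub (h : IsFiniteEnergyWaveMap lam ψ ψ') {s t : ℝ} (hs : 0 ≤ s) (ht : 0 ≤ t) :
    IntegrableOn (fun r => (ψ s r - ψ t r) ^ 2 * sinh r) (Ioi 0) ∧
      ∫ r in Ioi 0, (ψ s r - ψ t r) ^ 2 * sinh r
        ≤ 6 * ∫ r in Ioi 0, deriv (fun r => ψ s r - ψ t r) r ^ 2 * sinh r :=
  ((h.memH hs).sub (h.memH ht)).hardy (by
    simpa using (h.mem_energyClass s hs).tendsto_atTop.sub (h.mem_energyClass t ht).tendsto_atTop)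

/-- ψ(t) has a limit at infinity that need not be 0, so it need not be square integrable for sinh r
dr. The difference of two times tends to 0, and Hardy's inequality applies to it. -/
theorem contL2_sub_initial (h : IsFiniteEnergyWaveMap lam ψ ψ') :
    ContL2 fun t r => √(sinh r) * (ψ t r - ψ 0 r) := by
  have e : ∀ s t r : ℝ, 0 < r → (√(sinh r) * (ψ s r - ψ t r)) ^ 2 = (ψ s r - ψ t r) ^ 2 * sinh r :=
    fun s t r hr => by rw [mul_pow, sq_sqrt (sinh_pos_iff.2 hr).le, mul_comm]
  refine .of_sq_le (d := fun s t r => (ψ s r - ψ t r) ^ 2 * sinh r) (fun t ht => ?_)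
    (fun t ht => ?_) fun s t hs ht => ?_
  · refine (memLp_two_iff_integrable_sq ?_).2 ?_
    · refine ContinuousOn.aestronglyMeasurable ?_ measurableSet_Ioi
      exact continuous_sinh.sqrt.continuousOn.mul
        ((h.memH ht).ac.continuousOn.sub (h.memH le_rfl).ac.continuousOn)
    · refine (h.hardy_sub ht le_rfl).1.congr ?_
      filter_upwards [ae_restrict_mem measurableSet_Ioi] with r hr
      rw [e _ _ _ hr]
  · have h1 : Tendsto (fun s => ENNReal.ofReal (6 * gap ψ s t)) (𝓝[Ici 0] t) (𝓝 0) := by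
      simpa using ENNReal.tendsto_ofReal ((h.tendsto_gap ht).const_mul 6)
    refine tendsto_of_tendsto_of_tendsto_of_le_of_le' tendsto_const_nhds h1
      (Eventually.of_forall fun s => zero_le) ?_
    filter_upwards [self_mem_nhdsWithin] with s hs
    obtain ⟨i1, i2⟩ := h.hardy_sub hs ht
    rw [← ofReal_integral_eq_lintegral_ofReal i1]
    · refine ENNReal.ofReal_le_ofReal (i2.trans ?_)
      rw [h.integral_grad_sub hs ht, gap]
      gcongr
      exact le_add_of_nonneg_right (sq_nonneg _)
    · filter_upwards [ae_restrict_mem measurableSet_Ioi] with r hr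
      exact mul_nonneg (sq_nonneg _) (sinh_pos_iff.2 hr).le
  · filter_upwards [ae_restrict_mem measurableSet_Ioi] with r hr
    rw [← e _ _ _ hr]
    exact le_of_eq (by ring)

/-- Norm differentiability in the full weighted space, without localisation; it yields the limit of
difference quotients in the energy argument. -/
theorem hasDerivWithinAt_curve (h : IsFiniteEnergyWaveMap lam ψ ψ') {t : ℝ} (ht : 0 ≤ t) :
    HasDerivWithinAt (curve fun t r => √(sinh r) * (ψ t r - ψ 0 r))
      (curve (fun t r => √(sinh r) * ψ' t r) t) (Ici 0) t := by
  have hΦ := h.contL2_sub_initial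
  have hV := h.contL2_velocity
  have hsq : ContDiffOn ℝ (⊤ : ℕ∞) (fun r => √(sinh r)) (Ioi 0) :=
    contDiff_sinh.contDiffOn.sqrt fun r hr => (sinh_pos_iff.2 hr).ne'
  refine hasDerivWithinAt_of_weak (b := curve fun t r => √(sinh r) * ψ' t r) dense_testFunctions
    hΦ.continuousOn_curve hV.continuousOn_curve ?_ ht
  rintro f ⟨χ, hχ, hf⟩ t ht
  have key : ∀ {g : ℝ → ℝ → ℝ}, ContL2 (fun t r => √(sinh r) * g t r) → ∀ {s : ℝ}, 0 ≤ s →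
      inner ℝ f (curve (fun t r => √(sinh r) * g t r) s) = ∫ r, (χ r * √(sinh r)) * g s r := by
    intro g hg s hs
    rw [L2.inner_def, ← integral_Ioi_eq (fun r _ => rfl) fun r hr => by rw [hχ.eq_zero hr]; ring]
    refine integral_congr_ae ?_
    rw [hg.curve_eq hs]
    filter_upwards [(hg.memLp s hs).coeFn_toLp, hf] with r h1 h2
    rw [h1, h2]; simp; ring
  have hw := hχ.mul_contDiffOn hsq
  have i0 := h.contL2Loc_self
  refine (((h.weakWave_self.position _ hw t ht).sub_const
    (∫ r, (χ r * √(sinh r)) * ψ 0 r)).congr (fun s hs => ?_) ?_).congr_deriv (key hV ht).symm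
  · rw [key (g := fun t r => ψ t r - ψ 0 r) hΦ hs, ← integral_sub (i0.integrable_mul hw hs)
      (i0.integrable_mul hw le_rfl)]
    simp only [mul_sub]
  · rw [key (g := fun t r => ψ t r - ψ 0 r) hΦ ht, ← integral_sub (i0.integrable_mul hw ht)
      (i0.integrable_mul hw le_rfl)]
    simp only [mul_sub]

end IsFiniteEnergyWaveMap

/-! ### Monotonicity of the energy through time translates -/

/-- Twice the Lagrangian density with respect to `dr`. -/
noncomputable def lagrangianDensity (ψ ψ' : ℝ → ℝ → ℝ) (t r : ℝ) : ℝ :=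
  ψ' t r ^ 2 * sinh r - deriv (ψ t) r ^ 2 * sinh r - sinh (ψ t r) ^ 2 / sinh r

theorem integral_le_add_of_le {k l g : ℝ → ℝ} (hk : Integrable k) (hl : Integrable l)
    (hg : IntegrableOn g (Ioi 0)) (h0 : ∀ r, r ≤ 0 → k r = l r)
    (hle : ∀ r, 0 < r → k r ≤ l r + g r) : ∫ r, k r ≤ (∫ r, l r) + ∫ r in Ioi 0, g r := by
  have e : ∫ r, (k r - l r) = ∫ r in Ioi 0, (k r - l r) :=
    (integral_Ioi_eq (fun r _ => rfl) fun r hr => by rw [h0 r hr, sub_self]).symm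
  have : ∫ r in Ioi 0, (k r - l r) ≤ ∫ r in Ioi 0, g r := by
    refine integral_mono_ae (hk.sub hl).integrableOn hg ?_
    filter_upwards [ae_restrict_mem measurableSet_Ioi] with r hr
    have := hle r hr
    have : k r - l r ≤ g r := by linarith
    exact this
  rw [← e, integral_sub hk hl] at this
  linarith

theorem tendsto_intervalIntegral_of_abs_le {F : ℕ → ℝ → ℝ} {f g : ℝ → ℝ} {a b : ℝ} (ha : 0 ≤ a)
    (hb : 0 ≤ b) (hF : ∀ n, ContinuousOn (F n) (Ici 0)) (hg : ContinuousOn g (Ici 0))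
    (hle : ∀ n t, 0 ≤ t → |F n t| ≤ g t)
    (hlim : ∀ t, 0 ≤ t → Tendsto (fun n => F n t) atTop (𝓝 (f t))) :
    Tendsto (fun n => ∫ t in a..b, F n t) atTop (𝓝 (∫ t in a..b, f t)) := by
  have h0 : ∀ t ∈ uIoc a b, 0 ≤ t := fun t ht => (le_min ha hb).trans ht.1.le
  refine intervalIntegral.tendsto_integral_filter_of_dominated_convergence g
    (Eventually.of_forall fun n => ?_)
    (Eventually.of_forall fun n => Eventually.of_forall fun t ht => hle n t (h0 t ht))
    (intervalIntegrable_of_continuousOn_Ici hg ha hb)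
    (Eventually.of_forall fun t ht => hlim t (h0 t ht))
  exact ((hF n).mono h0).aestronglyMeasurable measurableSet_uIoc

theorem tendsto_average {K : ℝ → ℝ} (hK : ContinuousOn K (Ici 0)) {t : ℝ} (ht : 0 ≤ t) :
    Tendsto (fun ε => ε⁻¹ * ∫ τ in t..(t + ε), K τ) (𝓝[>] 0) (𝓝 (K t)) := by
  have hc := continuous_comp_max hK
  have hd := (hc.integral_hasStrictDerivAt t t).hasDerivAt
  have h1 := hd.tendsto_slope_zero_right
  simp only [max_eq_left ht, intervalIntegral.integral_same, sub_zero, smul_eq_mul] at h1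
  refine h1.congr' ?_
  filter_upwards [self_mem_nhdsWithin] with ε hε
  rw [integral_comp_max ht (add_nonneg ht (mem_Ioi.1 hε).le)]

/-- a and b stand for the values at t and t + ε. The virial density of sum against difference equals
the increment of the Lagrangian density, up to the trapezoidal error and terms with η'; the coth r
terms cancel against the derivative of sinh r in the weight. -/
theorem virial_difference_pointwise {η η' s c δ m a b a' b' ax bx Sa Sb Sa2 Sb2 : ℝ} (hs : 0 < s)
    (hc : 0 < c) (hcs : c ^ 2 = 1 + s ^ 2) (h0 : 0 ≤ η) (h1 : η ≤ 1) (hη' : |η'| ≤ δ * (c / s))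
    (hT : |1 / 2 * (Sa2 + Sb2) * (b - a) - (Sb ^ 2 - Sa ^ 2)| ≤ m * (b - a) ^ 2)
    (ha : a ^ 2 ≤ Sa ^ 2) (hb : b ^ 2 ≤ Sb ^ 2) :
    η ^ 2 * s * ((1 * b' + 1 * a') * (1 * b' + -1 * a') - (1 * bx + 1 * ax) * (1 * bx + -1 * ax)
        + (1 * (bx * (c / s) - 1 / 2 * Sb2 / s ^ 2) + 1 * (ax * (c / s) - 1 / 2 * Sa2 / s ^ 2))
          * (1 * b + -1 * a))
      - (2 * η * η' * s + η ^ 2 * c) * ((1 * bx + 1 * ax) * (1 * b + -1 * a))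
      ≤ η ^ 2 * (b' ^ 2 * s - bx ^ 2 * s - Sb ^ 2 / s) - η ^ 2 * (a' ^ 2 * s - ax ^ 2 * s - Sa ^ 2 / s)
        + m * (η ^ 2 * s⁻¹ * ((b - a) * (b - a)))
        + δ * (2 * (b' ^ 2 * s + bx ^ 2 * s + Sb ^ 2 / s) + 2 * (a' ^ 2 * s + ax ^ 2 * s + Sa ^ 2 / s)
          + (b - a) ^ 2 * s) := by
  have e : η ^ 2 * s * ((1 * b' + 1 * a') * (1 * b' + -1 * a')
        - (1 * bx + 1 * ax) * (1 * bx + -1 * ax)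
        + (1 * (bx * (c / s) - 1 / 2 * Sb2 / s ^ 2) + 1 * (ax * (c / s) - 1 / 2 * Sa2 / s ^ 2))
          * (1 * b + -1 * a))
      - (2 * η * η' * s + η ^ 2 * c) * ((1 * bx + 1 * ax) * (1 * b + -1 * a))
      = η ^ 2 * (b' ^ 2 * s - bx ^ 2 * s - Sb ^ 2 / s)
        - η ^ 2 * (a' ^ 2 * s - ax ^ 2 * s - Sa ^ 2 / s)
        + η ^ 2 * s⁻¹ * -(1 / 2 * (Sa2 + Sb2) * (b - a) - (Sb ^ 2 - Sa ^ 2))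
        + -(2 * η * η' * s * ((bx + ax) * (b - a))) := by
    field_simp
    ring
  have hT' : η ^ 2 * s⁻¹ * -(1 / 2 * (Sa2 + Sb2) * (b - a) - (Sb ^ 2 - Sa ^ 2))
      ≤ η ^ 2 * s⁻¹ * (m * (b - a) ^ 2) :=
    mul_le_mul_of_nonneg_left ((neg_le_abs _).trans hT) (by positivity)
  have hδ : 0 ≤ δ := by
    by_contra hneg
    have : δ * (c / s) < 0 := mul_neg_of_neg_of_pos (not_le.1 hneg) (by positivity)
    linarith [abs_nonneg η']
  have hx : c * |(bx + ax) * (b - a)|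
      ≤ 1 / 2 * ((bx + ax) ^ 2 * s + (1 + s ^ 2) * (b - a) ^ 2 / s) := by
    have := abs_mul_le_of_pos (x := bx + ax) (y := c * (b - a)) hs
    rw [mul_pow, hcs] at this
    calc c * |(bx + ax) * (b - a)| = |(bx + ax) * (c * (b - a))| := by
          rw [show (bx + ax) * (c * (b - a)) = c * ((bx + ax) * (b - a)) by ring, abs_mul c,
            abs_of_pos hc]
      _ ≤ _ := this
  have hy : (b - a) ^ 2 / s ≤ 2 * (Sb ^ 2 / s) + 2 * (Sa ^ 2 / s) := by
    rw [← mul_div_assoc, ← mul_div_assoc, ← add_div]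
    gcongr
    nlinarith [sq_nonneg (a + b)]
  have hz : (1 + s ^ 2) * (b - a) ^ 2 / s = (b - a) ^ 2 / s + (b - a) ^ 2 * s := by
    field_simp
  have hxx : (bx + ax) ^ 2 * s ≤ 2 * (bx ^ 2 * s) + 2 * (ax ^ 2 * s) := by
    nlinarith [mul_nonneg (sq_nonneg (bx - ax)) hs.le]
  have hE : -(2 * η * η' * s * ((bx + ax) * (b - a)))
      ≤ δ * (2 * (b' ^ 2 * s + bx ^ 2 * s + Sb ^ 2 / s) + 2 * (a' ^ 2 * s + ax ^ 2 * s + Sa ^ 2 / s)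
          + (b - a) ^ 2 * s) := by
    calc _ ≤ |2 * η * η' * s * ((bx + ax) * (b - a))| := neg_le_abs _
      _ = 2 * s * |(bx + ax) * (b - a)| * (η * |η'|) := by
        rw [abs_mul, abs_mul, abs_mul, abs_mul, abs_two, abs_of_nonneg h0, abs_of_pos hs]; ring
      _ ≤ 2 * s * |(bx + ax) * (b - a)| * (1 * (δ * (c / s))) := by gcongr
      _ = δ * (2 * (c * |(bx + ax) * (b - a)|)) := by field_simp
      _ ≤ _ := by
        gcongr
        have : 0 ≤ b' ^ 2 * s := by positivity
        have : 0 ≤ a' ^ 2 * s := by positivity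
        linarith
  rw [e]
  have : η ^ 2 * s⁻¹ * (m * (b - a) ^ 2) = m * (η ^ 2 * s⁻¹ * ((b - a) * (b - a))) := by ring
  linarith

namespace IsFiniteEnergyWaveMap

variable {lam : ℝ} {ψ ψ' : ℝ → ℝ → ℝ}

theorem integrableOn_lagrangianDensity (h : IsFiniteEnergyWaveMap lam ψ ψ') {t : ℝ} (ht : 0 ≤ t) :
    IntegrableOn (lagrangianDensity ψ ψ' t) (Ioi 0) :=
  ((h.mem_energyClass t ht).integrableOn_velocity.sub
    (h.mem_energyClass t ht).integrableOn_grad).sub (h.mem_energyClass t ht).integrableOn_sinh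

theorem integral_lagrangianDensity (h : IsFiniteEnergyWaveMap lam ψ ψ') {t : ℝ} (ht : 0 ≤ t) :
    ∫ r in Ioi 0, lagrangianDensity ψ ψ' t r
      = 2 * (∫ r in Ioi 0, ψ' t r ^ 2 * sinh r) - twiceEnergy ψ ψ' t := by
  have hv := (h.mem_energyClass t ht).integrableOn_velocity
  rw [twiceEnergy, ← integral_const_mul, ← integral_sub (by exact hv.const_mul 2)
    (h.integrableOn_energyDensity ht)]
  refine integral_congr_ae (Eventually.of_forall fun r => ?_)
  simp only [lagrangianDensity, energyDensity]; ring

theorem continuousOn_integral_velocity_sq (h : IsFiniteEnergyWaveMap lam ψ ψ') :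
    ContinuousOn (fun t => ∫ r in Ioi 0, ψ' t r ^ 2 * sinh r) (Ici 0) := by
  simp only [integral_velocity_sq]
  exact h.contL2_velocity.continuousOn_integral h.contL2_velocity

theorem integrable_cutoff_lagrangian (h : IsFiniteEnergyWaveMap lam ψ ψ') {η : ℝ → ℝ}
    (hη : IsTestFunction η) : (∀ t, 0 ≤ t → Integrable fun r => η r ^ 2 * lagrangianDensity ψ ψ' t r) ∧
      ContinuousOn (fun t => ∫ r, η r ^ 2 * lagrangianDensity ψ ψ' t r) (Ici 0) := by
  have hw₁ : IsTestFunction fun r => η r * η r * sinh r :=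
    (hη.mul hη).mul_contDiffOn contDiff_sinh.contDiffOn
  have hw₂ : IsTestFunction fun r => η r * η r * (sinh r)⁻¹ := (hη.mul hη).mul_inv_sinh
  have c1 := h.contL2Loc_velocity
  have c2 := h.contL2Loc_deriv
  have c3 := h.contL2Loc_comp contDiff_sinh sinh_zero
  have e : ∀ t r, η r ^ 2 * lagrangianDensity ψ ψ' t r
      = η r * η r * sinh r * (ψ' t r * ψ' t r) - η r * η r * sinh r * (deriv (ψ t) r * deriv (ψ t) r)
        - η r * η r * (sinh r)⁻¹ * (sinh (ψ t r) * sinh (ψ t r)) := by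
    intro t r; rw [lagrangianDensity]; ring
  have i1 := fun t (ht : 0 ≤ t) => c1.integrable_mul_mul c1 hw₁ ht ht
  have i2 := fun t (ht : 0 ≤ t) => c2.integrable_mul_mul c2 hw₁ ht ht
  have i3 := fun t (ht : 0 ≤ t) => c3.integrable_mul_mul c3 hw₂ ht ht
  simp only [e]
  refine ⟨fun t ht => ((i1 t ht).sub (i2 t ht)).sub (i3 t ht), ?_⟩
  refine (((c1.continuousOn_integral_sq hw₁).sub (c2.continuousOn_integral_sq hw₁)).sub
    (c3.continuousOn_integral_sq hw₂)).congr fun t ht => ?_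
  rw [integral_sub (by exact (i1 t ht).sub (i2 t ht)) (i3 t ht), integral_sub (i1 t ht) (i2 t ht)]
  rfl

theorem abs_integral_cutoff_lagrangian_le (h : IsFiniteEnergyWaveMap lam ψ ψ') (n : ℕ) {t : ℝ}
    (ht : 0 ≤ t) :
    |∫ r, cutoff (n + 1) r ^ 2 * lagrangianDensity ψ ψ' t r| ≤ twiceEnergy ψ ψ' t := by
  have := h.abs_integral_le (C := 1) ht (k := fun r => cutoff (n + 1) r ^ 2
    * lagrangianDensity ψ ψ' t r) (fun r hr => by
      rw [(isTestFunction_cutoff (by positivity : (0 : ℝ) < n + 1)).eq_zero hr]; ring)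
    (fun r hr => by
      have hs : 0 < sinh r := sinh_pos_iff.2 hr
      have h1 : 0 ≤ sinh (ψ t r) ^ 2 / sinh r := by positivity
      have h2 : 0 ≤ deriv (ψ t) r ^ 2 * sinh r := by positivity
      have h3 : 0 ≤ ψ' t r ^ 2 * sinh r := by positivity
      rw [abs_mul, abs_of_nonneg (sq_nonneg _)]
      refine mul_le_mul (pow_le_one₀ (cutoff_nonneg _ _) (cutoff_le_one _ _)) ?_ (abs_nonneg _)
        zero_le_one
      rw [lagrangianDensity, energyDensity, abs_le]
      constructor <;> linarith)
  rwa [one_mul] at this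

end IsFiniteEnergyWaveMap

theorem deriv_sq_mul_sinh {η : ℝ → ℝ} (hη : IsTestFunction η) (r : ℝ) :
    deriv (fun r => η r ^ 2 * sinh r) r = 2 * η r * deriv η r * sinh r + η r ^ 2 * cosh r := by
  have h := ((hη.differentiable.differentiableAt.hasDerivAt (x := r)).fun_pow 2).fun_mul
    (hasDerivAt_sinh r)
  rw [h.deriv]
  simp only [Nat.cast_ofNat, Nat.add_one_sub_one, pow_one]

theorem source_zero (ψ : ℝ → ℝ → ℝ) (t r : ℝ) : source 0 ψ t r
    = deriv (ψ t) r * (cosh r / sinh r) - 1 / 2 * sinh (2 * ψ t r) / sinh r ^ 2 := by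
  simp [source, harmonicMap_zero_left]

namespace IsFiniteEnergyWaveMap

variable {lam : ℝ} {ψ ψ' : ℝ → ℝ → ℝ}

/-- The virial identity for the sum and the difference of ψ(t + ε) and ψ(t), which are both weak
solutions with their own sources. -/
theorem hasDerivWithinAt_difference (h : IsFiniteEnergyWaveMap lam ψ ψ') {η : ℝ → ℝ}
    (hη : IsTestFunction η) (h0 : ∀ r, 0 ≤ η r) (h1 : ∀ r, η r ≤ 1) {δ : ℝ}
    (hδ : ∀ r, 0 < r → |deriv η r| ≤ δ * (cosh r / sinh r)) {ε t M μ : ℝ} (hε : 0 ≤ ε) (ht : 0 ≤ t)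
    (hM : ∀ r, 0 < r → |ψ t r| ≤ M) (hM' : ∀ r, 0 < r → |ψ (t + ε) r| ≤ M)
    (hμ : ∀ r, 0 < r → |ψ (t + ε) r - ψ t r| ≤ μ) (hμ1 : μ ≤ 1) :
    ∃ D, HasDerivWithinAt (fun t => ∫ r, η r ^ 2 * sinh r
        * ((ψ' (t + ε) r + ψ' t r) * (ψ (t + ε) r - ψ t r))) D (Ici 0) t ∧
      D ≤ (∫ r, η r ^ 2 * lagrangianDensity ψ ψ' (t + ε) r)
        - (∫ r, η r ^ 2 * lagrangianDensity ψ ψ' t r)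
        + sinh (2 * M) * μ * (∫ r, η r ^ 2 * (sinh r)⁻¹
            * ((ψ (t + ε) r - ψ t r) * (ψ (t + ε) r - ψ t r)))
        + δ * (2 * twiceEnergy ψ ψ' (t + ε) + 2 * twiceEnergy ψ ψ' t
          + ∫ r in Ioi 0, (ψ (t + ε) r - ψ t r) ^ 2 * sinh r) := by
  have htε : 0 ≤ t + ε := add_nonneg ht hε
  have hw : IsTestFunction fun r => η r ^ 2 * sinh r := by
    simpa [sq] using (hη.mul hη).mul_contDiffOn contDiff_sinh.contDiffOn
  have hw₂ : IsTestFunction fun r => η r ^ 2 * (sinh r)⁻¹ := by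
    simpa [sq] using (hη.mul hη).mul_inv_sinh
  have hW := h.weakWave_self
  have hp := (hW.comp_add hε).linear hW 1 1
  have hm := (hW.comp_add hε).linear hW 1 (-1)
  have hd := hp.hasDerivWithinAt_virial hm hw ht
  have hi := hp.integrable_virial hm hw ht
  have hΔ := h.contL2Loc_sub hε
  refine ⟨_, hd.congr_of_eventuallyEq (Eventually.of_forall fun s => ?_) ?_, ?_⟩
  · simp only [one_mul, neg_one_mul, sub_eq_add_neg]
  · simp only [one_mul, neg_one_mul, sub_eq_add_neg]
  obtain ⟨iL, -⟩ := h.integrable_cutoff_lagrangian hη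
  have iY := hΔ.integrable_mul_mul hΔ hw₂ ht ht
  have iH := (h.hardy_sub htε ht).1
  have iE := h.integrableOn_energyDensity ht
  have iE' := h.integrableOn_energyDensity htε
  have key := integral_le_add_of_le hi (((iL _ htε).sub (iL _ ht)).add
    (iY.const_mul (sinh (2 * M) * μ)))
    ((((iE'.const_mul 2).add (iE.const_mul 2)).add iH).const_mul δ) (fun r hr => by
      simp only [Pi.add_apply, Pi.sub_apply]
      rw [deriv_sq_mul_sinh hη, hη.eq_zero hr]; ring) (fun r hr => by
      have hs : 0 < sinh r := sinh_pos_iff.2 hr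
      have := virial_difference_pointwise (b' := ψ' (t + ε) r) (a' := ψ' t r)
        (bx := deriv (ψ (t + ε)) r) (ax := deriv (ψ t) r) hs (cosh_pos r)
        (by rw [cosh_sq]; ring) (h0 r) (h1 r) (hδ r hr)
        (abs_sinh_sq_sub_le (hM r hr) (hM' r hr) (hμ r hr) hμ1) (sq_le_sinh_sq _) (sq_le_sinh_sq _)
      simp only [Pi.add_apply, Pi.sub_apply]
      rw [deriv_sq_mul_sinh hη, source_zero, source_zero]
      exact this)
  refine key.trans (le_of_eq ?_)
  rw [integral_add' (by exact (iL _ htε).sub (iL _ ht)) (iY.const_mul (sinh (2 * M) * μ)),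
    integral_sub' (iL _ htε) (iL _ ht), integral_const_mul]
  have e2 : ∫ r in Ioi 0, δ * (((fun r => 2 * energyDensity ψ ψ' (t + ε) r)
      + (fun r => 2 * energyDensity ψ ψ' t r)) + fun r => (ψ (t + ε) r - ψ t r) ^ 2 * sinh r) r
      = δ * (2 * twiceEnergy ψ ψ' (t + ε) + 2 * twiceEnergy ψ ψ' t
          + ∫ r in Ioi 0, (ψ (t + ε) r - ψ t r) ^ 2 * sinh r) := by
    rw [integral_const_mul, integral_add' (by exact (iE'.const_mul 2).add (iE.const_mul 2)) iH,
      integral_add' (iE'.const_mul 2) (iE.const_mul 2), integral_const_mul, integral_const_mul]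
    rfl
  rw [← e2]

theorem integral_sub_sq_eq (h : IsFiniteEnergyWaveMap lam ψ ψ') {s t : ℝ} (hs : 0 ≤ s)
    (ht : 0 ≤ t) : ∫ r in Ioi 0, (ψ s r - ψ t r) ^ 2 * sinh r
      = ‖curve (fun t r => √(sinh r) * (ψ t r - ψ 0 r)) s
        - curve (fun t r => √(sinh r) * (ψ t r - ψ 0 r)) t‖ ^ 2 := by
  rw [h.contL2_sub_initial.norm_sub_sq hs ht]
  refine setIntegral_congr_fun measurableSet_Ioi fun r hr => ?_
  have := sq_sqrt (sinh_pos_iff.2 (mem_Ioi.1 hr)).le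
  linear_combination -(ψ s r - ψ t r) ^ 2 * this

theorem integral_difference_eq (h : IsFiniteEnergyWaveMap lam ψ ψ') {ε t : ℝ} (hε : 0 ≤ ε)
    (ht : 0 ≤ t) :
    IntegrableOn (fun r => sinh r * ((ψ' (t + ε) r + ψ' t r) * (ψ (t + ε) r - ψ t r))) (Ioi 0) ∧
    ∫ r in Ioi 0, sinh r * ((ψ' (t + ε) r + ψ' t r) * (ψ (t + ε) r - ψ t r))
      = inner ℝ (curve (fun t r => √(sinh r) * ψ' t r) (t + ε)
          + curve (fun t r => √(sinh r) * ψ' t r) t)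
        (curve (fun t r => √(sinh r) * (ψ t r - ψ 0 r)) (t + ε)
          - curve (fun t r => √(sinh r) * (ψ t r - ψ 0 r)) t) := by
  have hV := h.contL2_velocity
  have hΦ := h.contL2_sub_initial
  have htε : 0 ≤ t + ε := add_nonneg ht hε
  have i1 := hV.integrableOn_mul hΦ htε htε
  have i2 := hV.integrableOn_mul hΦ ht htε
  have i3 := hV.integrableOn_mul hΦ htε ht
  have i4 := hV.integrableOn_mul hΦ ht ht
  have e : ∀ r ∈ Ioi (0 : ℝ), sinh r * ((ψ' (t + ε) r + ψ' t r) * (ψ (t + ε) r - ψ t r))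
      = (√(sinh r) * ψ' (t + ε) r) * (√(sinh r) * (ψ (t + ε) r - ψ 0 r))
        + (√(sinh r) * ψ' t r) * (√(sinh r) * (ψ (t + ε) r - ψ 0 r))
        - ((√(sinh r) * ψ' (t + ε) r) * (√(sinh r) * (ψ t r - ψ 0 r))
        + (√(sinh r) * ψ' t r) * (√(sinh r) * (ψ t r - ψ 0 r))) := fun r hr => by
    have := mul_self_sqrt (sinh_pos_iff.2 (mem_Ioi.1 hr)).le
    linear_combination -((ψ' (t + ε) r + ψ' t r) * (ψ (t + ε) r - ψ t r)) * this
  constructor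
  · exact ((i1.add i2).sub (i3.add i4)).congr_fun (fun r hr => (e r hr).symm) measurableSet_Ioi
  rw [setIntegral_congr_fun measurableSet_Ioi e, integral_sub (by exact i1.add i2)
    (by exact i3.add i4), integral_add i1 i2, integral_add i3 i4, inner_sub_right, inner_add_left,
    inner_add_left, hV.inner_curve hΦ htε htε, hV.inner_curve hΦ ht htε, hV.inner_curve hΦ htε ht,
    hV.inner_curve hΦ ht ht]

end IsFiniteEnergyWaveMap

namespace IsFiniteEnergyWaveMap

variable {lam : ℝ} {ψ ψ' : ℝ → ℝ → ℝ}

theorem continuousOn_lagrangian (h : IsFiniteEnergyWaveMap lam ψ ψ') :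
    ContinuousOn (fun t => ∫ r in Ioi 0, lagrangianDensity ψ ψ' t r) (Ici 0) :=
  ((h.continuousOn_integral_velocity_sq.const_mul 2).sub h.continuousOn_twiceEnergy).congr
    fun _ ht => h.integral_lagrangianDensity ht

/-- The localised inequality is integrated in time before n → ∞. The Lagrangian terms telescope to
the two end intervals, and the errors κ / (n + 1) and A' / (n + 1) disappear. -/
theorem difference_le (h : IsFiniteEnergyWaveMap lam ψ ψ') {T ε M μ A A' : ℝ} (hT : 0 ≤ T)
    (hε : 0 < ε) (hM0 : 0 ≤ M) (hM : ∀ t ∈ Icc 0 (T + ε), ∀ r, 0 < r → |ψ t r| ≤ M) (hμ0 : 0 ≤ μ)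
    (hμ : ∀ t ∈ Icc 0 T, ∀ r, 0 < r → |ψ (t + ε) r - ψ t r| ≤ μ) (hμ1 : μ ≤ 1)
    (hA : ∀ n : ℕ, ∫ t in 0..T, (∫ r, cutoff (n + 1) r ^ 2 * (sinh r)⁻¹
      * ((ψ (t + ε) r - ψ t r) * (ψ (t + ε) r - ψ t r))) ≤ ε * (A + A' / (n + 1))) :
    (∫ r in Ioi 0, sinh r * ((ψ' (T + ε) r + ψ' T r) * (ψ (T + ε) r - ψ T r)))
      - (∫ r in Ioi 0, sinh r * ((ψ' (0 + ε) r + ψ' 0 r) * (ψ (0 + ε) r - ψ 0 r)))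
      ≤ (∫ t in T..(T + ε), ∫ r in Ioi 0, lagrangianDensity ψ ψ' t r)
        - (∫ t in 0..(0 + ε), ∫ r in Ioi 0, lagrangianDensity ψ ψ' t r)
        + sinh (2 * M) * μ * (ε * A) := by
  obtain ⟨κ, hκ0, hκ⟩ := exists_deriv_cutoff_bound
  have hη : ∀ n : ℕ, IsTestFunction (cutoff (n + 1)) := fun n => isTestFunction_cutoff (by positivity)
  have hsM : 0 ≤ sinh (2 * M) := sinh_nonneg_iff.2 (by linarith)
  set Q : ℕ → ℝ → ℝ := fun n t => ∫ r, cutoff (n + 1) r ^ 2 * sinh r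
    * ((ψ' (t + ε) r + ψ' t r) * (ψ (t + ε) r - ψ t r)) with hQ
  set K : ℕ → ℝ → ℝ := fun n t => ∫ r, cutoff (n + 1) r ^ 2 * lagrangianDensity ψ ψ' t r with hK
  set Y : ℕ → ℝ → ℝ := fun n t => ∫ r, cutoff (n + 1) r ^ 2 * (sinh r)⁻¹
      * ((ψ (t + ε) r - ψ t r) * (ψ (t + ε) r - ψ t r)) with hY
  set G : ℝ → ℝ := fun t => 2 * twiceEnergy ψ ψ' (t + ε) + 2 * twiceEnergy ψ ψ' t
          + ∫ r in Ioi 0, (ψ (t + ε) r - ψ t r) ^ 2 * sinh r with hG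
  have cK : ∀ n, ContinuousOn (K n) (Ici 0) := fun n => (h.integrable_cutoff_lagrangian (hη n)).2
  have cKε : ∀ n, ContinuousOn (fun t => K n (t + ε)) (Ici 0) :=
    fun n => continuousOn_comp_add (cK n) hε.le
  have hΔ := h.contL2Loc_sub hε.le
  have cY : ∀ n, ContinuousOn (Y n) (Ici 0) := fun n => hΔ.continuousOn_integral_sq (by
    simpa [sq] using ((hη n).mul (hη n)).mul_inv_sinh)
  have cG : ContinuousOn G (Ici 0) := by
    have cE := h.continuousOn_twiceEnergy
    have cΦ := h.contL2_sub_initial.continuousOn_curve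
    have cΦε : ContinuousOn (fun t => curve (fun t r => √(sinh r) * (ψ t r - ψ 0 r)) (t + ε)) (Ici 0) :=
      cΦ.comp (by fun_prop) fun _ ht => mem_Ici.2 (add_nonneg ht hε.le)
    refine ((((continuousOn_comp_add cE hε.le).const_mul 2).add (cE.const_mul 2)).add
      ((cΦε.sub cΦ).norm.pow 2)).congr fun t ht => ?_
    simp only [hG, h.integral_sub_sq_eq (add_nonneg ht hε.le) ht]
    rfl
  have ii : ∀ {f : ℝ → ℝ}, ContinuousOn f (Ici 0) → IntervalIntegrable f volume 0 T :=
    fun hf => intervalIntegrable_of_continuousOn_Ici hf le_rfl hT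
  have step : ∀ n, Q n T - Q n 0 ≤ ((∫ t in T..(T + ε), K n t) - ∫ t in 0..(0 + ε), K n t)
      + sinh (2 * M) * μ * (ε * (A + A' / (n + 1))) + κ / (n + 1) * ∫ t in 0..T, G t := by
    intro n
    have hd : ∀ t ∈ Icc 0 T, ∃ D, HasDerivWithinAt (Q n) D (Ici 0) t ∧
        D ≤ K n (t + ε) - K n t + sinh (2 * M) * μ * Y n t + κ / (n + 1) * G t := fun t ht =>
      h.hasDerivWithinAt_difference (hη n) (cutoff_nonneg _) (cutoff_le_one _)
        (hκ _ (by positivity)) hε.le ht.1 (hM t ⟨ht.1, by linarith [ht.2]⟩)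
        (hM _ ⟨by linarith [ht.1], by linarith [ht.2]⟩) (hμ t ht) hμ1
    choose! D hD1 hD2 using hd
    have cφ : ContinuousOn (fun t => K n (t + ε) - K n t + sinh (2 * M) * μ * Y n t
        + κ / (n + 1) * G t) (Ici 0) :=
      (((cKε n).sub (cK n)).add ((cY n).const_mul _)).add (cG.const_mul _)
    have hsub : Icc 0 T ⊆ Ici 0 := fun x hx => hx.1
    have := intervalIntegral.sub_le_integral_of_hasDeriv_right_of_le hT
      (fun t ht => ((hD1 t ht).continuousWithinAt).mono hsub)
      (fun t ht => (hD1 t ⟨ht.1.le, ht.2.le⟩).mono fun x hx => (ht.1.trans hx).le)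
      (cφ.mono hsub).integrableOn_Icc (fun t ht => hD2 t ⟨ht.1.le, ht.2.le⟩)
    refine this.trans ?_
    rw [intervalIntegral.integral_add
        (((ii (cKε n)).sub (ii (cK n))).add ((ii (cY n)).const_mul _)) ((ii cG).const_mul _),
      intervalIntegral.integral_add ((ii (cKε n)).sub (ii (cK n))) ((ii (cY n)).const_mul _),
      integral_comp_add_sub (cK n) hT hε.le, intervalIntegral.integral_const_mul,
      intervalIntegral.integral_const_mul]
    have := mul_le_mul_of_nonneg_left (hA n) (mul_nonneg hsM hμ0)
    linarith
  have lQ : ∀ t, 0 ≤ t → Tendsto (fun n => Q n t) atTop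
      (𝓝 (∫ r in Ioi 0, sinh r * ((ψ' (t + ε) r + ψ' t r) * (ψ (t + ε) r - ψ t r)))) := fun t ht => by
    simpa only [hQ, mul_assoc] using tendsto_integral_cutoff (h.integral_difference_eq hε.le ht).1
  have lK : ∀ {a b : ℝ}, 0 ≤ a → 0 ≤ b → Tendsto (fun n => ∫ t in a..b, K n t) atTop
      (𝓝 (∫ t in a..b, ∫ r in Ioi 0, lagrangianDensity ψ ψ' t r)) := fun ha hb =>
    tendsto_intervalIntegral_of_abs_le ha hb cK h.continuousOn_twiceEnergy
      (fun n t ht => h.abs_integral_cutoff_lagrangian_le n ht)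
      fun t ht => tendsto_integral_cutoff (h.integrableOn_lagrangianDensity ht)
  have l0 : ∀ c : ℝ, Tendsto (fun n : ℕ => c / ((n : ℝ) + 1)) atTop (𝓝 0) := fun c => by
    simpa [div_eq_mul_inv] using (tendsto_one_div_add_atTop_nhds_zero_nat (𝕜 := ℝ)).const_mul c
  have lR := (((lK hT (by linarith : 0 ≤ T + ε)).sub (lK le_rfl (by linarith : 0 ≤ 0 + ε))).add
    ((((l0 A').const_add A).const_mul ε).const_mul (sinh (2 * M) * μ))).add
      ((l0 κ).mul_const (∫ t in 0..T, G t))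
  simpa only [add_zero, zero_mul] using
    le_of_tendsto_of_tendsto' ((lQ T hT).sub (lQ 0 le_rfl)) lR step

/-- The sum of velocities tends to 2 ψ_t and the difference quotient to ψ_t, both in norm. -/
theorem tendsto_difference (h : IsFiniteEnergyWaveMap lam ψ ψ') {t : ℝ} (ht : 0 ≤ t) :
    Tendsto (fun ε => ε⁻¹ * ∫ r in Ioi 0, sinh r
        * ((ψ' (t + ε) r + ψ' t r) * (ψ (t + ε) r - ψ t r))) (𝓝[>] 0)
      (𝓝 (2 * ∫ r in Ioi 0, ψ' t r ^ 2 * sinh r)) := by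
  have hV := h.contL2_velocity
  set V := curve fun t r => √(sinh r) * ψ' t r
  set Φ := curve fun t r => √(sinh r) * (ψ t r - ψ 0 r) with hΦ
  have hshift : Tendsto (fun ε => t + ε) (𝓝[>] 0) (𝓝[>] t) := by
    refine tendsto_nhdsWithin_iff.2 ⟨?_, ?_⟩
    · have : Tendsto (fun ε => t + ε) (𝓝 0) (𝓝 (t + 0)) := (continuous_const_add t).tendsto 0
      rw [add_zero] at this
      exact this.mono_left nhdsWithin_le_nhds
    · filter_upwards [self_mem_nhdsWithin] with ε hε
      exact lt_add_of_pos_right t hε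
  have hsub : Ioi t ⊆ Ici 0 := fun x hx => ht.trans (mem_Ioi.1 hx).le
  have l1 : Tendsto (fun ε => V (t + ε) + V t) (𝓝[>] 0) (𝓝 (V t + V t)) :=
    (((hV.continuousOn_curve t ht).mono hsub).tendsto.comp hshift).add_const _
  have l2 : Tendsto (fun ε => ε⁻¹ • (Φ (t + ε) - Φ t)) (𝓝[>] 0) (𝓝 (V t)) := by
    have := hasDerivWithinAt_iff_tendsto_slope.1 ((h.hasDerivWithinAt_curve ht).mono hsub)
    rw [sdiff_singleton_eq_self self_notMem_Ioi] at this
    refine (this.comp hshift).congr fun ε => ?_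
    simp [slope_def_module, hΦ]
  have l3 := l1.inner (𝕜 := ℝ) l2
  have e : inner ℝ (V t + V t) (V t) = 2 * ∫ r in Ioi 0, ψ' t r ^ 2 * sinh r := by
    rw [inner_add_left, hV.inner_curve hV ht ht, integral_velocity_sq, two_mul]
  rw [e] at l3
  refine l3.congr' ?_
  filter_upwards [self_mem_nhdsWithin] with ε hε
  rw [(h.integral_difference_eq (mem_Ioi.1 hε).le ht).2, inner_smul_right]

/-- The energy does not increase. -/
theorem twiceEnergy_le (h : IsFiniteEnergyWaveMap lam ψ ψ') {T : ℝ} (hT : 0 ≤ T) :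
    twiceEnergy ψ ψ' T ≤ twiceEnergy ψ ψ' 0 := by
  obtain ⟨M, hM0, hM⟩ := h.exists_abs_le (T + 1)
  obtain ⟨A, hA0, hA⟩ := h.exists_integral_sq_sub_le hT
  set K : ℝ → ℝ := fun t => ∫ r in Ioi 0, lagrangianDensity ψ ψ' t r with hK
  -- At fixed μ the limit ε → 0 compares twice the kinetic integral minus the Lagrangian at the
  -- times T and 0, and that combination is `twiceEnergy`. As A does not depend on μ, μ → 0 then
  -- removes the error.
  have key : ∀ μ, 0 < μ → μ ≤ 1 → twiceEnergy ψ ψ' T - twiceEnergy ψ ψ' 0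
      ≤ sinh (2 * M) * μ * A := by
    intro μ hμ0 hμ1
    -- The energy gap bounds the squared increment at every r, so a gap below μ² gives increments at
    -- most μ.
    obtain ⟨δ, hδ, hgap⟩ := h.exists_forall_gap_lt (T + 1) (pow_pos hμ0 2)
    have lL := (h.tendsto_difference hT).sub (h.tendsto_difference le_rfl)
    have lR := ((tendsto_average h.continuousOn_lagrangian hT).sub
      (tendsto_average h.continuousOn_lagrangian le_rfl)).add_const (sinh (2 * M) * μ * A)
    have hle := le_of_tendsto_of_tendsto lL lR (by
      filter_upwards [self_mem_nhdsWithin, nhdsWithin_le_nhds (Iio_mem_nhds hδ),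
        nhdsWithin_le_nhds (Iio_mem_nhds one_half_pos)] with ε h0 h1 h2
      have h0 : 0 < ε := h0
      have h1 : ε < δ := h1
      have h2 : ε < 1 / 2 := h2
      obtain ⟨A', -, hA'⟩ := hA ε h0 h2.le
      have hd := h.difference_le hT h0 hM0 (fun t ht => hM t ⟨ht.1, by linarith [ht.2]⟩) hμ0.le
        (fun t ht r hr => by
          refine abs_le_of_sq_le_sq ?_ hμ0.le
          refine (h.sq_sub_le_gap (by linarith [ht.1]) ht.1 hr).trans (hgap _ ⟨by linarith [ht.1],
            by linarith [ht.2]⟩ _ ⟨ht.1, by linarith [ht.2]⟩ ?_).le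
          rwa [dist_eq, add_sub_cancel_left, abs_of_pos h0]) hμ1 hA'
      have := mul_le_mul_of_nonneg_left hd (inv_pos.2 h0).le
      calc _ = ε⁻¹ * _ := (mul_sub _ _ _).symm
        _ ≤ _ := this
        _ = _ := by field_simp)
    rw [h.integral_lagrangianDensity hT, h.integral_lagrangianDensity le_rfl] at hle
    linarith
  have lim : Tendsto (fun μ => sinh (2 * M) * μ * A) (𝓝[>] 0) (𝓝 0) := by
    have : Tendsto (fun μ => sinh (2 * M) * μ * A) (𝓝 0) (𝓝 (sinh (2 * M) * 0 * A)) :=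
      ((continuous_const_mul _).mul_const _).tendsto 0
    simpa using this.mono_left nhdsWithin_le_nhds
  have := ge_of_tendsto lim (by
    filter_upwards [self_mem_nhdsWithin, nhdsWithin_le_nhds (Iio_mem_nhds one_pos)] with μ h0 h1
    exact key μ h0 (mem_Iio.1 h1).le)
  linarith

end IsFiniteEnergyWaveMap

/-! ### The energy of the harmonic map -/

variable {lam : ℝ}

theorem harmonicMap_le (h0 : 0 ≤ lam) (h1 : lam < 1) (r : ℝ) :
    harmonicMap lam r ≤ 2 * artanh lam := by
  have a := neg_one_lt_tanh (r / 2)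
  have b := tanh_lt_one (r / 2)
  refine mul_le_mul_of_nonneg_left ?_ zero_le_two
  refine strictMonoOn_artanh.monotoneOn ⟨?_, ?_⟩ ⟨by linarith, h1⟩ ?_ <;> nlinarith

/-- By the first order equation the integrand is the derivative of cosh P. -/
theorem integrableOn_sinh_sq_harmonicMap (h0 : 0 ≤ lam) (h1 : lam < 1) :
    IntegrableOn (fun r => sinh (harmonicMap lam r) ^ 2 / sinh r) (Ioi 0) ∧
      ∫ r in Ioi 0, sinh (harmonicMap lam r) ^ 2 / sinh r ≤ cosh (2 * artanh lam) - 1 := by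
  have hP : Continuous (harmonicMap lam) := (contDiff_harmonicMap h0 h1).continuous
  have hc : ContinuousOn (fun r => sinh (harmonicMap lam r) ^ 2 / sinh r) (Ioi 0) :=
    ((continuous_sinh.comp hP).pow 2).continuousOn.div continuous_sinh.continuousOn
      fun r hr => (sinh_pos_iff.2 hr).ne'
  refine integrableOn_of_intervalIntegral_le hc (fun r hr => ?_) fun a b ha hab => ?_
  · have := sinh_pos_iff.2 hr
    positivity
  have hsub : uIcc a b ⊆ Ioi 0 := by
    rw [uIcc_of_le hab]; exact fun x hx => ha.trans_le hx.1
  rw [intervalIntegral.integral_eq_sub_of_hasDerivAt (f := fun r => cosh (harmonicMap lam r))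
    (fun r hr => ((hasDerivAt_harmonicMap h0 h1 (hsub hr)).cosh).congr_deriv (by ring))
    (hc.mono hsub).intervalIntegrable]
  have hb := harmonicMap_nonneg h0 (ha.le.trans hab)
  have h2 := harmonicMap_le h0 h1 b
  have h3 : cosh (harmonicMap lam b) ≤ cosh (2 * artanh lam) :=
    cosh_le_cosh.2 (by rwa [abs_of_nonneg hb, abs_of_nonneg (hb.trans h2)])
  linarith [one_le_cosh (harmonicMap lam a)]

theorem memH_harmonicMap (h0 : 0 ≤ lam) (h1 : lam < 1) : MemH (harmonicMap lam) := by
  obtain ⟨hi, -⟩ := integrableOn_sinh_sq_harmonicMap h0 h1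
  have hP : Continuous (harmonicMap lam) := (contDiff_harmonicMap h0 h1).continuous
  refine ⟨.of_contDiffOn ((contDiff_harmonicMap h0 h1).of_le (by exact_mod_cast le_top)).contDiffOn,
    hi.congr_fun (fun r hr => ?_) measurableSet_Ioi, Integrable.mono' hi ?_ ?_⟩
  · have hs : 0 < sinh r := sinh_pos_iff.2 hr
    dsimp only
    rw [(hasDerivAt_harmonicMap h0 h1 hr).deriv]
    field_simp
  · exact ((hP.pow 2).continuousOn.div continuous_sinh.continuousOn
      fun r hr => (sinh_pos_iff.2 hr).ne').aestronglyMeasurable measurableSet_Ioi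
  · filter_upwards [ae_restrict_mem measurableSet_Ioi] with r hr
    have hs : 0 < sinh r := sinh_pos_iff.2 hr
    rw [norm_of_nonneg (by positivity)]
    gcongr ?_ / _
    exact sq_le_sinh_sq _

/-- Controls the quadratic quantities built from a wave map and its deviation from a harmonic
map. -/
noncomputable def deviationDensity (lam : ℝ) (ψ ψ' : ℝ → ℝ → ℝ) (t r : ℝ) : ℝ :=
  energyDensity ψ ψ' t r + sinh (harmonicMap lam r) ^ 2 / sinh r
    + (ψ t r - harmonicMap lam r) ^ 2 * sinh r

namespace IsFiniteEnergyWaveMap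

variable {ψ ψ' : ℝ → ℝ → ℝ}

/-- Bogomolny: (cosh ψ)_r = sinh ψ ψ_r is bounded by the energy density, integrated up to infinity.
It bounds the contribution of P by the energy of ψ and so makes the final constant independent of λ.
-/
theorem cosh_sub_one_le (h : IsFiniteEnergyWaveMap lam ψ ψ') {t : ℝ} (ht : 0 ≤ t) :
    cosh (2 * artanh lam) - 1 ≤ 1 / 2 * twiceEnergy ψ ψ' t := by
  have hm := h.mem_energyClass t ht
  have lim : Tendsto (fun b => cosh (ψ t b) - 1) atTop (𝓝 (cosh (2 * artanh lam) - 1)) :=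
    ((continuous_cosh.tendsto _).comp hm.tendsto_atTop).sub_const 1
  refine le_of_tendsto lim ?_
  filter_upwards [eventually_gt_atTop 0] with b hb
  have := (h.memH ht).comp_le (F := fun x => cosh x - 1) (F' := sinh) (contDiff_cosh.sub contDiff_const)
    (fun x => (hasDerivAt_cosh x).sub_const 1) hm.integrableOn_sinh (fun r _ => rfl) (by simp) hb
  have hv : 0 ≤ ∫ r in Ioi 0, ψ' t r ^ 2 * sinh r := setIntegral_nonneg measurableSet_Ioi
    fun r hr => mul_nonneg (sq_nonneg _) (sinh_pos_iff.2 hr).le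
  rw [h.twiceEnergy_eq ht]
  linarith

/-- In units of `twiceEnergy` the first two terms cost 1 + 1/2, and Hardy's inequality for the
deviation costs 12 + 6. -/
theorem deviation_le (h : IsFiniteEnergyWaveMap lam ψ ψ') (h0 : 0 ≤ lam) (h1 : lam < 1) {t : ℝ}
    (ht : 0 ≤ t) : IntegrableOn (deviationDensity lam ψ ψ' t) (Ioi 0) ∧
      ∫ r in Ioi 0, deviationDensity lam ψ ψ' t r ≤ 20 * twiceEnergy ψ ψ' t := by
  have hm := h.mem_energyClass t ht
  obtain ⟨iS, eS⟩ := integrableOn_sinh_sq_harmonicMap h0 h1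
  have hc := h.cosh_sub_one_le ht
  have hP := memH_harmonicMap h0 h1
  have hd := (h.memH ht).sub hP
  obtain ⟨iH, eH⟩ := hd.hardy (by simpa using hm.tendsto_atTop.sub (tendsto_harmonicMap h0 h1))
  have iE := h.integrableOn_energyDensity ht
  have hg : ∫ r in Ioi 0, deriv (fun r => ψ t r - harmonicMap lam r) r ^ 2 * sinh r
      ≤ ∫ r in Ioi 0, (2 * (deriv (ψ t) r ^ 2 * sinh r)
        + 2 * (sinh (harmonicMap lam r) ^ 2 / sinh r)) := by
    refine integral_mono_ae hd.grad (by exact (hm.integrableOn_grad.const_mul 2).add (iS.const_mul 2)) ?_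
    filter_upwards [ae_restrict_mem measurableSet_Ioi, (h.memH ht).ac.ae_hasDerivAt] with r hr h2
    have hs : 0 < sinh r := sinh_pos_iff.2 hr
    rw [(h2.fun_sub (hasDerivAt_harmonicMap h0 h1 hr)).deriv]
    have e : 2 * (deriv (ψ t) r ^ 2 * sinh r) + 2 * (sinh (harmonicMap lam r) ^ 2 / sinh r)
        - (deriv (ψ t) r - sinh (harmonicMap lam r) / sinh r) ^ 2 * sinh r
        = (deriv (ψ t) r + sinh (harmonicMap lam r) / sinh r) ^ 2 * sinh r := by
      field_simp; ring
    have : 0 ≤ (deriv (ψ t) r + sinh (harmonicMap lam r) / sinh r) ^ 2 * sinh r := by positivity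
    linarith
  rw [integral_add (by exact hm.integrableOn_grad.const_mul 2) (by exact iS.const_mul 2),
    integral_const_mul, integral_const_mul] at hg
  have hE := h.twiceEnergy_eq ht
  have p1 : 0 ≤ ∫ r in Ioi 0, ψ' t r ^ 2 * sinh r := setIntegral_nonneg measurableSet_Ioi
    fun r hr => mul_nonneg (sq_nonneg _) (sinh_pos_iff.2 hr).le
  have p2 : 0 ≤ ∫ r in Ioi 0, sinh (ψ t r) ^ 2 / sinh r := setIntegral_nonneg measurableSet_Ioi
    fun r hr => div_nonneg (sq_nonneg _) (sinh_pos_iff.2 hr).le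
  refine ⟨(iE.add iS).add iH, ?_⟩
  have e : ∫ r in Ioi 0, deviationDensity lam ψ ψ' t r = twiceEnergy ψ ψ' t
      + (∫ r in Ioi 0, sinh (harmonicMap lam r) ^ 2 / sinh r)
      + ∫ r in Ioi 0, (ψ t r - harmonicMap lam r) ^ 2 * sinh r := by
    rw [twiceEnergy, ← integral_add iE iS, ← integral_add (by exact iE.add iS) iH]
    rfl
  rw [e]
  linarith [twiceEnergy_nonneg (ψ := ψ) (ψ' := ψ') t]

end IsFiniteEnergyWaveMap

/-! ### The pointwise global Morawetz estimate -/

theorem abs_potential_le {a p : ℝ} (ha : cosh a ≤ 2) :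
    |potential a p| ≤ 3 * sinh p ^ 2 + 4 * sinh a ^ 2 := by
  have h1 := sq_le_sinh_sq a
  have h2 := sq_le_sinh_sq p
  have h3 : |(p - a) * sinh (2 * a)| ≤ 4 * sinh p ^ 2 + 6 * sinh a ^ 2 := by
    have e : (p - a) * sinh (2 * a) = 2 * cosh a * ((p - a) * sinh a) := by
      rw [sinh_two_mul]; ring
    have h4 : |(p - a) * sinh a| ≤ 1 / 2 * ((p - a) ^ 2 + sinh a ^ 2) := by
      simpa using abs_mul_le_of_pos (x := p - a) (y := sinh a) one_pos
    rw [e, abs_mul, abs_of_pos (by have := cosh_pos a; positivity)]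
    calc _ ≤ 2 * 2 * (1 / 2 * ((p - a) ^ 2 + sinh a ^ 2)) := by gcongr
      _ ≤ _ := by nlinarith [sq_nonneg (p + a)]
  have h5 := abs_le.1 h3
  have := sq_nonneg (sinh p)
  have := sq_nonneg (sinh a)
  rw [potential, abs_le]
  constructor <;> linarith

/-- With the weights η (cosh r − 1) and ½ η sinh r, the kinetic term and the cross term cancel where
η' = 0. The rest is s² = (c − 1)(c + 1). -/
theorem morawetz_density_eq {s c η η' a g f F G S pot : ℝ} (hs : 0 < s) (hc : 1 < c)
    (hcs : s ^ 2 = (c - 1) * (c + 1)) :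
    a ^ 2 * (1 / 2 * s * η - 1 / 2 * (η' * (c - 1) + η * s))
      + g ^ 2 * (η * (c - 1) * (c / s) - 1 / 2 * (η' * (c - 1) + η * s) - 1 / 2 * s * η)
      + (1 / 2 * s * η * (c / s) - (1 / 2 * (c * η + s * η'))) * (g * f)
      - 1 / 2 * s * η / s ^ 2 * (f * F)
      + ((η' * (c - 1) + η * s) / s ^ 2 - 2 * (η * (c - 1)) * c / s ^ 3) * pot
      + η * (c - 1) / s ^ 2 * (S / s * G)
      = -(η * ((c - 1) / s) * g ^ 2)
        - η / (s * (c + 1)) * (pot * (c - 1) + 1 / 2 * (c + 1) * (f * F) - S * G)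
        + η' * (-(1 / 2 * (c - 1) * (a ^ 2 + g ^ 2)) - 1 / 2 * s * (g * f)
          + (c - 1) / s ^ 2 * pot) := by
  have h1 : c - 1 ≠ 0 := by linarith
  have h2 : c + 1 ≠ 0 := by linarith
  have e1 : η * (c - 1) * (c / s) - 1 / 2 * (η' * (c - 1) + η * s) - 1 / 2 * s * η
      = -(η * ((c - 1) / s)) - 1 / 2 * η' * (c - 1) := by
    field_simp; linear_combination -2 * η * hcs
  have e2 : (η' * (c - 1) + η * s) / s ^ 2 - 2 * (η * (c - 1)) * c / s ^ 3
      = -(η / (s * (c + 1)) * (c - 1)) + η' * ((c - 1) / s ^ 2) := by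
    have h3 : η / (s * (c + 1)) = η * (c - 1) / s ^ 3 := by
      rw [div_eq_div_iff (by positivity) (by positivity)]; linear_combination η * s * hcs
    rw [h3]
    field_simp; linear_combination η * hcs
  have e3 : η * (c - 1) / s ^ 2 * (S / s * G) = η / (s * (c + 1)) * (S * G) := by
    have h3 : η / (s * (c + 1)) = η * (c - 1) / s ^ 3 := by
      rw [div_eq_div_iff (by positivity) (by positivity)]; linear_combination η * s * hcs
    rw [h3]; field_simp
  have e4 : 1 / 2 * s * η / s ^ 2 * (f * F) = η / (s * (c + 1)) * (1 / 2 * (c + 1) * (f * F)) := by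
    field_simp
  have e5 : 1 / 2 * s * η * (c / s) = 1 / 2 * c * η := by field_simp
  rw [e1, e2, e3, e4, e5]
  ring

/-- A cutoff derivative of size δ coth r is compensated by the weights, since c (c − 1) ≤ s² and c ≤
1 + s; the error is δ times an integrable density. -/
theorem morawetz_error_le {s c η' δ a b p q Sp Sq pot : ℝ} (hs : 0 < s) (hc : 1 < c) (hcs1 : c ≤ 1 + s)
    (hcs : s ^ 2 = (c - 1) * (c + 1)) (hη' : |η'| ≤ δ * (c / s)) (hp : p ^ 2 ≤ Sp ^ 2)
    (hq : q ^ 2 ≤ Sq ^ 2) (hpot : |pot| ≤ 3 * Sp ^ 2 + 4 * Sq ^ 2) :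
    η' * (-(1 / 2 * (c - 1) * (a ^ 2 + (b - Sq / s) ^ 2)) - 1 / 2 * s * ((b - Sq / s) * (p - q))
        + (c - 1) / s ^ 2 * pot)
      ≤ δ * (10 * ((a ^ 2 * s + b ^ 2 * s + Sp ^ 2 / s) + Sq ^ 2 / s + (p - q) ^ 2 * s)) := by
  have hδ : 0 ≤ δ := by
    by_contra hneg
    have : δ * (c / s) < 0 := mul_neg_of_neg_of_pos (not_le.1 hneg) (by positivity)
    linarith [abs_nonneg η']
  set g := b - Sq / s with hg
  have hgs : g ^ 2 * s ≤ 2 * (b ^ 2 * s) + 2 * (Sq ^ 2 / s) := by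
    have e : 2 * (b ^ 2 * s) + 2 * (Sq ^ 2 / s) - g ^ 2 * s = (b + Sq / s) ^ 2 * s := by
      rw [hg]; field_simp; ring
    have : 0 ≤ (b + Sq / s) ^ 2 * s := by positivity
    linarith
  have hfs : (p - q) ^ 2 / s ≤ 2 * (Sp ^ 2 / s) + 2 * (Sq ^ 2 / s) := by
    rw [← mul_div_assoc, ← mul_div_assoc, ← add_div]
    gcongr
    nlinarith [sq_nonneg (p + q)]
  have hcc : c * (c - 1) ≤ s ^ 2 := by rw [hcs]; nlinarith
  have h1 : c / s * (1 / 2 * (c - 1) * (a ^ 2 + g ^ 2)) ≤ 1 / 2 * (a ^ 2 * s + g ^ 2 * s) := by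
    calc _ = c * (c - 1) * (1 / 2 * (a ^ 2 + g ^ 2) / s) := by ring
      _ ≤ s ^ 2 * (1 / 2 * (a ^ 2 + g ^ 2) / s) := by gcongr
      _ = _ := by field_simp
  have h2 : c / s * |1 / 2 * s * (g * (p - q))|
      ≤ 1 / 2 * (g ^ 2 * s) + 1 / 4 * ((p - q) ^ 2 / s) + 1 / 4 * ((p - q) ^ 2 * s) := by
    have k1 := abs_mul_le_of_pos (x := g) (y := p - q) hs
    have k2 : |g * (p - q)| ≤ 1 / 2 * (g ^ 2 + (p - q) ^ 2) := by
      simpa using abs_mul_le_of_pos (x := g) (y := p - q) one_pos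
    have k3 := mul_le_mul_of_nonneg_left k2 hs.le
    calc _ = 1 / 2 * (c * |g * (p - q)|) := by
          rw [abs_mul, abs_of_pos (by positivity : 0 < 1 / 2 * s)]; field_simp
      _ ≤ 1 / 2 * ((1 + s) * |g * (p - q)|) := by gcongr
      _ ≤ _ := by linarith
  have h3 : c / s * |(c - 1) / s ^ 2 * pot| ≤ 3 * (Sp ^ 2 / s) + 4 * (Sq ^ 2 / s) := by
    have hc0 : 0 ≤ c - 1 := by linarith
    calc _ = c * (c - 1) * (|pot| / s ^ 3) := by
          rw [abs_mul, abs_of_nonneg (by positivity : 0 ≤ (c - 1) / s ^ 2)]; field_simp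
      _ ≤ s ^ 2 * ((3 * Sp ^ 2 + 4 * Sq ^ 2) / s ^ 3) := by gcongr
      _ = _ := by field_simp
  have hX : c / s * |-(1 / 2 * (c - 1) * (a ^ 2 + g ^ 2)) - 1 / 2 * s * (g * (p - q))
        + (c - 1) / s ^ 2 * pot|
      ≤ 10 * ((a ^ 2 * s + b ^ 2 * s + Sp ^ 2 / s) + Sq ^ 2 / s + (p - q) ^ 2 * s) := by
    have hc0 : 0 ≤ 1 / 2 * (c - 1) * (a ^ 2 + g ^ 2) := by
      have : 0 ≤ c - 1 := by linarith
      positivity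
    have t1 := abs_add_le (-(1 / 2 * (c - 1) * (a ^ 2 + g ^ 2)) - 1 / 2 * s * (g * (p - q)))
      ((c - 1) / s ^ 2 * pot)
    have t2 := abs_sub (-(1 / 2 * (c - 1) * (a ^ 2 + g ^ 2))) (1 / 2 * s * (g * (p - q)))
    rw [abs_neg, abs_of_nonneg hc0] at t2
    have t3 := mul_le_mul_of_nonneg_left (t1.trans (add_le_add_left t2 _))
      (by positivity : 0 ≤ c / s)
    have : 0 ≤ a ^ 2 * s := by positivity
    have : 0 ≤ b ^ 2 * s := by positivity
    have : 0 ≤ Sp ^ 2 / s := by positivity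
    have : 0 ≤ Sq ^ 2 / s := by positivity
    have : 0 ≤ (p - q) ^ 2 * s := by positivity
    rw [mul_add (c / s), mul_add (c / s)] at t3
    linarith
  calc _ ≤ |η'| * |-(1 / 2 * (c - 1) * (a ^ 2 + g ^ 2)) - 1 / 2 * s * (g * (p - q))
        + (c - 1) / s ^ 2 * pot| := by rw [← abs_mul]; exact le_abs_self _
    _ ≤ δ * (c / s) * |-(1 / 2 * (c - 1) * (a ^ 2 + g ^ 2)) - 1 / 2 * s * (g * (p - q))
        + (c - 1) / s ^ 2 * pot| := by gcongr
    _ ≤ _ := by rw [mul_assoc]; gcongr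

namespace IsFiniteEnergyWaveMap

variable {lam : ℝ} {ψ ψ' : ℝ → ℝ → ℝ}

theorem contL2Loc_sub_sq (h : IsFiniteEnergyWaveMap lam ψ ψ') (h0 : 0 ≤ lam) (h1 : lam < 1) :
    ContL2Loc fun t r => (ψ t r - harmonicMap lam r) ^ 2 := by
  have hP : Continuous (harmonicMap lam) := (contDiff_harmonicMap h0 h1).continuous
  have c1 := h.contL2Loc_comp (F := fun x => x ^ 2) (contDiff_id.pow 2) (by simp)
  have c2 := h.contL2Loc_self.mul_left (g := fun r => 2 * harmonicMap lam r)
    (continuous_const.mul hP).continuousOn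
  have c3 := ContL2Loc.of_continuousOn (hP.pow 2).continuousOn
  convert (c1.sub c2).add c3 using 3
  simp only [Pi.pow_apply]
  ring

theorem integral_le_of_le (h : IsFiniteEnergyWaveMap lam ψ ψ') (h0 : 0 ≤ lam) (h1 : lam < 1) {t : ℝ}
    (ht : 0 ≤ t) {k l : ℝ → ℝ} {C : ℝ} (hC : 0 ≤ C) (hk : Integrable k) (hl : Integrable l)
    (hkl : ∀ r, r ≤ 0 → k r = l r)
    (hle : ∀ r, 0 < r → k r ≤ l r + C * deviationDensity lam ψ ψ' t r) :
    ∫ r, k r ≤ (∫ r, l r) + C * (20 * twiceEnergy ψ ψ' 0) := by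
  obtain ⟨i, e⟩ := h.deviation_le h0 h1 ht
  refine (integral_le_add_of_le hk hl (i.const_mul C) hkl hle).trans ?_
  rw [integral_const_mul]
  have := h.twiceEnergy_le ht
  gcongr
  linarith

/-- The localised global Morawetz estimate. -/
theorem integral_cutoff_le (h : IsFiniteEnergyWaveMap lam ψ ψ') (h0 : 0 ≤ lam)
    (h3 : lam ^ 2 ≤ 1 / 3) {η : ℝ → ℝ} (hη : IsTestFunction η) (hη0 : ∀ r, 0 ≤ η r)
    (hη1 : ∀ r, η r ≤ 1) {δ : ℝ} (hδ0 : 0 ≤ δ)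
    (hδ : ∀ r, 0 < r → |deriv η r| ≤ δ * (cosh r / sinh r)) {T : ℝ} (hT : 0 ≤ T) :
    ∫ t in 0..T, (∫ r, η r * (sinh r)⁻¹
        * ((ψ t r - harmonicMap lam r) ^ 2 * (ψ t r - harmonicMap lam r) ^ 2))
      ≤ 420 * (80 + 200 * δ * T) * twiceEnergy ψ ψ' 0 := by
  have h1 : lam < 1 := by nlinarith
  have hv : IsTestFunction fun r => η r * (1 / 2 * sinh r) :=
    hη.mul_contDiffOn (contDiff_const.mul contDiff_sinh).contDiffOn
  have hw : IsTestFunction fun r => η r * (cosh r - 1) :=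
    hη.mul_contDiffOn (contDiff_cosh.sub contDiff_const).contDiffOn
  have hω : IsTestFunction fun r => η r * (sinh r)⁻¹ := hη.mul_inv_sinh
  have c4 := h.contL2Loc_sub_sq h0 h1
  have hW := h.weakWave h0 h1
  have hcs : ∀ r, sinh r ^ 2 = (cosh r - 1) * (cosh r + 1) := fun r => by
    linear_combination -cosh_sq r
  have hc1 : ∀ r, 0 < r → cosh r ≤ 1 + sinh r := fun r hr => by
    have := cosh_sub_sinh r
    have : exp (-r) ≤ 1 := exp_le_one_iff.2 (by linarith)
    linarith
  have hd := fun r => hη.differentiable.differentiableAt.hasDerivAt (x := r)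
  have dw : ∀ r, deriv (fun r => η r * (cosh r - 1)) r = deriv η r * (cosh r - 1) + η r * sinh r :=
    fun r => ((hd r).fun_mul ((hasDerivAt_cosh r).sub_const 1)).deriv
  have dv : ∀ r, deriv (fun r => η r * (1 / 2 * sinh r)) r
      = 1 / 2 * (cosh r * η r + sinh r * deriv η r) := fun r => by
    rw [((hd r).fun_mul ((hasDerivAt_sinh r).const_mul (1 / 2))).deriv]; ring
  set I : ℝ → ℝ := fun t => ∫ r, η r * (sinh r)⁻¹
    * ((ψ t r - harmonicMap lam r) ^ 2 * (ψ t r - harmonicMap lam r) ^ 2) with hI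
  have cI : ContinuousOn I (Ici 0) := c4.continuousOn_integral_sq hω
  have hslope : ∀ t, 0 ≤ t → ∫ r, morawetzDensity lam (fun r => η r * (cosh r - 1))
      (fun r => η r * (1 / 2 * sinh r)) ψ ψ' t r
      ≤ -(1 / 420) * I t + δ * 10 * (20 * twiceEnergy ψ ψ' 0) := by
    intro t ht
    have im := (h.morawetz_identity h0 h1 hw hv ht).1
    have i4 := c4.integrable_mul_mul c4 hω ht ht
    rw [hI, ← integral_const_mul]
    refine h.integral_le_of_le h0 h1 ht (by positivity) im (i4.const_mul _) (fun r hr => ?_)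
      fun r hr => ?_
    · simp only [morawetzDensity, hη.eq_zero hr, hw.deriv.eq_zero hr, hv.deriv.eq_zero hr]; ring
    have hs : 0 < sinh r := sinh_pos_iff.2 hr
    have hc : 1 < cosh r := one_lt_cosh.2 hr.ne'
    obtain ⟨hC2, hC3⟩ := cosh_harmonicMap_le h0 h3 r
    have hpt := morawetz_pointwise (p := ψ t r) (harmonicMap_nonneg h0 hr.le) hC2 hC3
    have herr := morawetz_error_le (a := ψ' t r) (b := deriv (ψ t) r) hs hc (hc1 r hr) (hcs r)
      (hδ r hr) (sq_le_sinh_sq (ψ t r)) (sq_le_sinh_sq (harmonicMap lam r)) (abs_potential_le hC2)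
    have e := morawetz_density_eq (η := η r) (η' := deriv η r) (a := ψ' t r)
      (g := deriv (ψ t) r - sinh (harmonicMap lam r) / sinh r) (f := ψ t r - harmonicMap lam r)
      (F := 1 / 2 * (sinh (2 * ψ t r) - sinh (2 * harmonicMap lam r)))
      (G := 1 / 2 * (sinh (2 * ψ t r) - sinh (2 * harmonicMap lam r)
        - 2 * (ψ t r - harmonicMap lam r) * cosh (2 * harmonicMap lam r)))
      (S := sinh (harmonicMap lam r)) (pot := potential (harmonicMap lam r) (ψ t r)) hs hc (hcs r)
    have e1 : morawetzDensity lam (fun r => η r * (cosh r - 1))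
        (fun r => η r * (1 / 2 * sinh r)) ψ ψ' t r = _ := Eq.trans (by
          rw [morawetzDensity, dw, dv, potentialDrift]; ring) e
    have hm : η r / (sinh r * (cosh r + 1)) * ((cosh r + 1) * (ψ t r - harmonicMap lam r) ^ 4 / 420)
        ≤ η r / (sinh r * (cosh r + 1)) * _ :=
      mul_le_mul_of_nonneg_left hpt (div_nonneg (hη0 r) (by positivity))
    have hz : 0 ≤ η r * ((cosh r - 1) / sinh r)
        * (deriv (ψ t) r - sinh (harmonicMap lam r) / sinh r) ^ 2 :=
      mul_nonneg (mul_nonneg (hη0 r) (div_nonneg (by linarith) hs.le)) (sq_nonneg _)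
    have e2 : η r / (sinh r * (cosh r + 1))
        * ((cosh r + 1) * (ψ t r - harmonicMap lam r) ^ 4 / 420)
        = 1 / 420 * (η r * (sinh r)⁻¹
          * ((ψ t r - harmonicMap lam r) ^ 2 * (ψ t r - harmonicMap lam r) ^ 2)) := by
      have : cosh r + 1 ≠ 0 := by linarith
      field_simp
    rw [e2] at hm
    rw [e1, deviationDensity, energyDensity, mul_assoc δ 10]
    linarith
  have hM : ∀ t, 0 ≤ t → |(∫ r, η r * (cosh r - 1) * (ψ' t r * (deriv (ψ t) r
      - sinh (harmonicMap lam r) / sinh r)))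
      + ∫ r, η r * (1 / 2 * sinh r) * (ψ' t r * (ψ t r - harmonicMap lam r))|
      ≤ 40 * twiceEnergy ψ ψ' 0 := by
    intro t ht
    obtain ⟨iD, eD⟩ := h.deviation_le h0 h1 ht
    have hE := h.twiceEnergy_le ht
    have bound : ∀ {k : ℝ → ℝ}, (∀ r, r ≤ 0 → k r = 0) →
        (∀ r, 0 < r → |k r| ≤ deviationDensity lam ψ ψ' t r) →
        |∫ r, k r| ≤ 20 * twiceEnergy ψ ψ' 0 := by
      intro k k0 hk
      rw [← integral_Ioi_eq (k := k) (fun r _ => rfl) k0, ← Real.norm_eq_abs]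
      have := norm_integral_le_of_norm_le (f := k) iD
        ((ae_restrict_mem measurableSet_Ioi).mono fun r hr => hk r hr)
      linarith
    have b1 := bound (k := fun r => η r * (cosh r - 1) * (ψ' t r * (deriv (ψ t) r
      - sinh (harmonicMap lam r) / sinh r))) (fun r hr => by simp [hη.eq_zero hr]) (fun r hr => by
        have hs : 0 < sinh r := sinh_pos_iff.2 hr
        have hc := one_le_cosh r
        have k1 : |ψ' t r * (deriv (ψ t) r - sinh (harmonicMap lam r) / sinh r)|
            ≤ 1 / 2 * (ψ' t r ^ 2 + (deriv (ψ t) r - sinh (harmonicMap lam r) / sinh r) ^ 2) := by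
          simpa using abs_mul_le_of_pos (x := ψ' t r)
            (y := deriv (ψ t) r - sinh (harmonicMap lam r) / sinh r) one_pos
        have k2 : |η r * (cosh r - 1)| ≤ sinh r := by
          rw [abs_of_nonneg (mul_nonneg (hη0 r) (by linarith))]
          have := mul_le_of_le_one_left (by linarith : 0 ≤ cosh r - 1) (hη1 r)
          linarith [hc1 r hr]
        have e : 2 * (deriv (ψ t) r ^ 2 * sinh r) + 2 * (sinh (harmonicMap lam r) ^ 2 / sinh r)
            - (deriv (ψ t) r - sinh (harmonicMap lam r) / sinh r) ^ 2 * sinh r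
            = (deriv (ψ t) r + sinh (harmonicMap lam r) / sinh r) ^ 2 * sinh r := by
          field_simp; ring
        have p1 : 0 ≤ (deriv (ψ t) r + sinh (harmonicMap lam r) / sinh r) ^ 2 * sinh r := by positivity
        have p2 : 0 ≤ ψ' t r ^ 2 * sinh r := by positivity
        have p3 : 0 ≤ sinh (ψ t r) ^ 2 / sinh r := by positivity
        have p4 : 0 ≤ (ψ t r - harmonicMap lam r) ^ 2 * sinh r := by positivity
        rw [abs_mul, deviationDensity, energyDensity]
        calc _ ≤ sinh r * (1 / 2 * (ψ' t r ^ 2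
              + (deriv (ψ t) r - sinh (harmonicMap lam r) / sinh r) ^ 2)) := by gcongr
          _ ≤ _ := by linarith)
    have b2 := bound (k := fun r => η r * (1 / 2 * sinh r) * (ψ' t r * (ψ t r - harmonicMap lam r)))
      (fun r hr => by simp [hη.eq_zero hr]) (fun r hr => by
        have hs : 0 < sinh r := sinh_pos_iff.2 hr
        have k1 : |ψ' t r * (ψ t r - harmonicMap lam r)|
            ≤ 1 / 2 * (ψ' t r ^ 2 + (ψ t r - harmonicMap lam r) ^ 2) := by
          simpa using abs_mul_le_of_pos (x := ψ' t r) (y := ψ t r - harmonicMap lam r) one_pos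
        have k2 : |η r * (1 / 2 * sinh r)| ≤ 1 / 2 * sinh r := by
          rw [abs_of_nonneg (mul_nonneg (hη0 r) (by positivity))]
          exact mul_le_of_le_one_left (by positivity) (hη1 r)
        have p1 : 0 ≤ deriv (ψ t) r ^ 2 * sinh r := by positivity
        have p2 : 0 ≤ ψ' t r ^ 2 * sinh r := by positivity
        have p3 : 0 ≤ sinh (ψ t r) ^ 2 / sinh r := by positivity
        have p4 : 0 ≤ (ψ t r - harmonicMap lam r) ^ 2 * sinh r := by positivity
        have p5 : 0 ≤ sinh (harmonicMap lam r) ^ 2 / sinh r := by positivity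
        rw [abs_mul, deviationDensity, energyDensity]
        calc _ ≤ 1 / 2 * sinh r * (1 / 2 * (ψ' t r ^ 2 + (ψ t r - harmonicMap lam r) ^ 2)) := by
              gcongr
          _ ≤ _ := by linarith)
    refine (abs_add_le _ _).trans ?_
    linarith
  have hfin := sub_le_integral_of_hasDerivWithinAt hT
    (fun t ht => (h.morawetz_identity h0 h1 hw hv ht).2)
    (φ := fun t => -(1 / 420) * I t + δ * 10 * (20 * twiceEnergy ψ ψ' 0))
    ((cI.const_mul _).add continuousOn_const) hslope
  rw [intervalIntegral.integral_add
      ((intervalIntegrable_of_continuousOn_Ici cI le_rfl hT).const_mul _) intervalIntegrable_const,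
    intervalIntegral.integral_const_mul, intervalIntegral.integral_const, smul_eq_mul,
    sub_zero] at hfin
  -- The functional contributes 40 at each end, the cutoff error 10 · 20 per unit of time.
  have m1 := abs_le.1 (hM T hT)
  have m2 := abs_le.1 (hM 0 le_rfl)
  linarith

end IsFiniteEnergyWaveMap

theorem abs_fourDim_pow_mul {lam : ℝ} {ψ : ℝ → ℝ → ℝ} {t r : ℝ} (hr : 0 < r) :
    |fourDim lam ψ t r| ^ 4 * sinh r ^ 3
      = (sinh r)⁻¹ * ((ψ t r - harmonicMap lam r) ^ 2 * (ψ t r - harmonicMap lam r) ^ 2) := by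
  have hs : 0 < sinh r := sinh_pos_iff.2 hr
  rw [show |fourDim lam ψ t r| ^ 4 = (fourDim lam ψ t r ^ 2) ^ 2 by
    rw [← sq_abs (fourDim lam ψ t r)]; ring, fourDim]
  field_simp

namespace IsFiniteEnergyWaveMap

variable {lam : ℝ} {ψ ψ' : ℝ → ℝ → ℝ}

/-- Fatou's lemma in r and then in t, with one index n for the spatial cutoff and for the time
horizon: δ T = κ / (n + 1) · (n + 1) stays bounded. -/
theorem lintegral_fourDim_le (h : IsFiniteEnergyWaveMap lam ψ ψ') (h0 : 0 ≤ lam)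
    (h3 : lam ^ 2 ≤ 1 / 3) {κ : ℝ} (hκ0 : 0 ≤ κ) (hκ : ∀ N : ℝ, 0 < N → ∀ r : ℝ, 0 < r →
      |deriv (cutoff N) r| ≤ κ / N * (cosh r / sinh r)) :
    ∫⁻ t in Ici (0 : ℝ), ∫⁻ r in Ioi (0 : ℝ), ENNReal.ofReal (|fourDim lam ψ t r| ^ 4 * sinh r ^ 3)
      ≤ ENNReal.ofReal (420 * (80 + 200 * κ) * twiceEnergy ψ ψ' 0) := by
  have h1 : lam < 1 := by nlinarith
  have c4 := h.contL2Loc_sub_sq h0 h1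
  have hη : ∀ n : ℕ, IsTestFunction (cutoff (n + 1)) := fun n => isTestFunction_cutoff (by positivity)
  have hω : ∀ n : ℕ, IsTestFunction fun r => cutoff (n + 1) r * (sinh r)⁻¹ :=
    fun n => (hη n).mul_inv_sinh
  set f : ℝ → ℝ → ℝ := fun t r => (sinh r)⁻¹
    * ((ψ t r - harmonicMap lam r) ^ 2 * (ψ t r - harmonicMap lam r) ^ 2) with hf
  set I : ℕ → ℝ → ℝ := fun n t => ∫ r, cutoff (n + 1) r * (sinh r)⁻¹
    * ((ψ t r - harmonicMap lam r) ^ 2 * (ψ t r - harmonicMap lam r) ^ 2) with hI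
  have cI : ∀ n, ContinuousOn (I n) (Ici 0) := fun n => c4.continuousOn_integral_sq (hω n)
  have nn : ∀ (n : ℕ) (t r : ℝ), 0 < r → 0 ≤ cutoff (n + 1) r * f t r := fun n t r hr =>
    mul_nonneg (cutoff_nonneg _ _) (mul_nonneg (inv_pos.2 (sinh_pos_iff.2 hr)).le
      (mul_nonneg (sq_nonneg _) (sq_nonneg _)))
  have hIi : ∀ (n : ℕ) (t : ℝ), 0 ≤ t → ∫⁻ r in Ioi 0, ENNReal.ofReal (cutoff (n + 1) r * f t r)
      = ENNReal.ofReal (I n t) := by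
    intro n t ht
    have i4 := (c4.integrable_mul_mul c4 (hω n) ht ht)
    have e : I n t = ∫ r in Ioi 0, cutoff (n + 1) r * f t r :=
      (integral_Ioi_eq (fun r _ => by rw [hf, mul_assoc]) fun r hr => by
        rw [(hη n).eq_zero hr]; ring).symm
    rw [e, ofReal_integral_eq_lintegral_ofReal]
    · simpa only [hf, mul_assoc, IntegrableOn] using i4.integrableOn (s := Ioi 0)
    · filter_upwards [ae_restrict_mem measurableSet_Ioi] with r hr using nn n t r hr
  have nI : ∀ (n : ℕ) (t : ℝ), 0 ≤ I n t := fun n t => by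
    have e : I n t = ∫ r in Ioi 0, cutoff (n + 1) r * f t r :=
      (integral_Ioi_eq (fun r _ => by rw [hf, mul_assoc]) fun r hr => by
        rw [(hη n).eq_zero hr]; ring).symm
    rw [e]
    exact setIntegral_nonneg measurableSet_Ioi (nn n t)
  set F : ℕ → ℝ → ℝ≥0∞ := fun n => (Ioc 0 ((n : ℝ) + 1)).indicator fun t => ENNReal.ofReal (I n t)
    with hF
  have inner : ∀ t, 0 < t → ∫⁻ r in Ioi 0, ENNReal.ofReal (|fourDim lam ψ t r| ^ 4 * sinh r ^ 3)
      ≤ liminf (fun n => F n t) atTop := by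
    intro t ht
    have e1 : liminf (fun n => F n t) atTop
        = liminf (fun n : ℕ => ∫⁻ r in Ioi 0, ENNReal.ofReal (cutoff (n + 1) r * f t r)) atTop := by
      refine liminf_congr ?_
      filter_upwards [eventually_ge_atTop ⌈t⌉₊] with n hn
      have : t ≤ n := (Nat.le_ceil t).trans (by exact_mod_cast hn)
      have hmem : t ∈ Ioc (0 : ℝ) (n + 1) := ⟨ht, by linarith⟩
      rw [hF, hIi n t ht.le]
      exact indicator_of_mem hmem _
    rw [e1]
    refine le_trans (le_of_eq ?_) (lintegral_liminf_le' fun n => ?_)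
    · refine setLIntegral_congr_fun measurableSet_Ioi fun r hr => ?_
      have hlim : Tendsto (fun n : ℕ => ENNReal.ofReal (cutoff (n + 1) r * f t r)) atTop
          (𝓝 (ENNReal.ofReal (1 * f t r))) :=
        ENNReal.tendsto_ofReal ((tendsto_cutoff hr).mul_const _)
      rw [hlim.liminf_eq, one_mul, abs_fourDim_pow_mul hr]
    · have i4 := (c4.integrable_mul_mul c4 (hω n) ht.le ht.le).integrableOn (s := Ioi 0)
      simp only [mul_assoc] at i4
      exact i4.aestronglyMeasurable.aemeasurable.ennreal_ofReal
  rw [setLIntegral_congr Ioi_ae_eq_Ici.symm]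
  refine (setLIntegral_mono_ae' measurableSet_Ioi (Eventually.of_forall inner)).trans ?_
  refine (lintegral_liminf_le' fun n => ?_).trans ?_
  · have : AEMeasurable (I n) (volume.restrict (Ioi 0)) :=
      ((cI n).mono Ioi_subset_Ici_self).aemeasurable measurableSet_Ioi
    exact this.ennreal_ofReal.indicator measurableSet_Ioc
  refine liminf_le_of_le (by isBoundedDefault) fun b hb => ?_
  obtain ⟨n, hn⟩ := hb.exists
  refine hn.trans ?_
  have hT : (0 : ℝ) ≤ n + 1 := by positivity
  have e2 : ∫⁻ t in Ioi 0, F n t = ENNReal.ofReal (∫ t in 0..((n : ℝ) + 1), I n t) := by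
    rw [hF, lintegral_indicator measurableSet_Ioc, Measure.restrict_restrict measurableSet_Ioc,
      inter_eq_self_of_subset_left Ioc_subset_Ioi_self, intervalIntegral.integral_of_le hT,
      ofReal_integral_eq_lintegral_ofReal]
    · exact (intervalIntegrable_iff_integrableOn_Ioc_of_le hT).1
        (intervalIntegrable_of_continuousOn_Ici (cI n) le_rfl hT)
    · exact Eventually.of_forall fun t => nI n t
  rw [e2]
  refine ENNReal.ofReal_le_ofReal ?_
  have := h.integral_cutoff_le h0 h3 (hη n) (cutoff_nonneg _) (cutoff_le_one _)
    (δ := κ / (n + 1)) (by positivity) (hκ _ (by positivity)) hT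
  rwa [show 200 * (κ / ((n : ℝ) + 1)) * (n + 1) = 200 * κ by field_simp] at this

end IsFiniteEnergyWaveMap

end HypWaveMap

theorem mainTheorem2 :
    ∃ (Λ : ℝ) (C : ℝ≥0), 1 / 2 ≤ Λ ∧ 57716 / 100000 ≤ Λ ∧ Λ < 57717 / 100000 ∧
      ∀ lam : ℝ, 0 ≤ lam → lam ≤ Λ →
        ∀ ψ ψ' : ℝ → ℝ → ℝ, HypWaveMap.IsFiniteEnergyWaveMap lam ψ ψ' →
          ∫⁻ t in Ici (0 : ℝ), ∫⁻ r in Ioi (0 : ℝ),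
              ENNReal.ofReal (|HypWaveMap.fourDim lam ψ t r| ^ 4 * sinh r ^ 3)
            ≤ (C : ℝ≥0∞) * HypWaveMap.energy (ψ 0) (ψ' 0) := by
  obtain ⟨κ, hκ0, hκ⟩ := HypWaveMap.exists_deriv_cutoff_bound
  -- The square of this Λ is below 1/3; 840 is twice 420 because the energy is half of
  -- `twiceEnergy`.
  refine ⟨57716 / 100000, (840 * (80 + 200 * κ)).toNNReal, by norm_num, le_rfl, by norm_num,
    fun lam h0 h1 ψ ψ' h => ?_⟩
  have h3 : lam ^ 2 ≤ 1 / 3 := (pow_le_pow_left₀ h0 h1 2).trans (by norm_num)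
  refine (h.lintegral_fourDim_le h0 h3 hκ0 hκ).trans (le_of_eq ?_)
  rw [h.energy_eq le_rfl, ← ENNReal.ofReal, ← ENNReal.ofReal_mul (by positivity)]
  congr 1
  ring
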